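/- Let $k$ be a field. All Hopf algebras are over $k$. (1) For every finite-dimensional Hopf algebra $A$ that is not semisimple as a ring there is a Hopf algebra $H$, which may be chosen with bijective antipode, containing $A$ as a Hopf subalgebra (i.e. there is an injective Hopf algebra homomorphism $A\to H$), such that $H$ is flat over $A$ neither as a left nor as a right module. (2) More specifically, let $A$ be a nonsemisimple finite-dimensional Hopf algebra with antipode $S$. For a finite-dimensional left $A$-module $V$ with representation $\tau:A\to\operatorname{End}_kV$, let $A$ act on $\operatorname{End}_kV$ by $a\triangleright\beta=\sum\tau(a_{(1)})\,\beta\,\tau(S a_{(2)})$, and let $\operatorname{Coend}V=(\operatorname{End}_kV)^*$ be the coalgebra dual to the algebra $\operatorname{End}_kV$, with the right $A$-action $(\xi a)(\beta)=\xi(a\triangleright\beta)$; it is a right $A$-module coalgebra. For a right $A$-module coalgebra $C$ let $H(C,A)$ be the free Hopf algebra on $C$, i.e. the Hopf algebra in the initial object of the category of triples $(H,f,\varphi)$, where $H$ is a Hopf algebra, $f:C\to H$ is a coalgebra homomorphism, and $\varphi:A\to H$ is a Hopf algebra homomorphism with $f(ca)=f(c)\varphi(a)$ for all $c\in C$, $a\in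 A$. Then there exist finite-dimensional nonprojective left $A$-modules $V$ that have a direct summand isomorphic to the free cyclic module $A$. For every such $V$ the Hopf algebra $H(\operatorname{Coend}V,A)$ exists, its canonical map $A\to H(\operatorname{Coend}V,A)$ is injective, and $H(\operatorname{Coend}V,A)$ is neither left nor right flat over $A$. (3) Consequently Schauenburg's question, whether every Hopf algebra with bijective antipode is faithfully flat over all its Hopf subalgebras with bijective antipode, has a negative answer: over every field $k$ there are a Hopf algebra $H$ with bijective antipode and a Hopf subalgebra $A$ of $H$ with bijective antipode such that $H$ is neither left nor right flat over $A$, hence on neither side faithfully flat. -/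

import Mathlib

open scoped TensorProduct
open MulOpposite Coalgebra WithConv

universe u

noncomputable section

/-! ### Tensor products and flatness over a noncommutative ring -/

section Flatness

variable (R : Type*) [Ring R]

/-- The relations `(m r) ⊗ n = m ⊗ (r n)` defining `M ⊗_R N` inside `M ⊗_ℤ N`. -/
def balancedRel (M N : Type*) [AddCommGroup M] [Module Rᵐᵒᵖ M] [AddCommGroup N] [Module R N] :
    AddSubgroup (M ⊗[ℤ] N) :=
  AddSubgroup.closure
    {t | ∃ (m : M) (r : R) (n : N), t = (op r • m) ⊗ₜ[ℤ] n - m ⊗ₜ[ℤ] (r • n)}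

/-- The tensor product `M ⊗_R N` of a right `R`-module `M` and a left `R`-module `N`
over a possibly noncommutative ring `R`; right modules are modules over `Rᵐᵒᵖ`. -/
abbrev BalancedTensor (M N : Type*) [AddCommGroup M] [Module Rᵐᵒᵖ M]
    [AddCommGroup N] [Module R N] : Type _ :=
  (M ⊗[ℤ] N) ⧸ balancedRel R M N

variable {R}

/-- The map `f ⊗ id : M ⊗_R N → M' ⊗_R N` induced by a map `f` of right modules. -/
def BalancedTensor.mapLeft {M M' : Type*} [AddCommGroup M] [Module Rᵐᵒᵖ M]
    [AddCommGroup M'] [Module Rᵐᵒᵖ M'] (f : M →ₗ[Rᵐᵒᵖ] M')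
    (N : Type*) [AddCommGroup N] [Module R N] :
    BalancedTensor R M N →+ BalancedTensor R M' N :=
  QuotientAddGroup.map _ _ (f.toAddMonoidHom.toIntLinearMap.rTensor N).toAddMonoidHom (by
    refine (AddSubgroup.closure_le _).2 ?_
    rintro _ ⟨m, r, n, rfl⟩
    refine AddSubgroup.subset_closure ⟨f m, r, n, ?_⟩
    simp)

/-- The map `id ⊗ g : M ⊗_R N → M ⊗_R N'` induced by a map `g` of left modules. -/
def BalancedTensor.mapRight (M : Type*) [AddCommGroup M] [Module Rᵐᵒᵖ M]
    {N N' : Type*} [AddCommGroup N] [Module R N] [AddCommGroup N'] [Module R N']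
    (g : N →ₗ[R] N') :
    BalancedTensor R M N →+ BalancedTensor R M N' :=
  QuotientAddGroup.map _ _ (g.toAddMonoidHom.toIntLinearMap.lTensor M).toAddMonoidHom (by
    refine (AddSubgroup.closure_le _).2 ?_
    rintro _ ⟨m, r, n, rfl⟩
    refine AddSubgroup.subset_closure ⟨m, r, g n, ?_⟩
    simp)

/-- A left `R`-module `N` is flat if `- ⊗_R N` preserves injective maps of right modules. -/
def IsFlatLeft (R N : Type u) [Ring R] [AddCommGroup N] [Module R N] : Prop :=
  ∀ (M M' : Type u) [AddCommGroup M] [Module Rᵐᵒᵖ M] [AddCommGroup M'] [Module Rᵐᵒᵖ M']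
    (f : M →ₗ[Rᵐᵒᵖ] M'), Function.Injective f → Function.Injective (BalancedTensor.mapLeft f N)

/-- A right `R`-module `M` is flat if `M ⊗_R -` preserves injective maps of left modules. -/
def IsFlatRight (R M : Type u) [Ring R] [AddCommGroup M] [Module Rᵐᵒᵖ M] : Prop :=
  ∀ (N N' : Type u) [AddCommGroup N] [Module R N] [AddCommGroup N'] [Module R N']
    (g : N →ₗ[R] N'), Function.Injective g → Function.Injective (BalancedTensor.mapRight M g)

/-- `H` is flat as a left `A`-module, with action `a • h = φ a * h`. -/
def LeftFlatOver {A H : Type u} [Ring A] [Ring H] (φ : A →+* H) : Prop :=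
  letI : Module A H := Module.compHom H φ
  IsFlatLeft A H

/-- `H` is flat as a right `A`-module, with action `h • a = h * φ a`. -/
def RightFlatOver {A H : Type u} [Ring A] [Ring H] (φ : A →+* H) : Prop :=
  letI : Module Aᵐᵒᵖ H := Module.compHom H (RingHom.op φ)
  IsFlatRight A H

end Flatness

/-! ### Module coalgebras and free Hopf algebras on them -/

section ModuleCoalgebra

/-- A right `A`-module coalgebra: a coalgebra with a `k`-bilinear right `A`-action such that
`ε(c a) = ε(c) ε(a)` and `Δ(c a) = ∑ c₍₁₎ a₍₁₎ ⊗ c₍₂₎ a₍₂₎`. -/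
class IsRightModuleCoalgebra (k A C : Type*) [Field k] [Ring A] [Bialgebra k A]
    [AddCommGroup C] [Module k C] [Coalgebra k C] [Module Aᵐᵒᵖ C] : Prop
    extends IsScalarTower k Aᵐᵒᵖ C where
  counit_smul (a : A) (c : C) :
    counit (R := k) (op a • c) = counit (R := k) c * counit (R := k) a
  comul_smul (a : A) (c : C) :
    comul (R := k) (op a • c) = ∑ i ∈ (ℛ k c).index, ∑ j ∈ (ℛ k a).index,
      (op ((ℛ k a).left j) • (ℛ k c).left i) ⊗ₜ[k] (op ((ℛ k a).right j) • (ℛ k c).right i)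

/-- The triples `(H, f, φ)` considered in the definition of the free Hopf algebra: `f : C → H` is
a coalgebra homomorphism and `φ : A → H` is a homomorphism of Hopf algebras with
`f(c a) = f(c) φ(a)`. A bialgebra homomorphism between Hopf algebras is automatically
compatible with the antipodes. -/
def IsCompatible {k A C H : Type*} [Field k] [Ring A] [HopfAlgebra k A]
    [AddCommGroup C] [Module k C] [Coalgebra k C] [Module Aᵐᵒᵖ C]
    [Ring H] [HopfAlgebra k H] (f : C →ₗc[k] H) (φ : A →ₐc[k] H) : Prop :=
  ∀ (a : A) (c : C), f (op a • c) = f c * φ a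

/-- `(H, f, φ)` is the free Hopf algebra `H(C, A)` on the right `A`-module coalgebra `C` with its
canonical maps: it is initial among all the compatible triples. -/
structure IsFreeHopfAlgebra {k A C H : Type u} [Field k] [Ring A] [HopfAlgebra k A]
    [AddCommGroup C] [Module k C] [Coalgebra k C] [Module Aᵐᵒᵖ C] [IsRightModuleCoalgebra k A C]
    [Ring H] [HopfAlgebra k H] (f : C →ₗc[k] H) (φ : A →ₐc[k] H) : Prop where
  compatible : IsCompatible f φ
  existsUnique_lift : ∀ (H' : Type u) [Ring H'] [HopfAlgebra k H']
    (f' : C →ₗc[k] H') (φ' : A →ₐc[k] H'), IsCompatible f' φ' →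
      ∃! t : H →ₐc[k] H', (∀ c, t (f c) = f' c) ∧ (∀ a, t (φ a) = φ' a)

end ModuleCoalgebra

/-! ### Modules with a cyclic free direct summand -/

/-- The `A`-module `V` has a direct summand isomorphic to the cyclic free module `A`. -/
def HasCyclicFreeSummand (A V : Type*) [Ring A] [AddCommGroup V] [Module A V] : Prop :=
  ∃ V₀ V₁ : Submodule A V, IsCompl V₀ V₁ ∧ Nonempty (V₀ ≃ₗ[A] A)

/-! ### The coalgebra `Coend V` -/

section Coend

/-- The coendomorphism coalgebra `Coend V = (End_k V)^*` of a vector space `V`. -/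
def Coend (k V : Type*) [Field k] [AddCommGroup V] [Module k V] : Type _ :=
  Module.Dual k (Module.End k V)

namespace Coend

section Basic

variable {k V : Type*} [Field k] [AddCommGroup V] [Module k V]

instance : AddCommGroup (Coend k V) := inferInstanceAs (AddCommGroup (Module.Dual k _))

instance : Module k (Coend k V) := inferInstanceAs (Module k (Module.Dual k _))

/-- The evaluation pairing between `Coend V` and `End_k V`. -/
def toDual : Coend k V ≃ₗ[k] Module.Dual k (Module.End k V) := LinearEquiv.refl k _

variable [FiniteDimensional k V]

/-- The pairing identifies `Coend V ⊗ Coend V` with the dual of `End_k V ⊗ End_k V`. -/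
def toDual₂ : Coend k V ⊗[k] Coend k V ≃ₗ[k]
    Module.Dual k (Module.End k V ⊗[k] Module.End k V) :=
  (TensorProduct.congr toDual toDual).trans
    (TensorProduct.dualDistribEquiv k (Module.End k V) (Module.End k V))

@[simp]
theorem toDual₂_tmul (ξ η : Coend k V) (α β : Module.End k V) :
    toDual₂ (ξ ⊗ₜ[k] η) (α ⊗ₜ[k] β) = toDual ξ α * toDual η β := by
  rfl

/-- The comultiplication of `Coend V` is dual to the multiplication of `End_k V`, and the
counit is evaluation at the identity operator. -/
instance : CoalgebraStruct k (Coend k V) where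
  comul := toDual₂.symm.toLinearMap ∘ₗ
    (LinearMap.mul' k (Module.End k V)).dualMap ∘ₗ toDual.toLinearMap
  counit := Module.Dual.eval k (Module.End k V) 1 ∘ₗ toDual.toLinearMap

theorem counit_eq (ξ : Coend k V) : Coalgebra.counit (R := k) ξ = toDual ξ 1 := rfl

/-- `ξ(αβ) = ∑ ξ₍₁₎(α) ξ₍₂₎(β)`. -/
theorem toDual₂_comul (ξ : Coend k V) (α β : Module.End k V) :
    toDual₂ (Coalgebra.comul (R := k) ξ) (α ⊗ₜ[k] β) = toDual ξ (α * β) := by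
  simp [CoalgebraStruct.comul]

/-- An element of `Coend V ⊗ Coend V ⊗ Coend V` is determined by its pairing with
`End_k V ⊗ End_k V ⊗ End_k V`. -/
def toDual₃ : (Coend k V ⊗[k] Coend k V) ⊗[k] Coend k V ≃ₗ[k]
    Module.Dual k ((Module.End k V ⊗[k] Module.End k V) ⊗[k] Module.End k V) :=
  (TensorProduct.congr toDual₂ toDual).trans
    (TensorProduct.dualDistribEquiv k (Module.End k V ⊗[k] Module.End k V) (Module.End k V))

theorem toDual₃_tmul (t : Coend k V ⊗[k] Coend k V) (ζ : Coend k V)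
    (w : Module.End k V ⊗[k] Module.End k V) (γ : Module.End k V) :
    toDual₃ (t ⊗ₜ[k] ζ) (w ⊗ₜ[k] γ) = toDual₂ t w * toDual ζ γ := by
  rfl

theorem toDual₃_rTensor_comul (t : Coend k V ⊗[k] Coend k V) (α β γ : Module.End k V) :
    toDual₃ (Coalgebra.comul.rTensor (Coend k V) t) ((α ⊗ₜ[k] β) ⊗ₜ[k] γ) =
      toDual₂ t ((α * β) ⊗ₜ[k] γ) := by
  induction t with
  | zero => simp
  | add x y hx hy => simp only [map_add, LinearMap.add_apply, hx, hy]
  | tmul ξ ζ => rw [LinearMap.rTensor_tmul, toDual₃_tmul, toDual₂_comul, toDual₂_tmul]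

theorem toDual₃_assoc_symm (ξ : Coend k V) (t : Coend k V ⊗[k] Coend k V)
    (α β γ : Module.End k V) :
    toDual₃ ((TensorProduct.assoc k _ _ _).symm (ξ ⊗ₜ[k] t)) ((α ⊗ₜ[k] β) ⊗ₜ[k] γ) =
      toDual ξ α * toDual₂ t (β ⊗ₜ[k] γ) := by
  induction t with
  | zero => simp
  | add x y hx hy => simp only [TensorProduct.tmul_add, map_add, LinearMap.add_apply, hx, hy, mul_add]
  | tmul η ζ =>
    rw [TensorProduct.assoc_symm_tmul, toDual₃_tmul, toDual₂_tmul, toDual₂_tmul, mul_assoc]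

theorem toDual₃_lTensor_comul (t : Coend k V ⊗[k] Coend k V) (α β γ : Module.End k V) :
    toDual₃ ((TensorProduct.assoc k _ _ _).symm (Coalgebra.comul.lTensor (Coend k V) t))
      ((α ⊗ₜ[k] β) ⊗ₜ[k] γ) = toDual₂ t (α ⊗ₜ[k] (β * γ)) := by
  induction t with
  | zero => simp
  | add x y hx hy => simp only [map_add, LinearMap.add_apply, hx, hy]
  | tmul ξ ζ => rw [LinearMap.lTensor_tmul, toDual₃_assoc_symm, toDual₂_comul, toDual₂_tmul]

theorem toDual_lid_rTensor_counit (t : Coend k V ⊗[k] Coend k V) (β : Module.End k V) :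
    toDual (TensorProduct.lid k _ (Coalgebra.counit.rTensor (Coend k V) t)) β =
      toDual₂ t (1 ⊗ₜ[k] β) := by
  induction t with
  | zero => simp
  | add x y hx hy => simp only [map_add, LinearMap.add_apply, hx, hy]
  | tmul ξ ζ => simp [counit_eq]

theorem toDual_rid_lTensor_counit (t : Coend k V ⊗[k] Coend k V) (α : Module.End k V) :
    toDual (TensorProduct.rid k _ (Coalgebra.counit.lTensor (Coend k V) t)) α =
      toDual₂ t (α ⊗ₜ[k] 1) := by
  induction t with
  | zero => simp
  | add x y hx hy => simp only [map_add, LinearMap.add_apply, hx, hy]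
  | tmul ξ ζ => simp [counit_eq, mul_comm]

instance : Coalgebra k (Coend k V) where
  coassoc := by
    ext ξ : 1
    apply (TensorProduct.assoc k _ _ _).symm.injective
    apply (toDual₃ (k := k) (V := V)).injective
    refine TensorProduct.ext_threefold fun α β γ => ?_
    simp only [LinearMap.comp_apply, LinearEquiv.coe_coe, LinearEquiv.symm_apply_apply]
    rw [toDual₃_rTensor_comul, toDual₃_lTensor_comul, toDual₂_comul, toDual₂_comul, mul_assoc]
  rTensor_counit_comp_comul := by
    ext ξ : 1
    apply (TensorProduct.lid k _).injective
    apply (toDual (k := k) (V := V)).injective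
    ext β : 1
    simp only [LinearMap.comp_apply]
    rw [toDual_lid_rTensor_counit, toDual₂_comul]
    simp
  lTensor_counit_comp_comul := by
    ext ξ : 1
    apply (TensorProduct.rid k _).injective
    apply (toDual (k := k) (V := V)).injective
    ext β : 1
    simp only [LinearMap.comp_apply]
    rw [toDual_rid_lTensor_counit, toDual₂_comul]
    simp

end Basic

section Action

variable {k A V : Type*} [Field k] [Ring A] [HopfAlgebra k A]
  [AddCommGroup V] [Module k V] [Module A V] [IsScalarTower k A V]

variable (k A V) in
/-- The adjoint action `a ▷ β = ∑ τ(a₍₁₎) ∘ β ∘ τ(S a₍₂₎)` of `A` on `End_k V`, where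
`τ : A → End_k V` is the given representation. -/
def adj : A →ₗ[k] Module.End k (Module.End k V) :=
  TensorProduct.lift ((LinearMap.mul k (Module.End k (Module.End k V))).compl₁₂
      (LinearMap.mul k (Module.End k V) ∘ₗ (Algebra.lsmul k k V : A →ₐ[k] _).toLinearMap)
      ((LinearMap.mul k (Module.End k V)).flip ∘ₗ
        (Algebra.lsmul k k V : A →ₐ[k] _).toLinearMap ∘ₗ HopfAlgebra.antipode k)) ∘ₗ
    Coalgebra.comul

theorem adj_apply {ι : Type*} {a : A} (r : Coalgebra.Repr k a ι) (β : Module.End k V) :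
    adj k A V a β = ∑ i ∈ r.index, (Algebra.lsmul k k V : A →ₐ[k] _) (r.left i) * β *
      (Algebra.lsmul k k V : A →ₐ[k] _) (HopfAlgebra.antipode k (r.right i)) := by
  simp [adj, ← r.eq, mul_assoc]

theorem adj_one : adj k A V 1 = 1 := by
  ext β : 1
  simp [adj, Algebra.TensorProduct.one_def]

theorem adj_mul (a b : A) : adj k A V (a * b) = adj k A V a * adj k A V b := by
  ext β : 1
  have h : Coalgebra.comul (R := k) (a * b) = ∑ i ∈ (ℛ k a).index, ∑ j ∈ (ℛ k b).index,
      ((ℛ k a).left i * (ℛ k b).left j) ⊗ₜ[k] ((ℛ k a).right i * (ℛ k b).right j) := by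
    rw [Bialgebra.comul_mul, ← (ℛ k a).eq, ← (ℛ k b).eq, Finset.sum_mul_sum]
    simp
  rw [Module.End.mul_apply, adj_apply (ℛ k a), adj_apply (ℛ k b)]
  simp [adj, h, Finset.mul_sum, Finset.sum_mul, HopfAlgebra.antipode_mul_antidistrib, mul_assoc]

/-- The right action of `A` on `Coend V` dual to the left action `▷` on `End_k V`:
`(ξ a)(β) = ξ(a ▷ β)`. -/
instance : Module Aᵐᵒᵖ (Coend k V) where
  smul a ξ := toDual.symm (toDual ξ ∘ₗ adj k A V (unop a))
  one_smul ξ := by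
    change toDual.symm (toDual ξ ∘ₗ adj k A V 1) = ξ
    rw [adj_one]; rfl
  mul_smul a b ξ := by
    change toDual.symm (toDual ξ ∘ₗ adj k A V (unop b * unop a)) = _
    rw [adj_mul]; rfl
  smul_zero a := by
    change toDual.symm (toDual 0 ∘ₗ adj k A V (unop a)) = 0
    simp
  smul_add a ξ η := by
    change toDual.symm (toDual (ξ + η) ∘ₗ adj k A V (unop a)) =
      toDual.symm (toDual ξ ∘ₗ adj k A V (unop a)) + toDual.symm (toDual η ∘ₗ adj k A V (unop a))
    rw [map_add, LinearMap.add_comp, map_add]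
  add_smul a b ξ := by
    change toDual.symm (toDual ξ ∘ₗ adj k A V (unop a + unop b)) =
      toDual.symm (toDual ξ ∘ₗ adj k A V (unop a)) + toDual.symm (toDual ξ ∘ₗ adj k A V (unop b))
    rw [map_add, LinearMap.comp_add, map_add]
  zero_smul ξ := by
    change toDual.symm (toDual ξ ∘ₗ adj k A V 0) = 0
    simp

@[simp]
theorem toDual_op_smul (a : A) (ξ : Coend k V) (β : Module.End k V) :
    toDual (op a • ξ) β = toDual ξ (adj k A V a β) := rfl

theorem adj_eq_conv (a : A) (β : Module.End k V) :
    adj k A V a β = (toConv ((LinearMap.mul k (Module.End k V)).flip β ∘ₗ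
        (Algebra.lsmul k k V : A →ₐ[k] _).toLinearMap) *
      toConv ((Algebra.lsmul k k V : A →ₐ[k] _).toLinearMap ∘ₗ HopfAlgebra.antipode k)) a := by
  rw [(ℛ k a).convMul_apply, adj_apply (ℛ k a)]
  rfl

/-- `a ▷ (αβ) = ∑ (a₍₁₎ ▷ α) (a₍₂₎ ▷ β)`. -/
theorem adj_apply_mul (a : A) (α β : Module.End k V) :
    adj k A V a (α * β) = ∑ i ∈ (ℛ k a).index,
      adj k A V ((ℛ k a).left i) α * adj k A V ((ℛ k a).right i) β := by
  set T : A →ₐ[k] Module.End k V := Algebra.lsmul k k V with hT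
  have h : toConv (T.toLinearMap ∘ₗ HopfAlgebra.antipode k) *
      toConv ((LinearMap.mul k (Module.End k V)).flip β ∘ₗ T.toLinearMap) =
      toConv (LinearMap.toSpanSingleton k _ β ∘ₗ Coalgebra.counit) := by
    refine WithConv.ext (LinearMap.ext fun y => ?_)
    refine ((ℛ k y).convMul_apply _ _).trans ?_
    change ∑ i ∈ (ℛ k y).index, T (HopfAlgebra.antipode k ((ℛ k y).left i)) *
      (T ((ℛ k y).right i) * β) = counit (R := k) y • β
    simp only [← mul_assoc, ← map_mul, ← Finset.sum_mul, ← map_sum]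
    rw [HopfAlgebra.sum_antipode_mul_eq_smul]
    simp
  have h' : toConv ((LinearMap.mul k (Module.End k V)).flip α ∘ₗ T.toLinearMap) *
      toConv (LinearMap.toSpanSingleton k _ β ∘ₗ Coalgebra.counit) =
      toConv ((LinearMap.mul k (Module.End k V)).flip (α * β) ∘ₗ T.toLinearMap) := by
    refine WithConv.ext (LinearMap.ext fun x => ?_)
    refine ((ℛ k x).convMul_apply _ _).trans ?_
    change ∑ i ∈ (ℛ k x).index, (T ((ℛ k x).left i) * α) *
      (counit (R := k) ((ℛ k x).right i) • β) = T x * (α * β)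
    have hx : ∑ i ∈ (ℛ k x).index, counit (R := k) ((ℛ k x).right i) • (ℛ k x).left i = x := by
      have h₀ := congrArg (TensorProduct.rid k A) (Coalgebra.sum_tmul_counit_eq (ℛ k x))
      simpa only [map_sum, TensorProduct.rid_tmul, one_smul] using h₀
    conv_rhs => rw [← hx]
    simp only [map_sum, map_smul, Finset.sum_mul, smul_mul_assoc, mul_smul_comm, mul_assoc]
  simp only [adj_eq_conv]
  rw [← (ℛ k a).convMul_apply, mul_assoc, ← mul_assoc (toConv (_ ∘ₗ HopfAlgebra.antipode k)),
    ← mul_assoc, ← hT, h, h']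

/-- `a ▷ 1 = ε(a) 1`. -/
theorem adj_apply_one (a : A) : adj k A V a 1 = (counit (R := k) a) • 1 := by
  rw [adj_apply (ℛ k a)]
  simp only [mul_one, ← map_mul, ← map_sum]
  rw [HopfAlgebra.sum_mul_antipode_eq_smul]
  simp

variable [FiniteDimensional k V]

/-- `Coend V` is a right `A`-module coalgebra. -/
instance : IsRightModuleCoalgebra k A (Coend k V) where
  smul_assoc c a ξ := by
    obtain ⟨a, rfl⟩ := op_surjective a
    apply (toDual (k := k) (V := V)).injective
    ext β : 1
    change toDual ξ (adj k A V (c • a) β) = c • toDual ξ (adj k A V a β)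
    simp
  counit_smul a ξ := by
    rw [counit_eq, toDual_op_smul, adj_apply_one, map_smul, counit_eq, smul_eq_mul, mul_comm]
  comul_smul a ξ := by
    apply (toDual₂ (k := k) (V := V)).injective
    refine TensorProduct.ext' fun α β => ?_
    rw [toDual₂_comul, toDual_op_smul, adj_apply_mul]
    simp only [map_sum, ← toDual₂_comul, LinearMap.sum_apply, toDual₂_tmul, toDual_op_smul]
    conv_lhs => rw [← (ℛ k ξ).eq]
    simp only [map_sum, LinearMap.sum_apply, toDual₂_tmul]
    rw [Finset.sum_comm]

end Action

end Coend

end Coend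

end

/-!
Let `V` be a nonprojective module over the finite-dimensional Hopf algebra `A`, with matrix
representation `t` on a basis of `V`. A coalgebra map `Coend V → H` is a comatrix `M` over `H`, and
its compatibility with `φ : A → H` is the relation `t(a) M = M ∑ φ(a₍₁₎) t(a₍₂₎)`, called `Fwd`
(`isCompatible_iff`). The entries of `M` solve a homogeneous linear system with coefficients in
`φ(A)`, and those of `M⁻¹ = S(M)` solve another such system on the other side. If `H` were flat
over `A`, the solution would be an `H`-combination of solutions over `A`, and applying the counit
to the coefficients would give a solution over `A` itself with counit the identity matrix
(`LeftFlatOver.exists_bwd`, `RightFlatOver.exists_fwd`). Such a solution splits the action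
`A ⊗ V → V`, so that `V` would be projective (`projective_of_flat`). Nonprojective modules with a
free cyclic summand are `A ⊕ A / I`, for a left ideal `I` without a complement.

It remains to construct the Hopf algebras and to embed `A` into them. The Hopf algebra `ChainHopf`
is generated by `A` and the entries of matrices `Z j`, where `j` runs through `ℕ` or `ℤ`, subject
to `Z j (Z (j + 1))ᵀ = 1 = (Z (j + 1))ᵀ Z j` and to the relation `Fwd` for `Z 0`; its antipode
shifts the chain. For `ℕ` it is the free Hopf algebra on `Coend V` (`isFreeHopfAlgebra_chainHopf`),
and for `ℤ` its antipode is bijective (`bijective_antipode_chainHopf`). As the free one maps to the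
other, it is enough to show that `A` embeds into the latter, that is, to find a chain over some
algebra that contains `A`. Chains of arbitrary finite length are sufficient: transposition and
inversion, done twice, turn solutions of `Fwd` for `φ` into those of `Fwd` for `φ ∘ S²`, so that
finite chains may be shifted, and the germs of the resulting sequences form a chain indexed by `ℤ`
(`ofAlg_injective_of_chains`).

The finite chains consist of matrices of operators on `X = Y ⊕ A`, with `A` acting trivially on the
infinite-dimensional space `Y`. As `A` is a direct summand of `V`, the actions of `A` on `X ⊗ V`,
via the second factor and diagonally, are isomorphic: the diagonal action on `A ⊗ V` is free, and
infinitely many free summands are available on both sides. This gives an invertible matrix of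
operators for each of the relations occurring in a chain (`exists_seed`). The transposed relations
concern the dual representation, in which `A` is again a summand because `A` has a Frobenius form
(`exists_frobenius`, obtained from the trace formula for integrals). The seeds can be so chosen
that the transpose of the inverse of each of them agrees with the next one up to operators of
finite rank (`exists_seeds`). Over an infinite field a generic member of a pencil of matrices which
differ by finite rank is invertible if one member is; by induction on `n`, each seed can therefore
be corrected by a matrix of finite rank so that it may be inverted and transposed `n` times in
succession (`exists_chainInvertible`). A finite field is first replaced by an infinite extension.

The antipode of a finite-dimensional Hopf algebra is bijective, and Sweedler's four-dimensional
Hopf algebra, which exists over every field, is not semisimple. This answers Schauenburg's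
question.
-/

noncomputable section

set_option linter.unusedSectionVars false


/-! ### Convolution and antipodes -/

section Convolution

variable {k A E : Type*} [Field k] [Ring A] [HopfAlgebra k A] [Ring E] [Algebra k E]

theorem AlgHom.conv_antipode_mul (g : A →ₐ[k] E) :
    toConv (g.toLinearMap ∘ₗ HopfAlgebra.antipode k) * toConv g.toLinearMap = 1 := by
  have := LinearMap.algHom_comp_convMul_distrib g
    (toConv (HopfAlgebra.antipode k)) (toConv (LinearMap.id : A →ₗ[k] A))
  rw [LinearMap.antipode_mul_id] at this
  refine WithConv.ext (this.symm.trans ?_)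
  ext x; simp

theorem AlgHom.conv_mul_antipode (g : A →ₐ[k] E) :
    toConv g.toLinearMap * toConv (g.toLinearMap ∘ₗ HopfAlgebra.antipode k) = 1 := by
  have := LinearMap.algHom_comp_convMul_distrib g
    (toConv (LinearMap.id : A →ₗ[k] A)) (toConv (HopfAlgebra.antipode k))
  rw [LinearMap.id_mul_antipode] at this
  refine WithConv.ext (this.symm.trans ?_)
  ext x; simp

/-- The antipode reverses the comultiplication: in the convolution algebra of maps
`A → A ⊗ A`, both sides invert `Δ = i₁ * i₂`, where `i₁`, `i₂` are the two inclusions. -/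
theorem comul_antipode_repr {κ : Type*} {a : A} (r : Coalgebra.Repr k a κ) :
    comul (R := k) (HopfAlgebra.antipode k a) = ∑ i ∈ r.index,
      HopfAlgebra.antipode k (r.right i) ⊗ₜ[k] HopfAlgebra.antipode k (r.left i) := by
  set i₁ : A →ₐ[k] A ⊗[k] A := Algebra.TensorProduct.includeLeft
  set i₂ : A →ₐ[k] A ⊗[k] A := Algebra.TensorProduct.includeRight
  have hΔ : toConv (Bialgebra.comulAlgHom k A).toLinearMap =
      toConv i₁.toLinearMap * toConv i₂.toLinearMap := by
    refine WithConv.ext (LinearMap.ext fun x => ?_)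
    refine Eq.trans ?_ ((ℛ k x).convMul_apply _ _).symm
    simp [i₁, i₂, (ℛ k x).eq]
  have hl : toConv (i₂.toLinearMap ∘ₗ HopfAlgebra.antipode k) *
      toConv (i₁.toLinearMap ∘ₗ HopfAlgebra.antipode k) *
      toConv (Bialgebra.comulAlgHom k A).toLinearMap = 1 := by
    rw [hΔ, mul_assoc, ← mul_assoc (toConv (i₁.toLinearMap ∘ₗ _)), i₁.conv_antipode_mul, one_mul,
      i₂.conv_antipode_mul]
  have := left_inv_eq_right_inv hl (Bialgebra.comulAlgHom k A).conv_mul_antipode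
  refine (congrArg (fun f => f a) this).symm.trans ?_
  refine (r.convMul_apply _ _).trans ?_
  simp [i₁, i₂]

/-- A homomorphism of bialgebras between Hopf algebras commutes with the antipodes. -/
theorem BialgHom.map_antipode {B : Type*} [Ring B] [HopfAlgebra k B]
    (φ : A →ₐc[k] B) (a : A) :
    φ (HopfAlgebra.antipode k a) = HopfAlgebra.antipode k (φ a) := by
  have hr : toConv (φ : A →ₐ[k] B).toLinearMap *
      toConv (HopfAlgebra.antipode k ∘ₗ (φ : A →ₐ[k] B).toLinearMap) = 1 := by
    have := LinearMap.convMul_comp_coalgHom_distrib (toConv (LinearMap.id : B →ₗ[k] B))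
      (toConv (HopfAlgebra.antipode k)) (φ : A →ₗc[k] B)
    rw [LinearMap.id_mul_antipode] at this
    refine WithConv.ext (this.symm.trans ?_)
    ext x
    exact congrArg (algebraMap k B) (CoalgHomClass.counit_comp_apply φ x)
  exact congrArg (fun f => f a) (left_inv_eq_right_inv (φ : A →ₐ[k] B).conv_antipode_mul hr)

end Convolution

/-! ### Twisted matrices -/

section Twist

variable {k A R ι : Type*} [Field k] [AddCommGroup A] [Module k A] [Coalgebra k A]
  [Ring R] [Algebra k R] [Fintype ι] [DecidableEq ι]

/-- Scalar matrices as an algebra homomorphism. -/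
def scalarMat (k R ι : Type*) [Field k] [Ring R] [Algebra k R] [Fintype ι] [DecidableEq ι] :
    R →ₐ[k] Matrix ι ι R :=
  Matrix.scalarAlgHom ι k

/-- Matrices with entries in the base field, regarded as matrices over an algebra. -/
def constMat (k R ι : Type*) [Field k] [Ring R] [Algebra k R] [Fintype ι] [DecidableEq ι] :
    Matrix ι ι k →ₐ[k] Matrix ι ι R :=
  (Algebra.ofId k R).mapMatrix

@[simp] theorem scalarMat_mul_apply (r : R) (M : Matrix ι ι R) (i j : ι) :
    (scalarMat k R ι r * M) i j = r * M i j := by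
  simp [scalarMat]

@[simp] theorem constMat_apply (m : Matrix ι ι k) (i j : ι) :
    constMat k R ι m i j = algebraMap k R (m i j) := rfl

theorem constMat_mul_apply (m : Matrix ι ι k) (M : Matrix ι ι R) (i j : ι) :
    (constMat k R ι m * M) i j = ∑ l, m i l • M l j := by
  simp [Matrix.mul_apply, Algebra.smul_def]

theorem mul_constMat_apply (m : Matrix ι ι k) (M : Matrix ι ι R) (i j : ι) :
    (M * constMat k R ι m) i j = ∑ l, m l j • M i l := by
  simp [Matrix.mul_apply, Algebra.smul_def, Algebra.commutes]

theorem transpose_constMat_mul (m : Matrix ι ι k) (M : Matrix ι ι R) :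
    (constMat k R ι m * M).transpose = M.transpose * constMat k R ι m.transpose := by
  ext i j
  simp [constMat_mul_apply, mul_constMat_apply]

theorem transpose_mul_constMat (m : Matrix ι ι k) (M : Matrix ι ι R) :
    (M * constMat k R ι m).transpose = constMat k R ι m.transpose * M.transpose := by
  ext i j
  simp [constMat_mul_apply, mul_constMat_apply]

theorem transpose_scalarMat_mul (r : R) (M : Matrix ι ι R) :
    (scalarMat k R ι r * M).transpose = scalarMat k R ι r * M.transpose := by
  ext i j
  simp

/-- The matrix function `a ↦ ∑ ρ(a₍₁₎) t(a₍₂₎)`: the diagonal action of `A` on the tensor product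
of a space with action `ρ` and the coordinate space with action `t`. -/
def twist (ρ : A →ₗ[k] R) (t : A →ₗ[k] Matrix ι ι k) : A →ₗ[k] Matrix ι ι R :=
  (toConv ((scalarMat k R ι).toLinearMap ∘ₗ ρ) *
    toConv ((constMat k R ι).toLinearMap ∘ₗ t)).ofConv

theorem twist_repr (ρ : A →ₗ[k] R) (t : A →ₗ[k] Matrix ι ι k) {κ : Type*} {a : A}
    (r : Coalgebra.Repr k a κ) :
    twist ρ t a = ∑ s ∈ r.index, scalarMat k R ι (ρ (r.left s)) * constMat k R ι (t (r.right s)) :=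
  r.convMul_apply _ _

theorem twist_apply (ρ : A →ₗ[k] R) (t : A →ₗ[k] Matrix ι ι k) {κ : Type*} {a : A}
    (r : Coalgebra.Repr k a κ) (i j : ι) :
    twist ρ t a i j = ∑ s ∈ r.index, t (r.right s) i j • ρ (r.left s) := by
  simp [twist_repr ρ t r, Matrix.sum_apply, Algebra.smul_def, Algebra.commutes]

theorem map_twist (ρ : A →ₗ[k] R) (t : A →ₗ[k] Matrix ι ι k) (a : A)
    {R' : Type*} [Ring R'] [Algebra k R'] (g : R →ₐ[k] R') :
    (twist ρ t a).map g = twist (g.toLinearMap ∘ₗ ρ) t a := by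
  ext i j
  simp [twist_apply _ t (ℛ k a)]

theorem map_constMat (m : Matrix ι ι k)
    {R' : Type*} [Ring R'] [Algebra k R'] (g : R →ₐ[k] R') :
    (constMat k R ι m).map g = constMat k R' ι m := by
  ext i j
  simp

/-- `M` intertwines the action `t` on the coordinates with the diagonal action from the right:
`t(a) M = M ∑ ρ(a₍₁₎) t(a₍₂₎)`. -/
def Fwd (t : A →ₗ[k] Matrix ι ι k) (ρ : A →ₗ[k] R) (M : Matrix ι ι R) : Prop :=
  ∀ a, constMat k R ι (t a) * M = M * twist ρ t a

/-- `N` intertwines the action `t` on the coordinates with the diagonal action from the left: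
`N t(a) = (∑ ρ(a₍₁₎) t(a₍₂₎)) N`. -/
def Bwd (t : A →ₗ[k] Matrix ι ι k) (ρ : A →ₗ[k] R) (N : Matrix ι ι R) : Prop :=
  ∀ a, N * constMat k R ι (t a) = twist ρ t a * N

theorem Fwd.bwd {t : A →ₗ[k] Matrix ι ι k} {ρ : A →ₗ[k] R} {M N : Matrix ι ι R}
    (h : Fwd t ρ M) (hMN : M * N = 1) (hNM : N * M = 1) : Bwd t ρ N := fun a => by
  calc N * constMat k R ι (t a) = N * (constMat k R ι (t a) * M) * N := by
        simp only [mul_assoc, hMN, mul_one]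
    _ = twist ρ t a * N := by rw [h a, ← mul_assoc, hNM, one_mul]

theorem Bwd.fwd {t : A →ₗ[k] Matrix ι ι k} {ρ : A →ₗ[k] R} {M N : Matrix ι ι R}
    (h : Bwd t ρ N) (hMN : M * N = 1) (hNM : N * M = 1) : Fwd t ρ M := fun a => by
  calc constMat k R ι (t a) * M = M * (N * constMat k R ι (t a)) * M := by
        simp only [← mul_assoc, hMN, one_mul]
    _ = M * twist ρ t a := by rw [h a, mul_assoc, mul_assoc, hNM, mul_one]

theorem Fwd.map {t : A →ₗ[k] Matrix ι ι k} {ρ : A →ₗ[k] R} {M : Matrix ι ι R}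
    (h : Fwd t ρ M) {R' : Type*} [Ring R'] [Algebra k R'] (g : R →ₐ[k] R') :
    Fwd t (g.toLinearMap ∘ₗ ρ) (M.map g) := fun a => by
  have := congrArg g.mapMatrix (h a)
  rw [map_mul, map_mul] at this
  rw [← map_twist, ← map_constMat _ g]
  exact this

theorem Bwd.map {t : A →ₗ[k] Matrix ι ι k} {ρ : A →ₗ[k] R} {M : Matrix ι ι R}
    (h : Bwd t ρ M) {R' : Type*} [Ring R'] [Algebra k R'] (g : R →ₐ[k] R') :
    Bwd t (g.toLinearMap ∘ₗ ρ) (M.map g) := fun a => by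
  have := congrArg g.mapMatrix (h a)
  rw [map_mul, map_mul] at this
  rw [← map_twist, ← map_constMat _ g]
  exact this

/-- If `ρ'` is the convolution inverse of `ρ` then the relation `Bwd` may be rewritten as
`t(a) N = ∑ ρ'(a₍₁₎) N t(a₍₂₎)`. -/
theorem bwd_iff {t : A →ₗ[k] Matrix ι ι k} {ρ ρ' : A →ₗ[k] R} (h₁ : toConv ρ' * toConv ρ = 1)
    (h₂ : toConv ρ * toConv ρ' = 1) (N : Matrix ι ι R) :
    Bwd t ρ N ↔ ∀ a, constMat k R ι (t a) * N = ∑ s ∈ (ℛ k a).index,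
      scalarMat k R ι (ρ' ((ℛ k a).left s)) * (N * constMat k R ι (t ((ℛ k a).right s))) := by
  set u := toConv ((scalarMat k R ι).toLinearMap ∘ₗ ρ)
  set u' := toConv ((scalarMat k R ι).toLinearMap ∘ₗ ρ')
  have hone : (scalarMat k R ι).toLinearMap ∘ₗ (1 : WithConv (A →ₗ[k] R)).ofConv =
      (1 : WithConv (A →ₗ[k] Matrix ι ι R)).ofConv := by ext1 a; simp
  have hu₁ : u' * u = 1 := by
    have := LinearMap.algHom_comp_convMul_distrib (scalarMat k R ι) (toConv ρ') (toConv ρ)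
    rw [h₁, hone] at this
    exact WithConv.ext this.symm
  have hu₂ : u * u' = 1 := by
    have := LinearMap.algHom_comp_convMul_distrib (scalarMat k R ι) (toConv ρ) (toConv ρ')
    rw [h₂, hone] at this
    exact WithConv.ext this.symm
  -- `x a = N t(a)` and `y a = t(a) N`, so that the two relations are `x = u * y`, `y = u' * x`
  set x : WithConv (A →ₗ[k] Matrix ι ι R) :=
    toConv (LinearMap.mulLeft k N ∘ₗ (constMat k R ι).toLinearMap ∘ₗ t)
  set y : WithConv (A →ₗ[k] Matrix ι ι R) :=
    toConv (LinearMap.mulRight k N ∘ₗ (constMat k R ι).toLinearMap ∘ₗ t)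
  have hB : Bwd t ρ N ↔ x = u * y := by
    rw [WithConv.ext_iff, LinearMap.ext_iff]
    refine forall_congr' fun a => ?_
    have h : (u * y).ofConv a = twist ρ t a * N := by
      rw [twist_repr ρ t (ℛ k a), Finset.sum_mul]
      refine ((ℛ k a).convMul_apply _ _).trans ?_
      simp [u, y, mul_assoc]
    rw [h]; rfl
  rw [hB]
  have hC : (∀ a, constMat k R ι (t a) * N = ∑ s ∈ (ℛ k a).index,
      scalarMat k R ι (ρ' ((ℛ k a).left s)) * (N * constMat k R ι (t ((ℛ k a).right s)))) ↔
      y = u' * x := by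
    rw [WithConv.ext_iff, LinearMap.ext_iff]
    refine forall_congr' fun a => ?_
    have h : (u' * x).ofConv a = ∑ s ∈ (ℛ k a).index,
      scalarMat k R ι (ρ' ((ℛ k a).left s)) * (N * constMat k R ι (t ((ℛ k a).right s))) := by
      refine ((ℛ k a).convMul_apply _ _).trans ?_
      simp [u', x]
    rw [h]; rfl
  rw [hC]
  constructor
  · intro h; rw [h, ← mul_assoc, hu₁, one_mul]
  · intro h; rw [h, ← mul_assoc, hu₂, one_mul]

/-- The transposed form of a linear family of matrices. -/
def trLin (t : A →ₗ[k] Matrix ι ι k) : A →ₗ[k] Matrix ι ι k :=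
  (Matrix.transposeLinearEquiv ι ι k k).toLinearMap ∘ₗ t

@[simp] theorem trLin_apply (t : A →ₗ[k] Matrix ι ι k) (a : A) :
    trLin t a = (t a).transpose := rfl

/-- Transposition exchanges a map with its convolution inverse. -/
theorem bwd_transpose_iff {t : A →ₗ[k] Matrix ι ι k} {ρ ρ' : A →ₗ[k] R}
    (h₁ : toConv ρ' * toConv ρ = 1) (h₂ : toConv ρ * toConv ρ' = 1) (N : Matrix ι ι R) :
    Bwd t ρ N ↔ Bwd (trLin t) ρ' N.transpose := by
  rw [bwd_iff h₁ h₂]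
  refine forall_congr' fun a => ?_
  rw [← Matrix.transpose_inj, transpose_constMat_mul, Matrix.transpose_sum,
    twist_repr _ _ (ℛ k a), Finset.sum_mul]
  simp only [transpose_scalarMat_mul, transpose_mul_constMat, trLin_apply, mul_assoc]

theorem twist_op (ρ : A →ₗ[k] R) (t : A →ₗ[k] Matrix ι ι k) (a : A) (i j : ι) :
    twist ((opLinearEquiv k).toLinearMap ∘ₗ ρ) (trLin t) a i j = op (twist ρ t a j i) := by
  simp [twist_apply _ _ (ℛ k a)]

/-- Passing to the opposite algebra and transposing exchanges the two relations. -/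
theorem fwd_iff_bwd_op {t : A →ₗ[k] Matrix ι ι k} {ρ : A →ₗ[k] R} (M : Matrix ι ι R) :
    Fwd t ρ M ↔ Bwd (trLin t) ((opLinearEquiv k).toLinearMap ∘ₗ ρ) (M.map op).transpose := by
  refine forall_congr' fun a => ?_
  rw [← Matrix.ext_iff, ← Matrix.ext_iff, forall_comm]
  refine forall_congr' fun i => forall_congr' fun j => ?_
  rw [← op_injective.eq_iff, constMat_mul_apply, mul_constMat_apply, Matrix.mul_apply,
    Matrix.mul_apply]
  simp [twist_op]

theorem bwd_iff_fwd_op {t : A →ₗ[k] Matrix ι ι k} {ρ : A →ₗ[k] R} (N : Matrix ι ι R) :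
    Bwd t ρ N ↔ Fwd (trLin t) ((opLinearEquiv k).toLinearMap ∘ₗ ρ) (N.map op).transpose := by
  refine forall_congr' fun a => ?_
  rw [← Matrix.ext_iff, ← Matrix.ext_iff, forall_comm]
  refine forall_congr' fun i => forall_congr' fun j => ?_
  rw [← op_injective.eq_iff, constMat_mul_apply, mul_constMat_apply, Matrix.mul_apply,
    Matrix.mul_apply]
  simp [twist_op]

end Twist

section TwistHopf

variable {k A R ι : Type*} [Field k] [Ring A] [HopfAlgebra k A]
  [Ring R] [Algebra k R] [Fintype ι] [DecidableEq ι]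

theorem twist_algHom (t : A →ₗ[k] Matrix ι ι k)
    (φ : A →ₐ[k] R) (a : A) (i j : ι) :
    twist φ.toLinearMap t a i j = φ (twist LinearMap.id t a i j) := by
  simp [twist_apply _ t (ℛ k a)]

theorem bwd_transpose_antipode {t : A →ₗ[k] Matrix ι ι k} (ρ : A →ₐ[k] R) (N : Matrix ι ι R) :
    Bwd t ρ.toLinearMap N ↔
      Bwd (trLin t) (ρ.toLinearMap ∘ₗ HopfAlgebra.antipode k) N.transpose :=
  bwd_transpose_iff ρ.conv_antipode_mul ρ.conv_mul_antipode N

theorem fwd_transpose_antipode {t : A →ₗ[k] Matrix ι ι k} (ρ : A →ₐ[k] R) (M : Matrix ι ι R) :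
    Fwd (trLin t) (ρ.toLinearMap ∘ₗ HopfAlgebra.antipode k) M.transpose ↔
      Fwd t (ρ.toLinearMap ∘ₗ HopfAlgebra.antipode k ∘ₗ HopfAlgebra.antipode k) M := by
  let σ : A →ₐ[k] Rᵐᵒᵖ := (AlgHom.op ρ).comp (HopfAlgebra.antipodeAlgHomOp k A)
  have h := bwd_transpose_antipode (t := t) σ (M.map op)
  rw [fwd_iff_bwd_op, fwd_iff_bwd_op]
  exact h

/-- The relation `Fwd` propagates along a chain `Z₀, Z₁, Z₂` of transposed inverses, at the cost of
the square of the antipode. -/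
theorem fwd_chain {t : A →ₗ[k] Matrix ι ι k} (ρ : A →ₐ[k] R) {Z₀ Z₁ Z₂ : Matrix ι ι R}
    (h₁ : Z₀ * Z₁.transpose = 1) (h₁' : Z₁.transpose * Z₀ = 1)
    (h₂ : Z₁ * Z₂.transpose = 1) (h₂' : Z₂.transpose * Z₁ = 1) :
    Fwd t ρ.toLinearMap Z₀ ↔
      Fwd t (ρ.toLinearMap ∘ₗ HopfAlgebra.antipode k ∘ₗ HopfAlgebra.antipode k) Z₂ := by
  have e : Fwd t ρ.toLinearMap Z₀ ↔ Bwd t ρ.toLinearMap Z₁.transpose :=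
    ⟨fun h => h.bwd h₁ h₁', fun h => h.fwd h₁ h₁'⟩
  have e' : Bwd (trLin t) (ρ.toLinearMap ∘ₗ HopfAlgebra.antipode k) Z₁ ↔
      Fwd (trLin t) (ρ.toLinearMap ∘ₗ HopfAlgebra.antipode k) Z₂.transpose :=
    ⟨fun h => h.fwd h₂' h₂, fun h => h.bwd h₂' h₂⟩
  rw [e, bwd_transpose_antipode, Matrix.transpose_transpose, e', fwd_transpose_antipode]

end TwistHopf


/-! ### Linear systems over flat extensions -/

section FlatSystems

variable {R H : Type u} [Ring R] [Ring H] {n m : Type} [Fintype n] [Fintype m]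

/-- Equational criterion for flatness on the left: a solution in `H` of a finite system of left
linear equations with coefficients in `R` is a combination of solutions in `R`. -/
theorem LeftFlatOver.solution_mem_closure {φ : R →+* H} (hφ : LeftFlatOver φ) (d : m → n → R)
    (N : n → H) (hN : ∀ s, ∑ y, φ (d s y) * N y = 0) :
    N ∈ AddSubgroup.closure {x : n → H | ∃ (c : n → R) (h : H),
      (∀ s, ∑ y, d s y * c y = 0) ∧ x = fun y => φ (c y) * h} := by
  classical
  let _ : Module R H := Module.compHom H φ
  have hsmul (r : R) (h : H) : r • h = φ r * h := rfl
  set C := AddSubgroup.closure {x : n → H | ∃ (c : n → R) (h : H),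
      (∀ s, ∑ y, d s y * c y = 0) ∧ x = fun y => φ (c y) * h} with hC
  let D : (n → R) →ₗ[Rᵐᵒᵖ] (m → R) :=
    { toFun := fun x s => ∑ y, d s y * x y
      map_add' := fun x x' => by ext s; simp [mul_add, Finset.sum_add_distrib]
      map_smul' := fun r x => by ext s; simp [Finset.sum_mul, mul_assoc] }
  let K := LinearMap.ker D
  let j : ((n → R) ⧸ K) →ₗ[Rᵐᵒᵖ] (m → R) := K.liftQ D le_rfl
  have hj : Function.Injective j := LinearMap.ker_eq_bot.1 (Submodule.ker_liftQ_eq_bot _ _ _ le_rfl)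
  have hinj := hφ _ _ j hj
  -- evaluation `(n → R) / K ⊗ H → (n → H) / C`
  let ev₀ : (n → R) →+ H →+ ((n → H) ⧸ C) :=
    AddMonoidHom.mk' (fun x => (QuotientAddGroup.mk' C).comp
      (AddMonoidHom.mk' (fun h y => φ (x y) * h) fun h h' => by ext; simp [mul_add]))
      fun x x' => by
        ext h
        refine (congrArg (QuotientAddGroup.mk' C) ?_).trans (map_add (QuotientAddGroup.mk' C) _ _)
        ext; simp [add_mul]
  let ev₁ : ((n → R) ⧸ K) →+ H →+ ((n → H) ⧸ C) :=
    QuotientAddGroup.lift K.toAddSubgroup ev₀ fun x hx => by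
      ext h
      refine (QuotientAddGroup.eq_zero_iff _).2
        (AddSubgroup.subset_closure ⟨x, h, fun s => ?_, rfl⟩)
      exact congrFun (show D x = 0 from hx) s
  have hev₁ (x : n → R) (h : H) :
      ev₁ (Submodule.Quotient.mk x) h = QuotientAddGroup.mk' C (fun y => φ (x y) * h) := rfl
  let ev₂ : ((n → R) ⧸ K) ⊗[ℤ] H →+ ((n → H) ⧸ C) :=
    TensorProduct.liftAddHom ev₁ fun r x h => by
      rw [map_zsmul, map_zsmul]; rfl
  let ev : BalancedTensor R ((n → R) ⧸ K) H →+ ((n → H) ⧸ C) :=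
    QuotientAddGroup.lift _ ev₂ <| by
      refine (AddSubgroup.closure_le _).2 ?_
      rintro _ ⟨x, r, h, rfl⟩
      obtain ⟨x, rfl⟩ := Submodule.Quotient.mk_surjective K x
      rw [SetLike.mem_coe, AddMonoidHom.mem_ker, map_sub, sub_eq_zero]
      change ev₁ (Submodule.Quotient.mk (op r • x)) h = ev₁ (Submodule.Quotient.mk x) (r • h)
      rw [hev₁, hev₁, hsmul]
      simp [mul_assoc]
  let e (y : n) : (n → R) ⧸ K := Submodule.Quotient.mk (Pi.single y 1)
  let t : BalancedTensor R ((n → R) ⧸ K) H := QuotientAddGroup.mk' _ (∑ y, e y ⊗ₜ[ℤ] N y)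
  have ht : BalancedTensor.mapLeft j H t = 0 := by
    have hmove (s : m) (r : R) (h : H) :
        (QuotientAddGroup.mk' (balancedRel R (m → R) H)) (Pi.single s r ⊗ₜ[ℤ] h) =
        (QuotientAddGroup.mk' (balancedRel R (m → R) H)) (Pi.single s 1 ⊗ₜ[ℤ] (φ r * h)) := by
      rw [← sub_eq_zero, ← map_sub]
      refine (QuotientAddGroup.eq_zero_iff _).2 (AddSubgroup.subset_closure
        ⟨Pi.single s 1, r, h, ?_⟩)
      rw [hsmul, ← Pi.single_smul]
      simp
    change QuotientAddGroup.mk' _ (j.toAddMonoidHom.toIntLinearMap.rTensor H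
      (∑ y, e y ⊗ₜ[ℤ] N y)) = 0
    have hje (y : n) : j (e y) = ∑ s, Pi.single s (d s y) := by
      refine (show j (e y) = D (Pi.single y 1) from rfl).trans ?_
      ext s
      simp [D, Pi.single_apply]
    rw [map_sum, map_sum]
    have : ∀ y, (QuotientAddGroup.mk' (balancedRel R (m → R) H))
        ((j.toAddMonoidHom.toIntLinearMap.rTensor H) (e y ⊗ₜ[ℤ] N y)) =
        ∑ s, (QuotientAddGroup.mk' (balancedRel R (m → R) H))
          (Pi.single s 1 ⊗ₜ[ℤ] (φ (d s y) * N y)) := fun y => by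
      rw [LinearMap.rTensor_tmul]
      change QuotientAddGroup.mk' _ (j (e y) ⊗ₜ[ℤ] N y) = _
      rw [hje, TensorProduct.sum_tmul, map_sum]
      exact Finset.sum_congr rfl fun s _ => hmove s _ _
    rw [Finset.sum_congr rfl fun y _ => this y, Finset.sum_comm]
    refine Finset.sum_eq_zero fun s _ => ?_
    rw [← map_sum, ← TensorProduct.tmul_sum, hN, TensorProduct.tmul_zero, map_zero]
  have ht0 : t = 0 := hinj (ht.trans (map_zero _).symm)
  have hevt : ev t = QuotientAddGroup.mk' C N := by
    change ev₂ (∑ y, e y ⊗ₜ[ℤ] N y) = _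
    rw [map_sum]
    have : ∀ y, ev₂ (e y ⊗ₜ[ℤ] N y) = QuotientAddGroup.mk' C (Pi.single y (N y)) := fun y => by
      change ev₁ (Submodule.Quotient.mk (Pi.single y 1)) (N y) = _
      rw [hev₁]
      congr 1
      ext z
      by_cases hz : z = y
      · subst hz; simp
      · simp [hz]
    rw [Finset.sum_congr rfl fun y _ => this y, ← map_sum, Finset.univ_sum_single]
  rw [ht0, map_zero] at hevt
  exact (QuotientAddGroup.eq_zero_iff _).1 hevt.symm

/-- Equational criterion for flatness on the right: a solution in `H` of a finite system of right
linear equations with coefficients in `R` is a combination of solutions in `R`. -/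
theorem RightFlatOver.solution_mem_closure {φ : R →+* H} (hφ : RightFlatOver φ) (d : m → n → R)
    (N : n → H) (hN : ∀ s, ∑ y, N y * φ (d s y) = 0) :
    N ∈ AddSubgroup.closure {x : n → H | ∃ (c : n → R) (h : H),
      (∀ s, ∑ y, c y * d s y = 0) ∧ x = fun y => h * φ (c y)} := by
  classical
  let _ : Module Rᵐᵒᵖ H := Module.compHom H (RingHom.op φ)
  have hsmul (r : R) (h : H) : op r • h = h * φ r := rfl
  set C := AddSubgroup.closure {x : n → H | ∃ (c : n → R) (h : H),
      (∀ s, ∑ y, c y * d s y = 0) ∧ x = fun y => h * φ (c y)} with hC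
  let D : (n → R) →ₗ[R] (m → R) :=
    { toFun := fun x s => ∑ y, x y * d s y
      map_add' := fun x x' => by ext s; simp [add_mul, Finset.sum_add_distrib]
      map_smul' := fun r x => by ext s; simp [Finset.mul_sum, mul_assoc] }
  let K := LinearMap.ker D
  let j : ((n → R) ⧸ K) →ₗ[R] (m → R) := K.liftQ D le_rfl
  have hj : Function.Injective j := LinearMap.ker_eq_bot.1 (Submodule.ker_liftQ_eq_bot _ _ _ le_rfl)
  have hinj := hφ _ _ j hj
  let ev₀ : (n → R) →+ H →+ ((n → H) ⧸ C) :=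
    AddMonoidHom.mk' (fun x => (QuotientAddGroup.mk' C).comp
      (AddMonoidHom.mk' (fun h y => h * φ (x y)) fun h h' => by ext; simp [add_mul]))
      fun x x' => by
        ext h
        refine (congrArg (QuotientAddGroup.mk' C) ?_).trans (map_add (QuotientAddGroup.mk' C) _ _)
        ext; simp [mul_add]
  let ev₁ : ((n → R) ⧸ K) →+ H →+ ((n → H) ⧸ C) :=
    QuotientAddGroup.lift K.toAddSubgroup ev₀ fun x hx => by
      ext h
      refine (QuotientAddGroup.eq_zero_iff _).2
        (AddSubgroup.subset_closure ⟨x, h, fun s => ?_, rfl⟩)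
      exact congrFun (show D x = 0 from hx) s
  have hev₁ (x : n → R) (h : H) :
      ev₁ (Submodule.Quotient.mk x) h = QuotientAddGroup.mk' C (fun y => h * φ (x y)) := rfl
  let ev₂ : H ⊗[ℤ] ((n → R) ⧸ K) →+ ((n → H) ⧸ C) :=
    TensorProduct.liftAddHom ev₁.flip fun r x h => by
      rw [map_zsmul, map_zsmul]; rfl
  let ev : BalancedTensor R H ((n → R) ⧸ K) →+ ((n → H) ⧸ C) :=
    QuotientAddGroup.lift _ ev₂ <| by
      refine (AddSubgroup.closure_le _).2 ?_
      rintro _ ⟨h, r, x, rfl⟩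
      obtain ⟨x, rfl⟩ := Submodule.Quotient.mk_surjective K x
      rw [SetLike.mem_coe, AddMonoidHom.mem_ker, map_sub, sub_eq_zero]
      change ev₁ (Submodule.Quotient.mk x) (op r • h) = ev₁ (Submodule.Quotient.mk (r • x)) h
      rw [hev₁, hev₁, hsmul]
      simp [mul_assoc]
  let e (y : n) : (n → R) ⧸ K := Submodule.Quotient.mk (Pi.single y 1)
  let t : BalancedTensor R H ((n → R) ⧸ K) := QuotientAddGroup.mk' _ (∑ y, N y ⊗ₜ[ℤ] e y)
  have ht : BalancedTensor.mapRight H j t = 0 := by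
    have hmove (s : m) (r : R) (h : H) :
        (QuotientAddGroup.mk' (balancedRel R H (m → R))) (h ⊗ₜ[ℤ] Pi.single s r) =
        (QuotientAddGroup.mk' (balancedRel R H (m → R))) ((h * φ r) ⊗ₜ[ℤ] Pi.single s 1) := by
      symm
      rw [← sub_eq_zero, ← map_sub]
      refine (QuotientAddGroup.eq_zero_iff _).2 (AddSubgroup.subset_closure
        ⟨h, r, Pi.single s 1, ?_⟩)
      rw [hsmul, ← Pi.single_smul]
      simp
    change QuotientAddGroup.mk' _ (j.toAddMonoidHom.toIntLinearMap.lTensor H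
      (∑ y, N y ⊗ₜ[ℤ] e y)) = 0
    have hje (y : n) : j (e y) = ∑ s, Pi.single s (d s y) := by
      refine (show j (e y) = D (Pi.single y 1) from rfl).trans ?_
      ext s
      simp [D, Pi.single_apply]
    rw [map_sum, map_sum]
    have : ∀ y, (QuotientAddGroup.mk' (balancedRel R H (m → R)))
        ((j.toAddMonoidHom.toIntLinearMap.lTensor H) (N y ⊗ₜ[ℤ] e y)) =
        ∑ s, (QuotientAddGroup.mk' (balancedRel R H (m → R)))
          ((N y * φ (d s y)) ⊗ₜ[ℤ] Pi.single s 1) := fun y => by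
      rw [LinearMap.lTensor_tmul]
      change QuotientAddGroup.mk' _ (N y ⊗ₜ[ℤ] j (e y)) = _
      rw [hje, TensorProduct.tmul_sum, map_sum]
      exact Finset.sum_congr rfl fun s _ => hmove s _ _
    rw [Finset.sum_congr rfl fun y _ => this y, Finset.sum_comm]
    refine Finset.sum_eq_zero fun s _ => ?_
    rw [← map_sum, ← TensorProduct.sum_tmul, hN, TensorProduct.zero_tmul, map_zero]
  have ht0 : t = 0 := hinj (ht.trans (map_zero _).symm)
  have hevt : ev t = QuotientAddGroup.mk' C N := by
    change ev₂ (∑ y, N y ⊗ₜ[ℤ] e y) = _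
    rw [map_sum]
    have : ∀ y, ev₂ (N y ⊗ₜ[ℤ] e y) = QuotientAddGroup.mk' C (Pi.single y (N y)) := fun y => by
      change ev₁ (Submodule.Quotient.mk (Pi.single y 1)) (N y) = _
      rw [hev₁]
      congr 1
      ext z
      by_cases hz : z = y
      · subst hz; simp
      · simp [hz]
    rw [Finset.sum_congr rfl fun y _ => this y, ← map_sum, Finset.univ_sum_single]
  rw [ht0, map_zero] at hevt
  exact (QuotientAddGroup.eq_zero_iff _).1 hevt.symm

end FlatSystems

/-! ### Flatness and projectivity -/

section Projective

variable {k A : Type u} {ι : Type} [Field k] [Ring A] [HopfAlgebra k A] [Fintype ι] [DecidableEq ι]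

/-- The matrix representation of `A` on a module with a finite `k`-basis. -/
def matrixRep {V : Type*} [AddCommGroup V] [Module k V] [Module A V] [IsScalarTower k A V]
    (b : Module.Basis ι k V) : A →ₐ[k] Matrix ι ι k :=
  (LinearMap.toMatrixAlgEquiv b).toAlgHom.comp (Algebra.lsmul k k V)

theorem repr_smul {V : Type*} [AddCommGroup V] [Module k V] [Module A V] [IsScalarTower k A V]
    (b : Module.Basis ι k V) (a : A) (v : V) (i : ι) :
    b.repr (a • v) i = ∑ j, matrixRep b a i j * b.repr v j := by
  have := congrFun (LinearMap.toMatrix_mulVec_repr b b (Algebra.lsmul k k V a) v) i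
  exact this.symm

theorem smul_basis {V : Type*} [AddCommGroup V] [Module k V] [Module A V] [IsScalarTower k A V]
    (b : Module.Basis ι k V) (a : A) (j : ι) :
    a • b j = ∑ i, matrixRep b a i j • b i := by
  rw [← b.sum_repr (a • b j)]
  refine Finset.sum_congr rfl fun i _ => ?_
  simp [repr_smul, Finsupp.single_apply]

theorem sum_counit_right_smul {C κ : Type*} [AddCommGroup C] [Module k C] [Coalgebra k C] {c : C}
    (r : Coalgebra.Repr k c κ) : ∑ i ∈ r.index, counit (R := k) (r.right i) • r.left i = c := by
  have h := congrArg (TensorProduct.rid k C) (Coalgebra.sum_tmul_counit_eq r)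
  simpa only [map_sum, TensorProduct.rid_tmul, one_smul] using h

theorem toConv_mulLeft_mul {C E : Type*} [AddCommGroup C] [Module k C] [Coalgebra k C] [Ring E]
    [Algebra k E] (x : E) (f g : C →ₗ[k] E) :
    toConv (LinearMap.mulLeft k x ∘ₗ f) * toConv g =
      toConv (LinearMap.mulLeft k x ∘ₗ (toConv f * toConv g).ofConv) := by
  refine WithConv.ext (LinearMap.ext fun c => ?_)
  refine ((ℛ k c).convMul_apply _ _).trans ?_
  refine Eq.trans ?_ (congrArg (x * ·) ((ℛ k c).convMul_apply _ _)).symm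
  simp [Finset.mul_sum, mul_assoc]

/-- `∑ g₍₁₎ t(S g₍₂₎)` intertwines the diagonal action of `A` on `A ⊗ V` with the action on the
first factor. -/
theorem sum_twist_antipode_mul (t : A →ₐ[k] Matrix ι ι k) (x g : A) :
    ∑ s ∈ (ℛ k x).index, twist LinearMap.id (t.toLinearMap ∘ₗ HopfAlgebra.antipode k)
        ((ℛ k x).left s * g) * constMat k A ι (t ((ℛ k x).right s)) =
      scalarMat k A ι x * twist LinearMap.id (t.toLinearMap ∘ₗ HopfAlgebra.antipode k) g := by
  set U := twist (LinearMap.id : A →ₗ[k] A) (t.toLinearMap ∘ₗ HopfAlgebra.antipode k) with hU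
  set c := (constMat k A ι).comp t
  set sc := toConv (scalarMat k A ι).toLinearMap
  set cS := c.toLinearMap ∘ₗ HopfAlgebra.antipode k
  have hmul (y : A) : U (y * g) = (sc * toConv (LinearMap.mulLeft k (U g) ∘ₗ cS)) y := by
    refine Eq.trans ?_ ((ℛ k y).convMul_apply _ _).symm
    rw [hU, twist_repr _ _ ((ℛ k y).mul (ℛ k g)), twist_repr _ _ (ℛ k g)]
    refine (Finset.sum_product (ℛ k y).index (ℛ k g).index _).trans ?_
    refine Finset.sum_congr rfl fun p _ => ?_
    simp only [sc, cS, c, LinearMap.comp_apply, LinearMap.mulLeft_apply, AlgHom.toLinearMap_apply,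
      AlgHom.comp_apply, Finset.sum_mul, Finset.mul_sum]
    refine Finset.sum_congr rfl fun q _ => ?_
    simp [HopfAlgebra.antipode_mul_antidistrib, mul_assoc, Coalgebra.Repr.mul]
  simp only [hmul]
  have h := (ℛ k x).convMul_apply (sc * toConv (LinearMap.mulLeft k (U g) ∘ₗ cS))
    (toConv c.toLinearMap)
  refine h.symm.trans ?_
  rw [mul_assoc, toConv_mulLeft_mul, c.conv_antipode_mul]
  have h1 : toConv (LinearMap.mulLeft k (U g) ∘ₗ
      (1 : WithConv (A →ₗ[k] Matrix ι ι A)).ofConv) =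
      toConv (LinearMap.mulLeft k (U g) ∘ₗ Algebra.linearMap k _ ∘ₗ counit) := rfl
  rw [h1]
  refine ((ℛ k x).convMul_apply _ _).trans ?_
  simp only [sc, LinearMap.comp_apply, LinearMap.mulLeft_apply, AlgHom.toLinearMap_apply,
    Algebra.linearMap_apply, ← Algebra.commutes]
  simp only [← mul_assoc, ← Algebra.commutes]
  simp only [← Finset.sum_mul, ← Algebra.smul_def, ← map_smul, ← map_sum]
  rw [sum_counit_right_smul]

theorem sum_twist_antipode_smul {V : Type*} [AddCommGroup V] [Module k V] [Module A V]
    [IsScalarTower k A V] (b : Module.Basis ι k V) (g : A) (i : ι) :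
    ∑ l, twist LinearMap.id ((matrixRep b).toLinearMap ∘ₗ HopfAlgebra.antipode k) g l i • b l =
      counit (R := k) g • b i := by
  simp only [twist_apply _ _ (ℛ k g), Finset.sum_smul]
  rw [Finset.sum_comm]
  have : ∀ s, ∑ l, (((matrixRep b).toLinearMap ∘ₗ HopfAlgebra.antipode k)
      ((ℛ k g).right s) l i • LinearMap.id (R := k) ((ℛ k g).left s)) • b l =
      ((ℛ k g).left s * HopfAlgebra.antipode k ((ℛ k g).right s)) • b i := fun s => by
    rw [mul_smul, smul_basis, Finset.smul_sum]
    refine Finset.sum_congr rfl fun l _ => ?_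
    rw [smul_comm]
    simp
  rw [Finset.sum_congr rfl fun s _ => this s, ← Finset.sum_smul,
    HopfAlgebra.sum_mul_antipode_eq_smul,
    smul_assoc, one_smul]

/-- A module is projective if the augmentation `A ⊗ V → V` from the diagonal module `A ⊗ V`, which
is free, has a section; the section is given by a matrix `G` over `A`. -/
theorem projective_of_bwd {V : Type*} [AddCommGroup V] [Module k V] [Module A V]
    [IsScalarTower k A V] (b : Module.Basis ι k V) (G : Matrix ι ι A)
    (hG : Bwd (matrixRep b).toLinearMap LinearMap.id G)
    (hε : ∀ i j, counit (R := k) (G i j) = if i = j then 1 else 0) : Module.Projective A V := by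
  set U := twist (LinearMap.id : A →ₗ[k] A)
    ((matrixRep b).toLinearMap ∘ₗ HopfAlgebra.antipode k) with hU
  let L : Matrix ι ι A := fun l j => ∑ i, U (G i j) l i
  have hL (x : A) (l m : ι) : ∑ j, matrixRep b x j m • L l j = x * L l m := by
    have h1 (i : ι) : ∑ j, matrixRep b x j m • U (G i j) =
        ∑ p, ∑ s ∈ (ℛ k x).index,
          matrixRep b ((ℛ k x).right s) i p • U ((ℛ k x).left s * G p m) := by
      have := congrFun (congrFun (hG x) i) m
      rw [mul_constMat_apply, Matrix.mul_apply] at this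
      replace this := congrArg U this
      rw [map_sum, map_sum] at this
      simp only [map_smul] at this
      refine this.trans (Finset.sum_congr rfl fun p _ => ?_)
      rw [twist_apply _ _ (ℛ k x), Finset.sum_mul, map_sum]
      simp
    have h2 : ∑ j, matrixRep b x j m • L l j = ∑ i, (∑ j, matrixRep b x j m • U (G i j)) l i := by
      simp only [L, Finset.smul_sum, Matrix.sum_apply, Matrix.smul_apply]
      exact Finset.sum_comm
    have h3 (p : ι) : ∑ s ∈ (ℛ k x).index, ∑ i,
        matrixRep b ((ℛ k x).right s) i p • U ((ℛ k x).left s * G p m) l i = x * U (G p m) l p := by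
      have := congrFun (congrFun (sum_twist_antipode_mul (matrixRep b) x (G p m)) l) p
      rw [scalarMat_mul_apply, Matrix.sum_apply] at this
      rw [← this]
      exact Finset.sum_congr rfl fun s _ => (mul_constMat_apply _ _ _ _).symm
    rw [h2, Finset.mul_sum, Finset.sum_congr rfl fun i _ => congrFun (congrFun (h1 i) l) i]
    simp only [Matrix.sum_apply, Matrix.smul_apply]
    rw [Finset.sum_comm]
    refine Finset.sum_congr rfl fun p _ => ?_
    rw [Finset.sum_comm, h3]
  let ℓ : V →ₗ[A] (ι → A) :=
    { toFun := fun v l => ∑ j, b.repr v j • L l j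
      map_add' := fun v w => by ext l; simp [add_smul, Finset.sum_add_distrib]
      map_smul' := fun x v => by
        ext l
        simp only [repr_smul, Finset.sum_smul, RingHom.id_apply, Pi.smul_apply, smul_eq_mul,
          Finset.mul_sum, mul_smul_comm, ← hL, Finset.smul_sum, smul_smul]
        rw [Finset.sum_comm]
        simp only [mul_comm] }
  let P : (ι → A) →ₗ[A] V := Fintype.linearCombination A b
  refine Module.Projective.of_split ℓ P ?_
  have hP : ∀ j, P (ℓ (b j)) = b j := fun j => by
    have : ℓ (b j) = fun l => L l j := by
      ext l; simp [ℓ, Finsupp.single_apply]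
    rw [this, Fintype.linearCombination_apply]
    simp only [L, Finset.sum_smul]
    rw [Finset.sum_comm]
    simp only [hU, sum_twist_antipode_smul, hε]
    simp
  have : (P.restrictScalars k) ∘ₗ (ℓ.restrictScalars k) = LinearMap.id := b.ext hP
  ext v
  exact congrArg (fun f => f v) this

variable [FiniteDimensional k A] {H : Type u} [Ring H] [HopfAlgebra k H]

/-- If `H` is flat as a left `A`-module then the relation `N t(a) = (∑ φ(a₍₁₎) t(a₍₂₎)) N` has a
solution over `A` as soon as it has one over `H`. -/
theorem LeftFlatOver.exists_bwd {φ : A →ₐc[k] H} (hφ : LeftFlatOver (φ : A →+* H))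
    (t : A →ₗ[k] Matrix ι ι k) (N : Matrix ι ι H)
    (hN : Bwd t (φ : A →ₐ[k] H).toLinearMap N)
    (hε : ∀ i j, counit (R := k) (N i j) = if i = j then 1 else 0) :
    ∃ G : Matrix ι ι A, Bwd t LinearMap.id G ∧
      ∀ i j, counit (R := k) (G i j) = if i = j then 1 else 0 := by
  let b := Module.finBasis k A
  let d : (Fin (Module.finrank k A) × ι × ι) → (ι × ι) → A := fun s y =>
    (if y.1 = s.2.1 then algebraMap k A (t (b s.1) y.2 s.2.2) else 0) -
      (if y.2 = s.2.2 then twist LinearMap.id t (b s.1) s.2.1 y.1 else 0)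
  have hd {R : Type u} [Ring R] [Algebra k R] (ψ : A →ₐ[k] R) (M : ι × ι → R) :
      (∀ s, ∑ y, ψ (d s y) * M y = 0) ↔ Bwd t ψ.toLinearMap (Matrix.of fun i j => M (i, j)) := by
    have h1 (s i j) : ∑ y, ψ (d (s, i, j) y) * M y =
        ((Matrix.of fun i j => M (i, j)) * constMat k R ι (t (b s)) -
          twist ψ.toLinearMap t (b s) * (Matrix.of fun i j => M (i, j))) i j := by
      rw [Matrix.sub_apply, mul_constMat_apply, Matrix.mul_apply, Fintype.sum_prod_type]
      simp only [d, twist_algHom, map_sub, sub_mul, Finset.sum_sub_distrib, Matrix.of_apply]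
      congr 1
      · rw [Finset.sum_eq_single i (fun p _ hp => by simp [hp]) (by simp)]
        simp [Algebra.smul_def]
      · refine Finset.sum_congr rfl fun p _ => ?_
        rw [Finset.sum_eq_single j (fun q _ hq => by simp [hq]) (by simp)]
        simp
    constructor
    · intro h a
      have h2 : LinearMap.mulLeft k (Matrix.of fun i j => M (i, j)) ∘ₗ
          (constMat k R ι).toLinearMap ∘ₗ t =
          LinearMap.mulRight k (Matrix.of fun i j => M (i, j)) ∘ₗ twist ψ.toLinearMap t := by
        refine b.ext fun s => ?_
        ext i j
        have := h (s, i, j)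
        rw [h1, Matrix.sub_apply, sub_eq_zero] at this
        exact this
      exact congrArg (fun f => f a) h2
    · rintro h ⟨s, i, j⟩
      rw [h1, Matrix.sub_apply, sub_eq_zero, h]
  have hmem := hφ.solution_mem_closure (n := ι × ι) d (fun y => N y.1 y.2) fun s =>
    (hd (φ : A →ₐ[k] H) (fun y => N y.1 y.2)).2 hN s
  have key : ∃ c : ι × ι → A, (∀ s, ∑ y, d s y * c y = 0) ∧
      ∀ y, counit (R := k) (N y.1 y.2) = counit (R := k) (c y) := by
    refine AddSubgroup.closure_induction (p := fun x _ => ∃ c : ι × ι → A,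
      (∀ s, ∑ y, d s y * c y = 0) ∧ ∀ y, counit (R := k) (x y) = counit (R := k) (c y))
      ?_ ?_ ?_ ?_ hmem
    · rintro _ ⟨c, h, hc, rfl⟩
      refine ⟨fun y => counit (R := k) h • c y, fun s => ?_, fun y => ?_⟩
      · simp only [mul_smul_comm, ← Finset.smul_sum, hc, smul_zero]
      · have : counit (R := k) (φ (c y)) = counit (R := k) (c y) :=
          CoalgHomClass.counit_comp_apply φ _
        simpa [this] using mul_comm _ _
    · exact ⟨0, by simp, by simp⟩
    · rintro x x' _ _ ⟨c, hc, he⟩ ⟨c', hc', he'⟩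
      exact ⟨c + c', fun s => by simp [mul_add, Finset.sum_add_distrib, hc, hc'],
        fun y => by simp [he, he']⟩
    · rintro x _ ⟨c, hc, he⟩
      exact ⟨-c, fun s => by simp [hc], fun y => by simp [he]⟩
  obtain ⟨c, hc, he⟩ := key
  refine ⟨Matrix.of fun i j => c (i, j), (hd (AlgHom.id k A) c).1 hc, fun i j => ?_⟩
  exact (he (i, j)).symm.trans (hε i j)

/-- If `H` is flat as a right `A`-module then the relation `t(a) M = M ∑ φ(a₍₁₎) t(a₍₂₎)` has a
solution over `A` as soon as it has one over `H`. -/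
theorem RightFlatOver.exists_fwd {φ : A →ₐc[k] H} (hφ : RightFlatOver (φ : A →+* H))
    (t : A →ₗ[k] Matrix ι ι k) (M : Matrix ι ι H)
    (hM : Fwd t (φ : A →ₐ[k] H).toLinearMap M)
    (hε : ∀ i j, counit (R := k) (M i j) = if i = j then 1 else 0) :
    ∃ G : Matrix ι ι A, Fwd t LinearMap.id G ∧
      ∀ i j, counit (R := k) (G i j) = if i = j then 1 else 0 := by
  let b := Module.finBasis k A
  let d : (Fin (Module.finrank k A) × ι × ι) → (ι × ι) → A := fun s y =>
    (if y.2 = s.2.2 then algebraMap k A (t (b s.1) s.2.1 y.1) else 0) -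
      (if y.1 = s.2.1 then twist LinearMap.id t (b s.1) y.2 s.2.2 else 0)
  have hd {R : Type u} [Ring R] [Algebra k R] (ψ : A →ₐ[k] R) (N : ι × ι → R) :
      (∀ s, ∑ y, N y * ψ (d s y) = 0) ↔ Fwd t ψ.toLinearMap (Matrix.of fun i j => N (i, j)) := by
    have h1 (s i j) : ∑ y, N y * ψ (d (s, i, j) y) =
        (constMat k R ι (t (b s)) * (Matrix.of fun i j => N (i, j)) -
          (Matrix.of fun i j => N (i, j)) * twist ψ.toLinearMap t (b s)) i j := by
      rw [Matrix.sub_apply, constMat_mul_apply, Matrix.mul_apply, Fintype.sum_prod_type]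
      simp only [d, twist_algHom, map_sub, mul_sub, Finset.sum_sub_distrib, Matrix.of_apply]
      congr 1
      · refine Finset.sum_congr rfl fun p _ => ?_
        rw [Finset.sum_eq_single j (fun q _ hq => by simp [hq]) (by simp)]
        simp [Algebra.smul_def, Algebra.commutes]
      · rw [Finset.sum_eq_single i (fun p _ hp => by simp [hp]) (by simp)]
        simp
    constructor
    · intro h a
      have h2 : LinearMap.mulRight k (Matrix.of fun i j => N (i, j)) ∘ₗ
          (constMat k R ι).toLinearMap ∘ₗ t =
          LinearMap.mulLeft k (Matrix.of fun i j => N (i, j)) ∘ₗ twist ψ.toLinearMap t := by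
        refine b.ext fun s => ?_
        ext i j
        have := h (s, i, j)
        rw [h1, Matrix.sub_apply, sub_eq_zero] at this
        exact this
      exact congrArg (fun f => f a) h2
    · rintro h ⟨s, i, j⟩
      rw [h1, Matrix.sub_apply, sub_eq_zero, h]
  have hmem := hφ.solution_mem_closure (n := ι × ι) d (fun y => M y.1 y.2) fun s =>
    (hd (φ : A →ₐ[k] H) (fun y => M y.1 y.2)).2 hM s
  have key : ∃ c : ι × ι → A, (∀ s, ∑ y, c y * d s y = 0) ∧
      ∀ y, counit (R := k) (M y.1 y.2) = counit (R := k) (c y) := by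
    refine AddSubgroup.closure_induction (p := fun x _ => ∃ c : ι × ι → A,
      (∀ s, ∑ y, c y * d s y = 0) ∧ ∀ y, counit (R := k) (x y) = counit (R := k) (c y))
      ?_ ?_ ?_ ?_ hmem
    · rintro _ ⟨c, h, hc, rfl⟩
      refine ⟨fun y => counit (R := k) h • c y, fun s => ?_, fun y => ?_⟩
      · simp only [smul_mul_assoc, ← Finset.smul_sum, hc, smul_zero]
      · have : counit (R := k) (φ (c y)) = counit (R := k) (c y) :=
          CoalgHomClass.counit_comp_apply φ _
        simp [this]
    · exact ⟨0, by simp, by simp⟩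
    · rintro x x' _ _ ⟨c, hc, he⟩ ⟨c', hc', he'⟩
      exact ⟨c + c', fun s => by simp [add_mul, Finset.sum_add_distrib, hc, hc'],
        fun y => by simp [he, he']⟩
    · rintro x _ ⟨c, hc, he⟩
      exact ⟨-c, fun s => by simp [hc], fun y => by simp [he]⟩
  obtain ⟨c, hc, he⟩ := key
  refine ⟨Matrix.of fun i j => c (i, j), (hd (AlgHom.id k A) c).1 hc, fun i j => ?_⟩
  exact (he (i, j)).symm.trans (hε i j)

/-- The antipode turns a solution of `t(a) G = G ∑ a₍₁₎ t(a₍₂₎)` over `A` into a solution of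
`G t(a) = (∑ a₍₁₎ t(a₍₂₎)) G`. -/
theorem Fwd.bwd_map_antipode {t : A →ₗ[k] Matrix ι ι k} {G : Matrix ι ι A}
    (hG : Fwd t LinearMap.id G) : Bwd t LinearMap.id (G.map (HopfAlgebra.antipode k)) := by
  refine (bwd_iff (AlgHom.id k A).conv_antipode_mul (AlgHom.id k A).conv_mul_antipode _).2
    fun a => ?_
  ext i j
  have := congrArg (HopfAlgebra.antipode k) (congrFun (congrFun (hG a) i) j)
  rw [constMat_mul_apply, Matrix.mul_apply, map_sum, map_sum] at this
  rw [constMat_mul_apply, Matrix.sum_apply]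
  simp only [scalarMat_mul_apply, mul_constMat_apply, Matrix.map_apply]
  simp only [map_smul] at this
  rw [this]
  simp only [twist_apply _ t (ℛ k a), HopfAlgebra.antipode_mul_antidistrib, map_sum, map_smul,
    Finset.mul_sum]
  rw [Finset.sum_comm]
  simp

/-- A Hopf algebra over which the representation of `A` on `V` becomes conjugate to its diagonal
twist can be flat over `A`, on either side, only if `V` is projective. -/
theorem projective_of_flat {V : Type*} [AddCommGroup V] [Module k V] [Module A V]
    [IsScalarTower k A V] (b : Module.Basis ι k V) (φ : A →ₐc[k] H) (M N : Matrix ι ι H)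
    (hM : Fwd (matrixRep b).toLinearMap (φ : A →ₐ[k] H).toLinearMap M)
    (hMN : M * N = 1) (hNM : N * M = 1)
    (hε : ∀ i j, counit (R := k) (M i j) = if i = j then 1 else 0)
    (hflat : LeftFlatOver (φ : A →+* H) ∨ RightFlatOver (φ : A →+* H)) :
    Module.Projective A V := by
  rcases hflat with h | h
  · obtain ⟨G, hG, hGε⟩ := h.exists_bwd _ N (hM.bwd hMN hNM) fun i j => by
      have hM1 : (Bialgebra.counitAlgHom k H).mapMatrix M = 1 := by
        ext i j; simpa [Matrix.one_apply] using hε i j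
      have := congrArg (Bialgebra.counitAlgHom k H).mapMatrix hMN
      rw [map_mul, hM1, one_mul, map_one] at this
      simpa [Matrix.one_apply] using congrFun (congrFun this i) j
    exact projective_of_bwd b G hG hGε
  · obtain ⟨G, hG, hGε⟩ := h.exists_fwd _ M hM hε
    exact projective_of_bwd b _ hG.bwd_map_antipode fun i j => by simp [hGε]

end Projective


/-! ### Integrals on finite-dimensional Hopf algebras -/

section Hits

variable {k A : Type*} [Field k] [Ring A] [HopfAlgebra k A]

/-- The operator `x ↦ ∑ f(x₍₁₎) x₍₂₎` on a Hopf algebra. -/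
def hitL (f : A →ₗ[k] k) : A →ₗ[k] A :=
  (toConv (Algebra.linearMap k A ∘ₗ f) * toConv LinearMap.id).ofConv

/-- The operator `x ↦ ∑ x₍₁₎ f(x₍₂₎)` on a Hopf algebra. -/
def hitR (f : A →ₗ[k] k) : A →ₗ[k] A :=
  (toConv LinearMap.id * toConv (Algebra.linearMap k A ∘ₗ f)).ofConv

theorem hitL_repr (f : A →ₗ[k] k) {κ : Type*} {x : A} (r : Coalgebra.Repr k x κ) :
    hitL f x = ∑ i ∈ r.index, f (r.left i) • r.right i := by
  refine (r.convMul_apply _ _).trans ?_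
  simp [Algebra.smul_def]

theorem hitR_repr (f : A →ₗ[k] k) {κ : Type*} {x : A} (r : Coalgebra.Repr k x κ) :
    hitR f x = ∑ i ∈ r.index, f (r.right i) • r.left i := by
  refine (r.convMul_apply _ _).trans ?_
  simp [Algebra.smul_def, Algebra.commutes]

theorem counit_hitR (f : A →ₗ[k] k) (x : A) : counit (R := k) (hitR f x) = f x := by
  rw [hitR_repr f (ℛ k x), map_sum]
  conv_rhs => rw [← Coalgebra.sum_counit_smul (ℛ k x), map_sum]
  simp [mul_comm]

/-- An element is recovered from its right hits by a basis: `Δ x = ∑ (xₘ ⊗ eₘ)`. -/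
theorem comul_eq_sum_hitR {κ : Type*} [Fintype κ] (e : Module.Basis κ k A) (x : A) :
    comul (R := k) x = ∑ m, hitR (e.coord m) x ⊗ₜ[k] e m := by
  simp only [hitR_repr _ (ℛ k x), TensorProduct.sum_tmul, TensorProduct.smul_tmul]
  rw [Finset.sum_comm, ← (ℛ k x).eq]
  refine Finset.sum_congr rfl fun i _ => ?_
  rw [← TensorProduct.tmul_sum]
  simp only [Module.Basis.coord_apply, e.sum_repr]

theorem hitL_hitR (f g : A →ₗ[k] k) (x : A) : hitL f (hitR g x) = hitR g (hitL f x) := by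
  have h := mul_assoc (toConv (Algebra.linearMap k A ∘ₗ f)) (toConv LinearMap.id)
    (toConv (Algebra.linearMap k A ∘ₗ g))
  have h' := congrArg (fun φ => φ.ofConv x) h
  have h1 := (ℛ k x).convMul_apply (toConv (Algebra.linearMap k A ∘ₗ f) * toConv LinearMap.id)
    (toConv (Algebra.linearMap k A ∘ₗ g))
  have h2 := (ℛ k x).convMul_apply (toConv (Algebra.linearMap k A ∘ₗ f))
    (toConv LinearMap.id * toConv (Algebra.linearMap k A ∘ₗ g))
  rw [hitR_repr g (ℛ k x), hitL_repr f (ℛ k x), map_sum, map_sum]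
  refine Eq.trans ?_ ((h1.symm.trans (h'.trans h2)).trans ?_)
  · refine Finset.sum_congr rfl fun i _ => ?_
    rw [map_smul, Algebra.smul_def, Algebra.commutes]; rfl
  · refine Finset.sum_congr rfl fun i _ => ?_
    rw [map_smul, Algebra.smul_def]; rfl

theorem hitL_hitL (f g : A →ₗ[k] k) (x : A) :
    hitL g (hitL f x) = (toConv (Algebra.linearMap k A ∘ₗ f) *
      toConv (Algebra.linearMap k A ∘ₗ g) * toConv LinearMap.id).ofConv x := by
  rw [mul_assoc]
  refine Eq.trans ?_ ((ℛ k x).convMul_apply _ _).symm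
  rw [hitL_repr f (ℛ k x), map_sum]
  refine Finset.sum_congr rfl fun i _ => ?_
  rw [map_smul, Algebra.smul_def]; rfl

theorem hitR_hitR (f g : A →ₗ[k] k) (x : A) : hitR g (hitR f x) = hitR (g ∘ₗ hitR f) x := by
  have h := mul_assoc (toConv LinearMap.id) (toConv (Algebra.linearMap k A ∘ₗ g))
    (toConv (Algebra.linearMap k A ∘ₗ f))
  have h' := congrArg (fun φ => φ.ofConv x) h
  have h1 := (ℛ k x).convMul_apply (toConv LinearMap.id * toConv (Algebra.linearMap k A ∘ₗ g))
    (toConv (Algebra.linearMap k A ∘ₗ f))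
  have hg : toConv (Algebra.linearMap k A ∘ₗ g) * toConv (Algebra.linearMap k A ∘ₗ f) =
      toConv (Algebra.linearMap k A ∘ₗ g ∘ₗ hitR f) := by
    refine WithConv.ext (LinearMap.ext fun y => ?_)
    refine ((ℛ k y).convMul_apply _ _).trans ?_
    rw [LinearMap.comp_apply, LinearMap.comp_apply, hitR_repr f (ℛ k y)]
    simp only [map_sum, map_smul, smul_eq_mul, map_mul, Algebra.linearMap_apply]
    exact Finset.sum_congr rfl fun i _ => Algebra.commutes _ _
  rw [hg] at h'
  refine Eq.trans ?_ (h1.symm.trans h')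
  rw [hitR_repr f (ℛ k x), map_sum]
  refine Finset.sum_congr rfl fun i _ => ?_
  rw [map_smul, Algebra.smul_def, Algebra.commutes]; rfl

theorem sum_hitL_antipode {κ : Type*} [Fintype κ] (e : Module.Basis κ k A) (f : A →ₗ[k] k)
    (x : A) :
    ∑ m, hitL (f ∘ₗ LinearMap.mulLeft k (e m) ∘ₗ HopfAlgebra.antipode k) (hitL (e.coord m) x) =
      f 1 • x := by
  simp only [hitL_hitL]
  have h : ∑ m, toConv (Algebra.linearMap k A ∘ₗ e.coord m) *
      toConv (Algebra.linearMap k A ∘ₗ f ∘ₗ LinearMap.mulLeft k (e m) ∘ₗ HopfAlgebra.antipode k) =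
      f 1 • (1 : WithConv (A →ₗ[k] A)) := by
    refine WithConv.ext (LinearMap.ext fun y => ?_)
    rw [WithConv.ofConv_sum, LinearMap.sum_apply]
    have h1 (m : κ) := (ℛ k y).convMul_apply (toConv (Algebra.linearMap k A ∘ₗ e.coord m))
      (toConv (Algebra.linearMap k A ∘ₗ f ∘ₗ LinearMap.mulLeft k (e m) ∘ₗ HopfAlgebra.antipode k))
    rw [Finset.sum_congr rfl fun m _ => h1 m, Finset.sum_comm]
    have h2 (i) : ∑ m, algebraMap k A (e.coord m ((ℛ k y).left i)) *
        algebraMap k A (f (e m * HopfAlgebra.antipode k ((ℛ k y).right i))) =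
        algebraMap k A (f ((ℛ k y).left i * HopfAlgebra.antipode k ((ℛ k y).right i))) := by
      conv_rhs => rw [← e.sum_repr ((ℛ k y).left i), Finset.sum_mul, map_sum, map_sum]
      simp
    refine (Finset.sum_congr rfl fun i _ => h2 i).trans ?_
    rw [← map_sum, ← map_sum, HopfAlgebra.sum_mul_antipode_eq_smul]
    rw [map_smul, smul_eq_mul, mul_comm, map_mul, ← Algebra.smul_def]
    rfl
  rw [← LinearMap.sum_apply, ← WithConv.ofConv_sum, ← Finset.sum_mul, h, smul_mul_assoc, one_mul]
  simp

/-- The comultiplication of `S x` in terms of that of `x`. -/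
def Coalgebra.Repr.antipode {κ : Type*} {x : A} (r : Coalgebra.Repr k x κ) :
    Coalgebra.Repr k (HopfAlgebra.antipode k x) κ where
  index := r.index
  left i := HopfAlgebra.antipode k (r.right i)
  right i := HopfAlgebra.antipode k (r.left i)
  eq := (comul_antipode_repr r).symm

/-- `∑ Δ(S²x₍₂₎) (S x₍₁₎ ⊗ 1) = 1 ⊗ S²x`. -/
theorem sum_comul_antipode_antipode_mul (x : A) :
    ∑ i ∈ (ℛ k x).index, comul (R := k) (HopfAlgebra.antipode k
        (HopfAlgebra.antipode k ((ℛ k x).right i))) *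
      (HopfAlgebra.antipode k ((ℛ k x).left i) ⊗ₜ[k] (1 : A)) =
      1 ⊗ₜ[k] HopfAlgebra.antipode k (HopfAlgebra.antipode k x) := by
  -- the computation takes place in the convolution algebra of maps to the opposite of `A ⊗ A`
  let u : A →ₐ[k] (A ⊗[k] A)ᵐᵒᵖ := (AlgHom.op Algebra.TensorProduct.includeLeft).comp
    (HopfAlgebra.antipodeAlgHomOp k A)
  let w : A →ₗ[k] (A ⊗[k] A)ᵐᵒᵖ := (opLinearEquiv k).toLinearMap ∘ₗ
    (Algebra.TensorProduct.includeRight : A →ₐ[k] A ⊗[k] A).toLinearMap ∘ₗ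
    HopfAlgebra.antipode k ∘ₗ HopfAlgebra.antipode k
  have hy (y : A) : op (comul (R := k) (HopfAlgebra.antipode k (HopfAlgebra.antipode k y))) =
      (toConv (u.toLinearMap ∘ₗ HopfAlgebra.antipode k) * toConv w) y := by
    refine Eq.trans ?_ ((ℛ k y).convMul_apply _ _).symm
    rw [← (ℛ k y).antipode.antipode.eq, Finset.op_sum]
    refine Finset.sum_congr rfl fun i _ => unop_injective ?_
    simp [u, w, Coalgebra.Repr.antipode]
  apply op_injective
  have h := (ℛ k x).convMul_apply (toConv u.toLinearMap)
    (toConv (u.toLinearMap ∘ₗ HopfAlgebra.antipode k) * toConv w)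
  rw [← mul_assoc, u.conv_mul_antipode, one_mul] at h
  refine Eq.trans ?_ h.symm
  rw [Finset.op_sum]
  refine Finset.sum_congr rfl fun i _ => ?_
  rw [← hy, op_mul]
  rfl

theorem hitL_mul_antipode_antipode {κ : Type*} [Fintype κ] (e : Module.Basis κ k A)
    (f : A →ₗ[k] k) (b x : A) :
    hitL f b * HopfAlgebra.antipode k (HopfAlgebra.antipode k x) =
      ∑ m, hitL (e.coord m) (b * HopfAlgebra.antipode k (HopfAlgebra.antipode k
        (hitL (f ∘ₗ LinearMap.mulLeft k (e m) ∘ₗ HopfAlgebra.antipode k) x))) := by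
  let Ψ : A ⊗[k] A →ₗ[k] A := (TensorProduct.lid k A).toLinearMap ∘ₗ f.rTensor A
  have hΨ (p q : A) : Ψ (p ⊗ₜ q) = f p • q := by simp [Ψ]
  have h := congrArg (fun z => Ψ (comul (R := k) b * z))
    (sum_comul_antipode_antipode_mul (k := k) x)
  simp only [Finset.mul_sum, map_sum, ← mul_assoc, ← Bialgebra.comul_mul] at h
  have hL : hitL f b * HopfAlgebra.antipode k (HopfAlgebra.antipode k x) =
      Ψ (comul (R := k) b * 1 ⊗ₜ[k] HopfAlgebra.antipode k (HopfAlgebra.antipode k x)) := by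
    rw [← (ℛ k b).eq, hitL_repr f (ℛ k b), Finset.sum_mul, Finset.sum_mul, map_sum]
    simp [hΨ]
  rw [hL, ← h]
  simp only [hitL_repr _ (ℛ k x), map_sum, map_smul, Finset.mul_sum, mul_smul_comm]
  rw [Finset.sum_comm]
  refine Finset.sum_congr rfl fun i _ => ?_
  generalize b * HopfAlgebra.antipode k (HopfAlgebra.antipode k ((ℛ k x).right i)) = y
  rw [← (ℛ k y).eq, Finset.sum_mul, map_sum]
  simp only [hitL_repr _ (ℛ k y), Finset.smul_sum]
  rw [Finset.sum_comm]
  refine Finset.sum_congr rfl fun j _ => ?_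
  rw [Algebra.TensorProduct.tmul_mul_tmul, hΨ, mul_one]
  conv_lhs => rw [← e.sum_repr ((ℛ k y).left j), Finset.sum_mul, map_sum, Finset.sum_smul]
  refine Finset.sum_congr rfl fun m _ => ?_
  simp [smul_smul, mul_comm]

/-- The functional `b ↦ tr (R_f ∘ L_b ∘ S²)`, which is an integral for every `f`. -/
def traceIntegral (f : A →ₗ[k] k) : A →ₗ[k] k :=
  LinearMap.trace k A ∘ₗ LinearMap.mulLeft k (hitR f) ∘ₗ
    LinearMap.mulRight k (HopfAlgebra.antipode k ∘ₗ HopfAlgebra.antipode k : Module.End k A) ∘ₗ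
    LinearMap.mul k A

theorem traceIntegral_apply (f : A →ₗ[k] k) (b : A) :
    traceIntegral f b = LinearMap.trace k A (hitR f ∘ₗ LinearMap.mulLeft k b ∘ₗ
      HopfAlgebra.antipode k ∘ₗ HopfAlgebra.antipode k) := rfl

variable [FiniteDimensional k A]

theorem traceIntegral_hitL (f φ : A →ₗ[k] k) (b : A) :
    traceIntegral f (hitL φ b) = φ 1 * traceIntegral f b := by
  let e := Module.finBasis k A
  set SS := HopfAlgebra.antipode k (A := A) ∘ₗ HopfAlgebra.antipode k with hSS
  let ψ m := φ ∘ₗ LinearMap.mulLeft k (e m) ∘ₗ HopfAlgebra.antipode k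
  have h : LinearMap.mulLeft k (hitL φ b) ∘ₗ SS =
      ∑ m, hitL (e.coord m) ∘ₗ LinearMap.mulLeft k b ∘ₗ SS ∘ₗ hitL (ψ m) := by
    ext x
    rw [LinearMap.sum_apply]
    exact hitL_mul_antipode_antipode e φ b x
  have h2 : ∑ m, hitL (ψ m) ∘ₗ hitR f ∘ₗ hitL (e.coord m) = φ 1 • hitR f := by
    ext x
    rw [LinearMap.sum_apply]
    refine (Finset.sum_congr rfl fun m _ => ?_).trans (sum_hitL_antipode e φ (hitR f x))
    exact congrArg (hitL (ψ m)) (hitL_hitR _ _ _).symm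
  have hsum (g : Fin (Module.finrank k A) → A →ₗ[k] A) :
      hitR f ∘ₗ ∑ m, g m = ∑ m, hitR f ∘ₗ g m := by
    ext x; simp
  have hsum' (g : Fin (Module.finrank k A) → A →ₗ[k] A) (h : A →ₗ[k] A) :
      (∑ m, g m) ∘ₗ h = ∑ m, g m ∘ₗ h := by
    ext x; simp
  rw [traceIntegral_apply, traceIntegral_apply, ← hSS, h, hsum, map_sum]
  have h3 (m) : LinearMap.trace k A (hitR f ∘ₗ hitL (e.coord m) ∘ₗ LinearMap.mulLeft k b ∘ₗ
      SS ∘ₗ hitL (ψ m)) = LinearMap.trace k A ((hitL (ψ m) ∘ₗ hitR f ∘ₗ hitL (e.coord m)) ∘ₗ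
        LinearMap.mulLeft k b ∘ₗ SS) := by
    have := LinearMap.trace_comp_comm' (R := k) (hitL (ψ m))
      (hitR f ∘ₗ hitL (e.coord m) ∘ₗ LinearMap.mulLeft k b ∘ₗ SS)
    simpa only [LinearMap.comp_assoc] using this
  rw [Finset.sum_congr rfl fun m _ => h3 m, ← map_sum, ← hsum', h2,
    LinearMap.smul_comp, map_smul, smul_eq_mul]

theorem hitR_traceIntegral (f : A →ₗ[k] k) (b : A) :
    hitR (traceIntegral f) b = traceIntegral f b • (1 : A) := by
  refine (Module.forall_dual_apply_eq_zero_iff k _).1 (fun φ => ?_) |> sub_eq_zero.1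
  rw [map_sub, sub_eq_zero, map_smul, smul_eq_mul, mul_comm, ← traceIntegral_hitL,
    hitR_repr _ (ℛ k b), hitL_repr _ (ℛ k b), map_sum, map_sum]
  simp [mul_comm]

theorem exists_traceIntegral_ne_zero : ∃ f : A →ₗ[k] k, traceIntegral f ≠ 0 := by
  by_contra! hzero
  let e := Module.finBasis k A
  let q : A ⊗[k] A →ₗ[k] A := LinearMap.mul' k A ∘ₗ (HopfAlgebra.antipode k).rTensor A
  let f : A →ₗ[k] k := counit
  let G : A ⊗[k] A →ₗ[k] A := hitR f ∘ₗ HopfAlgebra.antipode k ∘ₗ q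
  have hG : LinearMap.trace k A (G ∘ₗ comul) = 1 := by
    have h1 : G ∘ₗ comul = LinearMap.toSpanSingleton k A 1 ∘ₗ counit := by
      ext x
      have hq : q (comul x) = counit (R := k) x • (1 : A) := by
        rw [← HopfAlgebra.sum_antipode_mul_eq_smul (ℛ k x), ← (ℛ k x).eq]
        simp [q]
      have h1 : hitR f (1 : A) = 1 := by
        simp [hitR, f, LinearMap.convMul_def, Algebra.TensorProduct.one_def]
      simp [G, hq, h1]
    rw [h1, LinearMap.trace_comp_comm']
    have : counit ∘ₗ LinearMap.toSpanSingleton k A 1 = (LinearMap.id : k →ₗ[k] k) := by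
      ext; simp
    rw [this]; simp
  have hG' : LinearMap.trace k _ (comul ∘ₗ G) = ∑ m, traceIntegral (e.coord m ∘ₗ hitR f)
      (HopfAlgebra.antipode k (e m)) := by
    rw [LinearMap.trace_eq_matrix_trace k (e.tensorProduct e), Matrix.trace,
      Fintype.sum_prod_type, Finset.sum_comm]
    refine Finset.sum_congr rfl fun m _ => ?_
    rw [traceIntegral_apply, LinearMap.trace_eq_matrix_trace k e, Matrix.trace]
    refine Finset.sum_congr rfl fun n _ => ?_
    have h1 : G (e n ⊗ₜ e m) = hitR f (HopfAlgebra.antipode k (e m) * HopfAlgebra.antipode k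
        (HopfAlgebra.antipode k (e n))) := by
      simp [G, q, HopfAlgebra.antipode_mul_antidistrib]
    simp only [Matrix.diag_apply, LinearMap.toMatrix_apply, LinearMap.comp_apply,
      Module.Basis.tensorProduct_apply, h1, LinearMap.mulLeft_apply]
    rw [comul_eq_sum_hitR e, ← hitR_hitR]
    simp [Module.Basis.tensorProduct_repr_tmul_apply, Finsupp.single_apply]
  rw [LinearMap.trace_comp_comm', hG] at hG'
  simp [hzero] at hG'

/-- For an integral `λ` the map `a ↦ λ(· S(a))` is injective. -/
theorem eq_zero_of_integral_mul_antipode {l : A →ₗ[k] k} (hl : ∀ b, hitR l b = l b • (1 : A))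
    (hl0 : l ≠ 0) {a : A} (ha : ∀ b, l (b * HopfAlgebra.antipode k a) = 0) : a = 0 := by
  let e := Module.finBasis k A
  -- `∑ λ(b S(a₍₁₎)) a₍₂₎ = ∑ b₍₁₎ λ(b₍₂₎ S(a))`
  have h1 (x b : A) : ∑ i ∈ (ℛ k x).index, l (b * HopfAlgebra.antipode k ((ℛ k x).left i)) •
      (ℛ k x).right i = hitR (l ∘ₗ LinearMap.mulRight k (HopfAlgebra.antipode k x)) b := by
    let g (j : A × A) : A →ₗ[k] k := l ∘ₗ LinearMap.mulLeft k ((ℛ k b).right j) ∘ₗ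
      HopfAlgebra.antipode k
    let G (j : A × A) : WithConv (A →ₗ[k] A) := toConv (Algebra.linearMap k A ∘ₗ g j)
    have hy (y : A) : l (b * HopfAlgebra.antipode k y) • (1 : A) =
        ∑ j ∈ (ℛ k b).index, (ℛ k b).left j *
          (G j * toConv (HopfAlgebra.antipode k) : WithConv (A →ₗ[k] A)) y := by
      rw [← hl, hitR_repr l ((ℛ k b).mul (ℛ k y).antipode)]
      refine (Finset.sum_product (ℛ k b).index (ℛ k y).index _).trans ?_
      refine Finset.sum_congr rfl fun j _ => ?_
      rw [(ℛ k y).convMul_apply, Finset.mul_sum]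
      refine Finset.sum_congr rfl fun i _ => ?_
      rw [← mul_assoc]
      refine Eq.trans ?_ (congrArg (· * _) (Algebra.commutes _ _))
      rw [mul_assoc, ← Algebra.smul_def]
      rfl
    have h := fun i => congrArg (· * (ℛ k x).right i) (hy ((ℛ k x).left i))
    simp only [smul_mul_assoc, one_mul, Finset.sum_mul] at h
    rw [Finset.sum_congr rfl fun i _ => h i, Finset.sum_comm, hitR_repr _ (ℛ k b)]
    refine Finset.sum_congr rfl fun j _ => ?_
    simp only [mul_assoc]
    rw [← Finset.mul_sum]
    have h' := (ℛ k x).convMul_apply (G j * toConv (HopfAlgebra.antipode k)) (toConv LinearMap.id)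
    rw [mul_assoc, LinearMap.antipode_mul_id, mul_one] at h'
    refine (congrArg _ h'.symm).trans ?_
    refine (Algebra.commutes _ _).symm.trans (Algebra.smul_def _ _).symm
  -- the annihilated elements are stable under right hits and are killed by the counit
  have h2 (x : A) (hx : ∀ b, l (b * HopfAlgebra.antipode k x) = 0) (φ : A →ₗ[k] k) (b : A) :
      l (b * HopfAlgebra.antipode k (hitR φ x)) = 0 := by
    have := congrArg φ (h1 x b)
    have h0 : l ∘ₗ LinearMap.mulRight k (HopfAlgebra.antipode k x) = 0 := by
      ext b; exact hx b
    rw [h0, hitR_repr _ (ℛ k b)] at this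
    rw [hitR_repr _ (ℛ k x)]
    simpa [Finset.mul_sum, mul_comm] using this
  have h3 (x : A) (hx : ∀ b, l (b * HopfAlgebra.antipode k x) = 0) : counit (R := k) x = 0 := by
    obtain ⟨c, hc⟩ : ∃ c, l c ≠ 0 := by
      by_contra! h
      exact hl0 (LinearMap.ext h)
    have h4 : ∑ i ∈ (ℛ k x).index,
        HopfAlgebra.antipode k (HopfAlgebra.antipode k ((ℛ k x).right i)) *
        HopfAlgebra.antipode k ((ℛ k x).left i) = counit (R := k) x • 1 := by
      have := congrArg (HopfAlgebra.antipode k) (HopfAlgebra.sum_mul_antipode_eq_smul (ℛ k x))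
      simpa [HopfAlgebra.antipode_mul_antidistrib] using this
    let T : A ⊗[k] A →ₗ[k] k := l ∘ₗ LinearMap.mulLeft k c ∘ₗ LinearMap.mul' k A ∘ₗ
      TensorProduct.map (HopfAlgebra.antipode k ∘ₗ HopfAlgebra.antipode k)
        (HopfAlgebra.antipode k) ∘ₗ (TensorProduct.comm k A A).toLinearMap
    have hT (p q : A) : T (p ⊗ₜ q) = l (c * (HopfAlgebra.antipode k (HopfAlgebra.antipode k q) *
        HopfAlgebra.antipode k p)) := by simp [T]
    have h5 : T (comul x) = counit (R := k) x * l c := by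
      rw [← (ℛ k x).eq, map_sum]
      simp only [hT]
      rw [← map_sum, ← Finset.mul_sum, h4]
      simp
    have h6 : T (comul x) = 0 := by
      rw [comul_eq_sum_hitR e, map_sum]
      refine Finset.sum_eq_zero fun m _ => ?_
      rw [hT, ← mul_assoc]
      exact h2 x hx _ _
    rw [h6] at h5
    exact (mul_eq_zero.1 h5.symm).resolve_right hc
  refine (Module.forall_dual_apply_eq_zero_iff k a).1 fun φ => ?_
  rw [← counit_hitR]
  exact h3 _ (h2 a ha φ)

variable (k A) in
/-- A finite-dimensional Hopf algebra is a Frobenius algebra. -/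
theorem exists_frobenius : ∃ l : A →ₗ[k] k,
    Function.Bijective (HopfAlgebra.antipode k (A := A)) ∧
    Function.Bijective (fun b => l ∘ₗ LinearMap.mulLeft k b) := by
  obtain ⟨f, hf⟩ := exists_traceIntegral_ne_zero (k := k) (A := A)
  have key {a : A} := eq_zero_of_integral_mul_antipode (hitR_traceIntegral f) hf (a := a)
  set l := traceIntegral f
  have hS : Function.Bijective (HopfAlgebra.antipode k (A := A)) := by
    have : Function.Injective (HopfAlgebra.antipode k (A := A)) :=
      (injective_iff_map_eq_zero _).2 fun a ha => key fun b => by rw [ha, mul_zero, map_zero]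
    exact ⟨this, LinearMap.injective_iff_surjective.1 this⟩
  refine ⟨l, hS, ?_⟩
  let B : A →ₗ[k] (A →ₗ[k] k) := (LinearMap.mul k A).compr₂ l
  have hdim : Module.finrank k A = Module.finrank k (A →ₗ[k] k) :=
    (Subspace.dual_finrank_eq (K := k) (V := A)).symm
  have hflip : Function.Injective B.flip := (injective_iff_map_eq_zero _).2 fun y hy => by
    obtain ⟨a, rfl⟩ := hS.2 y
    rw [key (a := a) fun b => congrArg (fun g => g b) hy, map_zero]
  have hflip' : Function.Surjective B.flip :=
    (LinearMap.injective_iff_surjective_of_finrank_eq_finrank hdim).1 hflip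
  have hB : Function.Injective B := (injective_iff_map_eq_zero _).2 fun b hb => by
    refine (Module.forall_dual_apply_eq_zero_iff k b).1 fun φ => ?_
    obtain ⟨y, rfl⟩ := hflip' φ
    exact congrArg (fun g => g y) hb
  exact ⟨hB, (LinearMap.injective_iff_surjective_of_finrank_eq_finrank hdim).1 hB⟩

end Hits


/-! ### Operations on twisted matrices -/

section TwistOperations

variable {k A R ι : Type*} [Field k] [AddCommGroup A] [Module k A] [Coalgebra k A]
  [Ring R] [Algebra k R] [Fintype ι] [DecidableEq ι]

theorem toConv_twist_mul (ρ ρ' : A →ₗ[k] R) (t : A →ₗ[k] Matrix ι ι k) :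
    toConv (twist (toConv ρ * toConv ρ').ofConv t) =
      toConv ((scalarMat k R ι).toLinearMap ∘ₗ ρ) * toConv (twist ρ' t) := by
  have := LinearMap.algHom_comp_convMul_distrib (scalarMat k R ι) (toConv ρ) (toConv ρ')
  rw [twist, twist, this]
  exact mul_assoc _ _ _

theorem Fwd.mul {t : A →ₗ[k] Matrix ι ι k} {ρ ρ' : A →ₗ[k] R} {X Y : Matrix ι ι R}
    (hX : Fwd t ρ X) (hY : Fwd t ρ' Y) (hc : ∀ a i j, Commute (ρ a) (Y i j)) :
    Fwd t (toConv ρ * toConv ρ').ofConv (X * Y) := fun a => by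
  have h := (congrArg (fun f => f.ofConv a) (toConv_twist_mul ρ ρ' t)).trans
    ((ℛ k a).convMul_apply _ _)
  have hc' (b : A) : scalarMat k R ι (ρ b) * Y = Y * scalarMat k R ι (ρ b) := by
    ext i j
    simpa [scalarMat] using (hc b i j).eq
  rw [h, ← mul_assoc, hX a, mul_assoc, mul_assoc, twist_repr ρ t (ℛ k a), Finset.sum_mul,
    Finset.mul_sum]
  simp only [mul_assoc, hY _, Finset.mul_sum, LinearMap.comp_apply, AlgHom.toLinearMap_apply]
  refine Finset.sum_congr rfl fun i _ => ?_
  rw [← mul_assoc (scalarMat k R ι _), hc', mul_assoc]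

theorem fwd_counit (t : A →ₗ[k] Matrix ι ι k) : Fwd t (counit (R := k)) (1 : Matrix ι ι k) :=
  fun a => by
    rw [mul_one, one_mul, twist_repr _ t (ℛ k a)]
    conv_lhs => rw [← Coalgebra.sum_counit_smul (ℛ k a), map_sum, map_sum]
    refine Finset.sum_congr rfl fun i _ => ?_
    rw [map_smul, map_smul]
    ext p q
    simp

end TwistOperations

/-! ### The Hopf algebra generated by a chain of matrices -/

section Chain

variable {k A R ι J : Type*} [Field k] [Ring A] [HopfAlgebra k A] [Ring R] [Algebra k R]
  [Fintype ι] [DecidableEq ι]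

/-- A family of invertible matrices over an `A`-ring `R`, indexed by a set with a successor
function `s`, such that `Z (s j)` is the transposed inverse of `Z j`, and such that the matrix
with the base index `o` intertwines the representation `t` with its diagonal twist. -/
structure IsMatrixChain (s : J → J) (o : J) (t : A →ₐ[k] Matrix ι ι k) (φ : A →ₐ[k] R)
    (Z : J → Matrix ι ι R) : Prop where
  mul_transpose (j : J) : Z j * (Z (s j)).transpose = 1
  transpose_mul (j : J) : (Z (s j)).transpose * Z j = 1
  fwd : Fwd t.toLinearMap φ.toLinearMap (Z o)

theorem IsMatrixChain.map {s : J → J} {o : J} {t : A →ₐ[k] Matrix ι ι k} {φ : A →ₐ[k] R}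
    {Z : J → Matrix ι ι R} (h : IsMatrixChain s o t φ Z) {R' : Type*} [Ring R'] [Algebra k R']
    (g : R →ₐ[k] R') : IsMatrixChain s o t (g.comp φ) (fun j => (Z j).map g) where
  mul_transpose j := by
    have := congrArg g.mapMatrix (h.mul_transpose j)
    rw [map_mul, map_one] at this
    exact this
  transpose_mul j := by
    have := congrArg g.mapMatrix (h.transpose_mul j)
    rw [map_mul, map_one] at this
    exact this
  fwd := h.fwd.map g

theorem transpose_mul_of_commute {X Y : Matrix ι ι R} (h : ∀ i j p q, Commute (X i j) (Y p q)) :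
    (X * Y).transpose = Y.transpose * X.transpose := by
  ext i j
  simp only [Matrix.transpose_apply, Matrix.mul_apply]
  exact Finset.sum_congr rfl fun l _ => h _ _ _ _

theorem IsMatrixChain.mul {s : J → J} {o : J} {t : A →ₐ[k] Matrix ι ι k} {φ φ' ψ : A →ₐ[k] R}
    {X Y : J → Matrix ι ι R} (hX : IsMatrixChain s o t φ X) (hY : IsMatrixChain s o t φ' Y)
    (hXY : ∀ j j' i l p q, Commute (X j i l) (Y j' p q)) (hφ : ∀ a j p q, Commute (φ a) (Y j p q))
    (hψ : toConv ψ.toLinearMap = toConv φ.toLinearMap * toConv φ'.toLinearMap) :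
    IsMatrixChain s o t ψ (fun j => X j * Y j) where
  mul_transpose j := by
    rw [transpose_mul_of_commute (hXY _ _), mul_assoc, ← mul_assoc (Y j), hY.mul_transpose, one_mul,
      hX.mul_transpose]
  transpose_mul j := by
    rw [transpose_mul_of_commute (hXY _ _), mul_assoc, ← mul_assoc _ (X j), hX.transpose_mul,
      one_mul, hY.transpose_mul]
  fwd := by
    have := hX.fwd.mul hY.fwd (fun a => hφ a o)
    rw [← hψ] at this
    exact this

theorem isChain_counit (s : J → J) (o : J) (t : A →ₐ[k] Matrix ι ι k) :
    IsMatrixChain s o t (Bialgebra.counitAlgHom k A) (fun _ => 1) where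
  mul_transpose j := by simp
  transpose_mul j := by simp
  fwd := fwd_counit _

/-- Over the opposite algebra the successors of the members of a chain again form a chain. -/
theorem IsMatrixChain.op {s : J → J} {o : J} {t : A →ₐ[k] Matrix ι ι k} {φ : A →ₐ[k] R}
    {Z : J → Matrix ι ι R} (h : IsMatrixChain s o t φ Z) :
    IsMatrixChain s o t ((AlgHom.op φ).comp (HopfAlgebra.antipodeAlgHomOp k A))
      (fun j => ((Z (s j)).map MulOpposite.op).transpose) where
  mul_transpose j := by
    ext a b
    have := congrArg MulOpposite.op (congrFun (congrFun (h.transpose_mul (s j)) b) a)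
    rw [Matrix.mul_apply, Finset.op_sum] at this
    rw [Matrix.mul_apply]
    refine Eq.trans (Finset.sum_congr rfl fun l _ => ?_) (this.trans ?_)
    · simp
    · simp [Matrix.one_apply, eq_comm, apply_ite MulOpposite.op]
  transpose_mul j := by
    ext a b
    have := congrArg MulOpposite.op (congrFun (congrFun (h.mul_transpose (s j)) b) a)
    rw [Matrix.mul_apply, Finset.op_sum] at this
    rw [Matrix.mul_apply]
    refine Eq.trans (Finset.sum_congr rfl fun l _ => ?_) (this.trans ?_)
    · simp
    · simp [Matrix.one_apply, eq_comm, apply_ite MulOpposite.op]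
  fwd := by
    have h1 := h.fwd.bwd (h.mul_transpose o) (h.transpose_mul o)
    rw [bwd_transpose_antipode, Matrix.transpose_transpose, bwd_iff_fwd_op] at h1
    exact h1

end Chain

section ChainHopf

variable {k A : Type u} {ι J : Type} [Field k] [Ring A] [HopfAlgebra k A]
  [Fintype ι] [DecidableEq ι] (s : J → J) (o : J) (t : A →ₐ[k] Matrix ι ι k)

/-- The relations of the universal `A`-ring with a chain of matrices. -/
inductive ChainRel : FreeAlgebra k (A ⊕ (J × ι × ι)) → FreeAlgebra k (A ⊕ (J × ι × ι)) → Prop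
  | add (a b : A) : ChainRel (FreeAlgebra.ι k (Sum.inl (a + b)))
      (FreeAlgebra.ι k (Sum.inl a) + FreeAlgebra.ι k (Sum.inl b))
  | mul (a b : A) : ChainRel (FreeAlgebra.ι k (Sum.inl (a * b)))
      (FreeAlgebra.ι k (Sum.inl a) * FreeAlgebra.ι k (Sum.inl b))
  | algebraMap (c : k) : ChainRel (FreeAlgebra.ι k (Sum.inl (algebraMap k A c)))
      (algebraMap k _ c)
  | mul_transpose (j : J) (p q : ι) : ChainRel
      (∑ l, FreeAlgebra.ι k (Sum.inr (j, p, l)) * FreeAlgebra.ι k (Sum.inr (s j, q, l)))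
      (if p = q then 1 else 0)
  | transpose_mul (j : J) (p q : ι) : ChainRel
      (∑ l, FreeAlgebra.ι k (Sum.inr (s j, l, p)) * FreeAlgebra.ι k (Sum.inr (j, l, q)))
      (if p = q then 1 else 0)
  | fwd (a : A) (p q : ι) : ChainRel
      (∑ l, t a p l • FreeAlgebra.ι k (Sum.inr (o, l, q)))
      (∑ l, FreeAlgebra.ι k (Sum.inr (o, p, l)) *
        FreeAlgebra.ι k (Sum.inl (twist LinearMap.id t.toLinearMap a l q)))

/-- The universal `A`-ring with a chain of matrices; it is a Hopf algebra in which these matrices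
are coalgebra matrices and the antipode sends each of them to the transpose of its successor. -/
def ChainHopf : Type u := RingQuot (ChainRel s o t)

namespace ChainHopf

instance : Ring (ChainHopf s o t) := inferInstanceAs (Ring (RingQuot _))

instance : Algebra k (ChainHopf s o t) := inferInstanceAs (Algebra k (RingQuot _))

/-- The quotient map from the free algebra. -/
def mk : FreeAlgebra k (A ⊕ (J × ι × ι)) →ₐ[k] ChainHopf s o t := RingQuot.mkAlgHom k _

theorem mk_eq {x y : FreeAlgebra k (A ⊕ (J × ι × ι))} (h : ChainRel s o t x y) :
    mk s o t x = mk s o t y := RingQuot.mkAlgHom_rel k h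

/-- The canonical map from `A`. -/
def ofAlg : A →ₐ[k] ChainHopf s o t where
  toFun a := mk s o t (FreeAlgebra.ι k (Sum.inl a))
  map_one' := by
    have := mk_eq s o t (.algebraMap 1)
    rwa [map_one, map_one, map_one] at this
  map_mul' a b := (mk_eq s o t (.mul a b)).trans (map_mul _ _ _)
  map_zero' := by
    have := mk_eq s o t (.algebraMap 0)
    rwa [map_zero, map_zero, map_zero] at this
  map_add' a b := (mk_eq s o t (.add a b)).trans (map_add _ _ _)
  commutes' c := (mk_eq s o t (.algebraMap c)).trans (AlgHom.commutes _ _)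

/-- The universal chain of matrices. -/
def mat (j : J) : Matrix ι ι (ChainHopf s o t) :=
  Matrix.of fun p q => mk s o t (FreeAlgebra.ι k (Sum.inr (j, p, q)))

theorem isChain : IsMatrixChain s o t (ofAlg s o t) (mat s o t) where
  mul_transpose j := by
    ext p q
    have := mk_eq s o t (.mul_transpose j p q)
    rw [map_sum] at this
    simpa [Matrix.mul_apply, mat, Matrix.one_apply, apply_ite (mk s o t)] using this
  transpose_mul j := by
    ext p q
    have := mk_eq s o t (.transpose_mul j p q)
    rw [map_sum] at this
    simpa [Matrix.mul_apply, mat, Matrix.one_apply, apply_ite (mk s o t)] using this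
  fwd a := by
    ext p q
    have := mk_eq s o t (.fwd a p q)
    rw [map_sum, map_sum] at this
    rw [constMat_mul_apply, Matrix.mul_apply]
    simp only [map_smul, map_mul] at this
    refine this.trans (Finset.sum_congr rfl fun l _ => ?_)
    rw [twist_algHom]
    rfl

variable {s o t}

theorem mk_surjective : Function.Surjective (mk s o t) := RingQuot.mkAlgHom_surjective k _

/-- Induction on elements of the universal algebra. -/
theorem induction {P : ChainHopf s o t → Prop} (hc : ∀ c, P (algebraMap k _ c))
    (hA : ∀ a, P (ofAlg s o t a)) (hZ : ∀ j p q, P (mat s o t j p q))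
    (hmul : ∀ x y, P x → P y → P (x * y)) (hadd : ∀ x y, P x → P y → P (x + y)) (x) : P x := by
  obtain ⟨x, rfl⟩ := mk_surjective x
  induction x using FreeAlgebra.induction with
  | grade0 c => simpa using hc c
  | grade1 g =>
    rcases g with a | ⟨j, p, q⟩
    · exact hA a
    · exact hZ j p q
  | mul x y hx hy => rw [map_mul]; exact hmul _ _ hx hy
  | add x y hx hy => rw [map_add]; exact hadd _ _ hx hy

theorem algHom_ext {R : Type*} [Ring R] [Algebra k R] {f g : ChainHopf s o t →ₐ[k] R}
    (hA : ∀ a, f (ofAlg s o t a) = g (ofAlg s o t a))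
    (hZ : ∀ j p q, f (mat s o t j p q) = g (mat s o t j p q)) : f = g := by
  refine AlgHom.ext fun x => ?_
  induction x using induction with
  | hc c => simp
  | hA a => exact hA a
  | hZ j p q => exact hZ j p q
  | hmul x y hx hy => rw [map_mul, map_mul, hx, hy]
  | hadd x y hx hy => rw [map_add, map_add, hx, hy]

/-- The universal property of the universal `A`-ring with a chain of matrices. -/
def lift {R : Type*} [Ring R] [Algebra k R] {φ : A →ₐ[k] R} {Z : J → Matrix ι ι R}
    (h : IsMatrixChain s o t φ Z) : ChainHopf s o t →ₐ[k] R :=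
  RingQuot.liftAlgHom k ⟨FreeAlgebra.lift k (Sum.elim φ fun x => Z x.1 x.2.1 x.2.2), by
    intro x y hxy
    induction hxy with
    | add a b => simp
    | mul a b => simp
    | algebraMap c => simp
    | mul_transpose j p q =>
      have := congrFun (congrFun (h.mul_transpose j) p) q
      simpa [Matrix.mul_apply, Matrix.one_apply, apply_ite (FreeAlgebra.lift k _)] using this
    | transpose_mul j p q =>
      have := congrFun (congrFun (h.transpose_mul j) p) q
      simpa [Matrix.mul_apply, Matrix.one_apply, apply_ite (FreeAlgebra.lift k _)] using this
    | fwd a p q =>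
      have := congrFun (congrFun (h.fwd a) p) q
      rw [constMat_mul_apply, Matrix.mul_apply] at this
      simpa [twist_algHom] using this⟩

section Lift

variable {R : Type*} [Ring R] [Algebra k R] {φ : A →ₐ[k] R} {Z : J → Matrix ι ι R}
  (h : IsMatrixChain s o t φ Z)

@[simp] theorem lift_ofAlg (a : A) : lift h (ofAlg s o t a) = φ a := by
  refine (RingQuot.liftAlgHom_mkAlgHom_apply k _ _ _).trans ?_
  simp

@[simp] theorem lift_mat (j : J) (p q : ι) : lift h (mat s o t j p q) = Z j p q := by
  refine (RingQuot.liftAlgHom_mkAlgHom_apply k _ _ _).trans ?_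
  simp

end Lift

variable (s o t)

theorem isChain_comul : IsMatrixChain s o t
    ((Algebra.TensorProduct.map (ofAlg s o t) (ofAlg s o t)).comp (Bialgebra.comulAlgHom k A))
    (fun j => (mat s o t j).map (Algebra.TensorProduct.includeLeft : _ →ₐ[k]
        ChainHopf s o t ⊗[k] ChainHopf s o t) *
      (mat s o t j).map (Algebra.TensorProduct.includeRight : _ →ₐ[k]
        ChainHopf s o t ⊗[k] ChainHopf s o t)) := by
  refine ((isChain s o t).map _).mul ((isChain s o t).map _) ?_ ?_ ?_
  · intro j j' i l p q
    simp [Commute, SemiconjBy]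
  · intro a j p q
    simp [Commute, SemiconjBy]
  · refine WithConv.ext (LinearMap.ext fun a => ?_)
    refine Eq.trans ?_ ((ℛ k a).convMul_apply _ _).symm
    simp [← (ℛ k a).eq]

/-- The comultiplication of the universal algebra. -/
def comulHom : ChainHopf s o t →ₐ[k] ChainHopf s o t ⊗[k] ChainHopf s o t :=
  lift (isChain_comul s o t)

/-- The counit of the universal algebra. -/
def counitHom : ChainHopf s o t →ₐ[k] k := lift (isChain_counit s o t)

/-- The antipode of the universal algebra, as a homomorphism to the opposite algebra. -/
def antipodeHom : ChainHopf s o t →ₐ[k] (ChainHopf s o t)ᵐᵒᵖ := lift (isChain s o t).op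

variable {s o t}

theorem comulHom_ofAlg (a : A) : comulHom s o t (ofAlg s o t a) =
    Algebra.TensorProduct.map (ofAlg s o t) (ofAlg s o t) (comul a) := by
  simp [comulHom]

theorem comulHom_mat (j : J) (p q : ι) : comulHom s o t (mat s o t j p q) =
    ∑ l, mat s o t j p l ⊗ₜ[k] mat s o t j l q := by
  simp [comulHom, Matrix.mul_apply]

theorem counitHom_ofAlg (a : A) : counitHom s o t (ofAlg s o t a) = counit (R := k) a := by
  simp [counitHom]

theorem counitHom_mat (j : J) (p q : ι) :
    counitHom s o t (mat s o t j p q) = if p = q then 1 else 0 := by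
  simp [counitHom, Matrix.one_apply]

theorem antipodeHom_ofAlg (a : A) : antipodeHom s o t (ofAlg s o t a) =
    op (ofAlg s o t (HopfAlgebra.antipode k a)) := by
  simp [antipodeHom]

theorem antipodeHom_mat (j : J) (p q : ι) :
    antipodeHom s o t (mat s o t j p q) = op (mat s o t (s j) q p) := by
  simp [antipodeHom]

instance : Bialgebra k (ChainHopf s o t) :=
  Bialgebra.ofAlgHom (comulHom s o t) (counitHom s o t)
    (by
      refine algHom_ext (fun a => ?_) (fun j p q => ?_)
      · simp only [AlgHom.comp_apply, comulHom_ofAlg]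
        have h1 (x : A ⊗[k] A) : Algebra.TensorProduct.map (comulHom s o t) (AlgHom.id k _)
            (Algebra.TensorProduct.map (ofAlg s o t) (ofAlg s o t) x) =
            Algebra.TensorProduct.map (Algebra.TensorProduct.map (ofAlg s o t) (ofAlg s o t))
              (ofAlg s o t) ((comul (R := k)).rTensor A x) := by
          induction x with
          | zero => simp
          | add x y hx hy => simp only [map_add, hx, hy]
          | tmul x y => simp [comulHom_ofAlg]
        have h2 (x : A ⊗[k] A) : Algebra.TensorProduct.map (AlgHom.id k _) (comulHom s o t)
            (Algebra.TensorProduct.map (ofAlg s o t) (ofAlg s o t) x) =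
            Algebra.TensorProduct.map (ofAlg s o t) (Algebra.TensorProduct.map (ofAlg s o t)
              (ofAlg s o t)) ((comul (R := k)).lTensor A x) := by
          induction x with
          | zero => simp
          | add x y hx hy => simp only [map_add, hx, hy]
          | tmul x y => simp [comulHom_ofAlg]
        have h3 (x : (A ⊗[k] A) ⊗[k] A) : Algebra.TensorProduct.assoc k k k _ _ _
            (Algebra.TensorProduct.map (Algebra.TensorProduct.map (ofAlg s o t) (ofAlg s o t))
              (ofAlg s o t) x) = Algebra.TensorProduct.map (ofAlg s o t)
              (Algebra.TensorProduct.map (ofAlg s o t) (ofAlg s o t))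
              (TensorProduct.assoc k _ _ _ x) := by
          induction x with
          | zero => simp
          | add x y hx hy => simp only [map_add, hx, hy]
          | tmul x y =>
            induction x with
            | zero => simp
            | add x y hx hy => simp only [TensorProduct.add_tmul, map_add, hx, hy]
            | tmul x y => simp
        rw [h1, h2, ← Coalgebra.coassoc_apply, ← h3]
        rfl
      · simp only [AlgHom.comp_apply, comulHom_mat, map_sum, Algebra.TensorProduct.map_tmul,
          AlgHom.id_apply, TensorProduct.sum_tmul, TensorProduct.tmul_sum]
        rw [Finset.sum_comm]
        simp)
    (by
      refine algHom_ext (fun a => ?_) (fun j p q => ?_)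
      · simp only [AlgHom.comp_apply, comulHom_ofAlg, ← (ℛ k a).eq, map_sum,
          Algebra.TensorProduct.map_tmul, counitHom_ofAlg, AlgHom.id_apply]
        have h : (1 : k) ⊗ₜ[k] ofAlg s o t a = ∑ i ∈ (ℛ k a).index,
            counit (R := k) ((ℛ k a).left i) ⊗ₜ[k] ofAlg s o t ((ℛ k a).right i) := by
          conv_lhs => rw [← Coalgebra.sum_counit_smul (ℛ k a), map_sum, TensorProduct.tmul_sum]
          refine Finset.sum_congr rfl fun i _ => ?_
          rw [map_smul, TensorProduct.tmul_smul, TensorProduct.smul_tmul', smul_eq_mul, mul_one]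
        rw [← h]
        simp
      · simp only [AlgHom.comp_apply, comulHom_mat, map_sum, Algebra.TensorProduct.map_tmul,
          AlgHom.id_apply, counitHom_mat]
        simp [TensorProduct.ite_tmul])
    (by
      refine algHom_ext (fun a => ?_) (fun j p q => ?_)
      · simp only [AlgHom.comp_apply, comulHom_ofAlg, ← (ℛ k a).eq, map_sum,
          Algebra.TensorProduct.map_tmul, counitHom_ofAlg, AlgHom.id_apply]
        have h : ofAlg s o t a ⊗ₜ[k] (1 : k) = ∑ i ∈ (ℛ k a).index,
            ofAlg s o t ((ℛ k a).left i) ⊗ₜ[k] counit (R := k) ((ℛ k a).right i) := by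
          conv_lhs => rw [← sum_counit_right_smul (ℛ k a), map_sum, TensorProduct.sum_tmul]
          refine Finset.sum_congr rfl fun i _ => ?_
          rw [map_smul, ← TensorProduct.smul_tmul', ← TensorProduct.tmul_smul, smul_eq_mul, mul_one]
        rw [← h]
        simp
      · simp only [AlgHom.comp_apply, comulHom_mat, map_sum, Algebra.TensorProduct.map_tmul,
          AlgHom.id_apply, counitHom_mat]
        simp [TensorProduct.tmul_ite])

theorem comul_ofAlg (a : A) : comul (R := k) (ofAlg s o t a) =
    Algebra.TensorProduct.map (ofAlg s o t) (ofAlg s o t) (comul a) := comulHom_ofAlg a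

theorem comul_mat (j : J) (p q : ι) : comul (R := k) (mat s o t j p q) =
    ∑ l, mat s o t j p l ⊗ₜ[k] mat s o t j l q := comulHom_mat j p q

theorem counit_ofAlg (a : A) : counit (R := k) (ofAlg s o t a) = counit (R := k) a :=
  counitHom_ofAlg a

theorem counit_mat (j : J) (p q : ι) :
    counit (R := k) (mat s o t j p q) = if p = q then 1 else 0 := counitHom_mat j p q

instance : HopfAlgebraStruct k (ChainHopf s o t) where
  antipode := (opLinearEquiv k).symm.toLinearMap ∘ₗ (antipodeHom s o t).toLinearMap

theorem antipode_eq (x : ChainHopf s o t) :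
    HopfAlgebraStruct.antipode k x = unop (antipodeHom s o t x) := rfl

theorem antipode_ofAlg (a : A) : HopfAlgebraStruct.antipode k (ofAlg s o t a) =
    ofAlg s o t (HopfAlgebra.antipode k a) := by
  rw [antipode_eq, antipodeHom_ofAlg, unop_op]

theorem antipode_mat (j : J) (p q : ι) : HopfAlgebraStruct.antipode k (mat s o t j p q) =
    mat s o t (s j) q p := by
  rw [antipode_eq, antipodeHom_mat, unop_op]

theorem sum_antipode_mul (x : ChainHopf s o t) : ∑ i ∈ (ℛ k x).index,
    HopfAlgebraStruct.antipode k ((ℛ k x).left i) * (ℛ k x).right i =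
      algebraMap k _ (counit x) := by
  let Ψ : ChainHopf s o t ⊗[k] ChainHopf s o t →ₗ[k] ChainHopf s o t :=
    LinearMap.mul' k _ ∘ₗ (HopfAlgebraStruct.antipode k).rTensor _
  have hΨ (p q : ChainHopf s o t) : Ψ (p ⊗ₜ q) = HopfAlgebraStruct.antipode k p * q := by
    simp [Ψ]
  suffices h : Ψ (comul x) = algebraMap k _ (counit x) by
    rw [← h]
    conv_rhs => rw [← (ℛ k x).eq, map_sum]
    simp only [hΨ]
  induction x using induction with
  | hc c =>
    rw [Bialgebra.comul_algebraMap, Bialgebra.counit_algebraMap,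
      Algebra.TensorProduct.algebraMap_apply, hΨ, antipode_eq, AlgHom.commutes]
    simp
  | hA a =>
    have := congrArg (ofAlg s o t) (HopfAlgebra.sum_antipode_mul_eq_smul (ℛ k a))
    rw [comul_ofAlg, counit_ofAlg, ← (ℛ k a).eq, map_sum, map_sum]
    simpa [hΨ, antipode_ofAlg, Algebra.smul_def] using this
  | hZ j p q =>
    have := congrFun (congrFun ((isChain s o t).transpose_mul j) p) q
    rw [comul_mat, counit_mat, map_sum]
    simpa [hΨ, antipode_mat, Matrix.mul_apply, Matrix.one_apply,
      apply_ite (algebraMap k (ChainHopf s o t))] using this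
  | hadd x y hx hy => rw [map_add, map_add, map_add, map_add, hx, hy]
  | hmul x y hx hy =>
    have key (z : ChainHopf s o t ⊗[k] ChainHopf s o t) :
        Ψ (z * comul y) = ∑ j ∈ (ℛ k y).index,
          HopfAlgebraStruct.antipode k ((ℛ k y).left j) * Ψ z * (ℛ k y).right j := by
      induction z with
      | zero => simp
      | add z z' hz hz' => simp only [add_mul, map_add, hz, hz', mul_add, Finset.sum_add_distrib]
      | tmul p q =>
        rw [← (ℛ k y).eq, Finset.mul_sum, map_sum]
        refine Finset.sum_congr rfl fun j _ => ?_
        rw [Algebra.TensorProduct.tmul_mul_tmul, hΨ, hΨ, antipode_eq, map_mul, unop_mul]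
        simp only [antipode_eq, mul_assoc]
    rw [Bialgebra.comul_mul, key, hx, Bialgebra.counit_mul, mul_comm, map_mul, ← hy]
    conv_rhs => rw [← (ℛ k y).eq, map_sum]
    simp only [hΨ, ← Algebra.commutes, mul_assoc, Finset.mul_sum]

theorem sum_mul_antipode (x : ChainHopf s o t) : ∑ i ∈ (ℛ k x).index,
    (ℛ k x).left i * HopfAlgebraStruct.antipode k ((ℛ k x).right i) =
      algebraMap k _ (counit x) := by
  let Ψ : ChainHopf s o t ⊗[k] ChainHopf s o t →ₗ[k] ChainHopf s o t :=
    LinearMap.mul' k _ ∘ₗ (HopfAlgebraStruct.antipode k).lTensor _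
  have hΨ (p q : ChainHopf s o t) : Ψ (p ⊗ₜ q) = p * HopfAlgebraStruct.antipode k q := by
    simp [Ψ]
  suffices h : Ψ (comul x) = algebraMap k _ (counit x) by
    rw [← h]
    conv_rhs => rw [← (ℛ k x).eq, map_sum]
    simp only [hΨ]
  induction x using induction with
  | hc c =>
    rw [Bialgebra.comul_algebraMap, Bialgebra.counit_algebraMap,
      Algebra.TensorProduct.algebraMap_apply, hΨ, antipode_eq, map_one]
    simp
  | hA a =>
    have := congrArg (ofAlg s o t) (HopfAlgebra.sum_mul_antipode_eq_smul (ℛ k a))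
    rw [comul_ofAlg, counit_ofAlg, ← (ℛ k a).eq, map_sum, map_sum]
    simpa [hΨ, antipode_ofAlg, Algebra.smul_def] using this
  | hZ j p q =>
    have := congrFun (congrFun ((isChain s o t).mul_transpose j) p) q
    rw [comul_mat, counit_mat, map_sum]
    simpa [hΨ, antipode_mat, Matrix.mul_apply, Matrix.one_apply,
      apply_ite (algebraMap k (ChainHopf s o t))] using this
  | hadd x y hx hy => rw [map_add, map_add, map_add, map_add, hx, hy]
  | hmul x y hx hy =>
    have key (z : ChainHopf s o t ⊗[k] ChainHopf s o t) :
        Ψ (comul x * z) = ∑ j ∈ (ℛ k x).index,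
          (ℛ k x).left j * Ψ z * HopfAlgebraStruct.antipode k ((ℛ k x).right j) := by
      induction z with
      | zero => simp
      | add z z' hz hz' => simp only [add_mul, map_add, hz, hz', mul_add, Finset.sum_add_distrib]
      | tmul p q =>
        rw [← (ℛ k x).eq, Finset.sum_mul, map_sum]
        refine Finset.sum_congr rfl fun j _ => ?_
        rw [Algebra.TensorProduct.tmul_mul_tmul, hΨ, hΨ, antipode_eq, map_mul, unop_mul]
        simp only [antipode_eq, mul_assoc]
    rw [Bialgebra.comul_mul, key, hy, Bialgebra.counit_mul, mul_comm, map_mul, ← hx]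
    conv_rhs => rw [← (ℛ k x).eq, map_sum]
    simp only [hΨ, Finset.mul_sum, ← Algebra.commutes, mul_assoc]

instance : HopfAlgebra k (ChainHopf s o t) where
  mul_antipode_rTensor_comul := by
    ext x
    have := sum_antipode_mul x
    simp only [LinearMap.comp_apply]
    conv_lhs => rw [← (ℛ k x).eq]
    simpa using this
  mul_antipode_lTensor_comul := by
    ext x
    have := sum_mul_antipode x
    simp only [LinearMap.comp_apply]
    conv_lhs => rw [← (ℛ k x).eq]
    simpa using this

variable (s o t)

/-- The canonical map from `A` is a homomorphism of Hopf algebras. -/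
def ofHopf : A →ₐc[k] ChainHopf s o t :=
  BialgHom.ofAlgHom (ofAlg s o t) (by ext a; exact counit_ofAlg a)
    (by ext a; exact (comul_ofAlg a).symm)

@[simp] theorem ofHopf_apply (a : A) : ofHopf s o t a = ofAlg s o t a := rfl

end ChainHopf
end ChainHopf


/-! ### Bijectivity of the antipode -/

section SquareAntipode

variable {k A : Type*} [Field k] [Ring A] [HopfAlgebra k A]

variable (k A) in
/-- The square of the antipode as an algebra homomorphism. -/
def antipodeSq : A →ₐ[k] A :=
  AlgHom.ofLinearMap (HopfAlgebra.antipode k ∘ₗ HopfAlgebra.antipode k) (by simp)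
    (fun a b => by simp [HopfAlgebra.antipode_mul_antidistrib])

@[simp] theorem antipodeSq_apply (a : A) :
    antipodeSq k A a = HopfAlgebra.antipode k (HopfAlgebra.antipode k a) := rfl

end SquareAntipode

section Bijective

variable {k A : Type u} {ι : Type} [Field k] [Ring A] [HopfAlgebra k A]
  [Fintype ι] [DecidableEq ι]

/-- The antipode of the universal Hopf algebra on a doubly infinite chain is bijective, since its
square has the shift of the chain as an inverse. -/
theorem bijective_antipode_chainHopf (t : A →ₐ[k] Matrix ι ι k)
    (hA : Function.Bijective (HopfAlgebra.antipode k (A := A))) :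
    Function.Bijective (HopfAlgebra.antipode k (A := ChainHopf (fun i : ℤ => i + 1) 0 t)) := by
  set H := ChainHopf (fun i : ℤ => i + 1) 0 t
  let e : A ≃ₐ[k] A := AlgEquiv.ofBijective (antipodeSq k A) (hA.comp hA)
  have he (a : A) : e.symm (HopfAlgebra.antipode k (HopfAlgebra.antipode k a)) = a :=
    e.symm_apply_apply a
  let ψ : A →ₐ[k] H := (ChainHopf.ofAlg _ _ t).comp e.symm
  have hc := ChainHopf.isChain (fun i : ℤ => i + 1) 0 t
  have hψ : IsMatrixChain (fun i : ℤ => i + 1) 0 t ψ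
      (fun j => ChainHopf.mat (fun i : ℤ => i + 1) 0 t (j - 2)) := by
    have h1 (j : ℤ) : j + 1 - 2 = j - 2 + 1 := by ring
    refine ⟨fun j => ?_, fun j => ?_, ?_⟩
    · have := hc.mul_transpose (j - 2)
      rwa [h1]
    · have := hc.transpose_mul (j - 2)
      rwa [h1]
    · have h2 := fwd_chain (t := t.toLinearMap) ψ (hc.mul_transpose (0 - 2))
        (hc.transpose_mul (0 - 2)) (hc.mul_transpose (0 - 2 + 1)) (hc.transpose_mul (0 - 2 + 1))
      rw [h2]
      have h3 : ψ.toLinearMap ∘ₗ HopfAlgebra.antipode k ∘ₗ HopfAlgebra.antipode k =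
          (ChainHopf.ofAlg (fun i : ℤ => i + 1) 0 t).toLinearMap := by
        ext a; simp [ψ, he]
      rw [h3]
      exact hc.fwd
  have hinv : (ChainHopf.lift hψ).comp (antipodeSq k H) = AlgHom.id k H := by
    refine ChainHopf.algHom_ext (fun a => ?_) (fun j p q => ?_)
    · simp [H, ChainHopf.antipode_ofAlg, ψ, he]
    · have : j + 1 + 1 - 2 = j := by ring
      simp [H, ChainHopf.antipode_mat, this]
  have hinv' : (antipodeSq k H).comp (ChainHopf.lift hψ) = AlgHom.id k H := by
    refine ChainHopf.algHom_ext (fun a => ?_) (fun j p q => ?_)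
    · have : HopfAlgebra.antipode k (HopfAlgebra.antipode k (e.symm a)) = a := e.apply_symm_apply a
      simp [H, ChainHopf.antipode_ofAlg, ψ, this]
    · have : j - 2 + 1 + 1 = j := by ring
      simp [H, ChainHopf.antipode_mat, this]
  constructor
  · intro x y hxy
    have h (z : H) : ChainHopf.lift hψ (HopfAlgebra.antipode k (HopfAlgebra.antipode k z)) = z :=
      congrArg (fun f => f z) hinv
    rw [← h x, ← h y, hxy]
  · intro x
    exact ⟨_, congrArg (fun f => f x) hinv'⟩

end Bijective

/-! ### Matrices of coefficients and the coalgebra `Coend V` -/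

section Comatrix

variable {k H : Type*} {ι : Type} [Field k] [Ring H] [HopfAlgebra k H]
  [Fintype ι] [DecidableEq ι]

/-- A matrix `M` over a Hopf algebra with `Δ Mₚᵩ = ∑ Mₚₗ ⊗ Mₗᵩ` and `ε(M) = 1`. -/
structure IsComatrix (k : Type*) {H : Type*} {ι : Type} [Field k] [Ring H] [HopfAlgebra k H]
    [Fintype ι] [DecidableEq ι] (M : Matrix ι ι H) : Prop where
  comul (p q : ι) : Coalgebra.comul (R := k) (M p q) = ∑ l, M p l ⊗ₜ[k] M l q
  counit (p q : ι) : Coalgebra.counit (R := k) (M p q) = if p = q then 1 else 0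

/-- The decomposition of the comultiplication of an entry of a comatrix. -/
def IsComatrix.repr {M : Matrix ι ι H} (hM : IsComatrix k M) (p q : ι) :
    Coalgebra.Repr k (M p q) ι where
  index := Finset.univ
  left l := M p l
  right l := M l q
  eq := (hM.comul p q).symm

theorem IsComatrix.mul_antipode {M : Matrix ι ι H} (hM : IsComatrix k M) :
    M * M.map (HopfAlgebra.antipode k) = 1 := by
  ext p q
  have := HopfAlgebra.sum_mul_antipode_eq_smul (hM.repr p q)
  rw [hM.counit] at this
  simpa [Matrix.mul_apply, Matrix.one_apply, IsComatrix.repr] using this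

theorem IsComatrix.antipode_mul {M : Matrix ι ι H} (hM : IsComatrix k M) :
    M.map (HopfAlgebra.antipode k) * M = 1 := by
  ext p q
  have := HopfAlgebra.sum_antipode_mul_eq_smul (hM.repr p q)
  rw [hM.counit] at this
  simpa [Matrix.mul_apply, Matrix.one_apply, IsComatrix.repr] using this

theorem IsComatrix.antipode {M : Matrix ι ι H} (hM : IsComatrix k M) :
    IsComatrix k (M.map (HopfAlgebra.antipode k)).transpose where
  comul p q := by
    have := comul_antipode_repr (hM.repr q p)
    simpa [IsComatrix.repr] using this
  counit p q := by
    simp [hM.counit, eq_comm]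

/-- The chain of iterated antipodes of a matrix. -/
def antipodeChain (k : Type*) {H : Type*} {ι : Type} [Field k] [Ring H] [HopfAlgebra k H]
    (M : Matrix ι ι H) : ℕ → Matrix ι ι H
  | 0 => M
  | n + 1 => ((antipodeChain k M n).map (HopfAlgebra.antipode k)).transpose

theorem IsComatrix.antipodeChain {M : Matrix ι ι H} (hM : IsComatrix k M) (n : ℕ) :
    IsComatrix k (antipodeChain k M n) := by
  induction n with
  | zero => exact hM
  | succ n ih => exact ih.antipode

theorem IsComatrix.isMatrixChain {A : Type*} [Ring A] [HopfAlgebra k A] {M : Matrix ι ι H}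
    (hM : IsComatrix k M) {t : A →ₐ[k] Matrix ι ι k} {φ : A →ₐ[k] H}
    (hf : Fwd t.toLinearMap φ.toLinearMap M) :
    IsMatrixChain Nat.succ 0 t φ (_root_.antipodeChain k M) where
  mul_transpose j := (hM.antipodeChain j).mul_antipode
  transpose_mul j := (hM.antipodeChain j).antipode_mul
  fwd := hf

theorem isComatrix_mat {k A : Type u} {ι J : Type} [Field k] [Ring A] [HopfAlgebra k A]
    [Fintype ι] [DecidableEq ι] (s : J → J) (o : J) (t : A →ₐ[k] Matrix ι ι k) (j : J) :
    IsComatrix k (ChainHopf.mat s o t j) :=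
  ⟨ChainHopf.comul_mat j, ChainHopf.counit_mat j⟩

/-- The relation `Fwd` in terms of the adjoint action. -/
theorem fwd_iff_adj {A : Type*} [Ring A] [HopfAlgebra k A] (t : A →ₐ[k] Matrix ι ι k)
    (ρ : A →ₗ[k] H) (M : Matrix ι ι H) :
    Fwd t.toLinearMap ρ M ↔ ∀ a, M * scalarMat k H ι (ρ a) = ∑ i ∈ (ℛ k a).index,
      constMat k H ι (t ((ℛ k a).left i)) * M *
        constMat k H ι (t (HopfAlgebra.antipode k ((ℛ k a).right i))) := by
  set c := (constMat k H ι).comp t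
  -- with `x a = M ρ(a)` and `y a = t(a) M` the relations are `y = x * c` and `x = y * (c ∘ S)`
  set x : WithConv (A →ₗ[k] Matrix ι ι H) :=
    toConv (LinearMap.mulLeft k M ∘ₗ (scalarMat k H ι).toLinearMap ∘ₗ ρ)
  set y : WithConv (A →ₗ[k] Matrix ι ι H) := toConv (LinearMap.mulRight k M ∘ₗ c.toLinearMap)
  have h1 : Fwd t.toLinearMap ρ M ↔ y = x * toConv c.toLinearMap := by
    rw [WithConv.ext_iff, LinearMap.ext_iff]
    refine forall_congr' fun a => ?_
    rw [toConv_mulLeft_mul]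
    rfl
  have h2 : (∀ a, M * scalarMat k H ι (ρ a) = ∑ i ∈ (ℛ k a).index,
      constMat k H ι (t ((ℛ k a).left i)) * M *
        constMat k H ι (t (HopfAlgebra.antipode k ((ℛ k a).right i)))) ↔
      x = y * toConv (c.toLinearMap ∘ₗ HopfAlgebra.antipode k) := by
    rw [WithConv.ext_iff, LinearMap.ext_iff]
    refine forall_congr' fun a => ?_
    have := (ℛ k a).convMul_apply y (toConv (c.toLinearMap ∘ₗ HopfAlgebra.antipode k))
    exact ⟨fun h => Eq.trans h this.symm, fun h => Eq.trans h this⟩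
  rw [h1, h2]
  constructor
  · intro h; rw [h, mul_assoc, c.conv_mul_antipode, mul_one]
  · intro h; rw [h, mul_assoc, c.conv_antipode_mul, mul_one]

end Comatrix

section CoendBasis

variable {k : Type*} {V : Type*} {ι : Type} [Field k] [AddCommGroup V] [Module k V]
  [Fintype ι] [DecidableEq ι] (b : Module.Basis ι k V)

/-- The coefficient functional `β ↦ βₚᵩ` on endomorphisms. -/
def coeff (p q : ι) : Coend k V :=
  Coend.toDual.symm (Matrix.entryLinearMap k k p q ∘ₗ (LinearMap.toMatrix b b).toLinearMap)

theorem toDual_coeff (p q : ι) (β : Module.End k V) :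
    Coend.toDual (coeff b p q) β = LinearMap.toMatrix b b β p q := rfl

/-- The matrix unit endomorphisms. -/
def unitEnd (p q : ι) : Module.End k V := Matrix.toLin b b (Matrix.single p q 1)

theorem eq_sum_unitEnd (β : Module.End k V) :
    β = ∑ p, ∑ q, LinearMap.toMatrix b b β p q • unitEnd b p q := by
  apply (LinearMap.toMatrix b b).injective
  simp only [map_sum, map_smul, unitEnd, LinearMap.toMatrix_toLin, Matrix.smul_single, smul_eq_mul,
    mul_one]
  exact Matrix.matrix_eq_sum_single _

theorem eq_sum_coeff (ξ : Coend k V) :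
    ξ = ∑ p, ∑ q, Coend.toDual ξ (unitEnd b p q) • coeff b p q := by
  apply (Coend.toDual (k := k) (V := V)).injective
  ext β : 1
  simp only [map_sum, map_smul, LinearMap.sum_apply, LinearMap.smul_apply, toDual_coeff]
  conv_lhs => rw [eq_sum_unitEnd b β]
  simp [mul_comm]

variable [FiniteDimensional k V]

theorem comul_coeff (p q : ι) : comul (R := k) (coeff b p q) =
    ∑ l, coeff b p l ⊗ₜ[k] coeff b l q := by
  apply (Coend.toDual₂ (k := k) (V := V)).injective
  refine TensorProduct.ext' fun α β => ?_
  rw [Coend.toDual₂_comul, map_sum, LinearMap.sum_apply]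
  simp only [Coend.toDual₂_tmul, toDual_coeff]
  rw [Module.End.mul_eq_comp, LinearMap.toMatrix_comp b b b, Matrix.mul_apply]

theorem counit_coeff (p q : ι) :
    counit (R := k) (coeff b p q) = if p = q then 1 else 0 := by
  rw [Coend.counit_eq, toDual_coeff, Module.End.one_eq_id, LinearMap.toMatrix_id, Matrix.one_apply]

variable {H : Type*} [Ring H] [HopfAlgebra k H]

/-- A coalgebra map from `Coend V` gives a comatrix. -/
theorem isComatrix_of_coalgHom (f : Coend k V →ₗc[k] H) :
    IsComatrix k (Matrix.of fun p q => f (coeff b p q)) where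
  comul p q := by
    have := CoalgHomClass.map_comp_comul_apply f (coeff b p q)
    rw [comul_coeff] at this
    simpa using this.symm
  counit p q := (CoalgHomClass.counit_comp_apply f _).trans (counit_coeff b p q)

/-- The coalgebra map from `Coend V` determined by a comatrix. -/
def coendHom (M : Matrix ι ι H) (hM : IsComatrix k M) : Coend k V →ₗc[k] H :=
  let f : Coend k V →ₗ[k] H := ∑ p, ∑ q,
    ((Module.Dual.eval k _ (unitEnd b p q)) ∘ₗ Coend.toDual.toLinearMap).smulRight (M p q)
  have hf (ξ : Coend k V) : f ξ = ∑ p, ∑ q, Coend.toDual ξ (unitEnd b p q) • M p q := by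
    simp [f]
  have hcoeff (p q) : f (coeff b p q) = M p q := by
    simp [hf, toDual_coeff, unitEnd, Matrix.single_apply, ite_and]
  { f with
    counit_comp := by
      ext ξ
      rw [eq_sum_coeff b ξ]
      simp [hcoeff, hM.counit, counit_coeff]
    map_comp_comul := by
      ext ξ
      rw [eq_sum_coeff b ξ]
      simp [hcoeff, hM.comul, comul_coeff] }

@[simp] theorem coendHom_coeff (M : Matrix ι ι H) (hM : IsComatrix k M) (p q : ι) :
    coendHom b M hM (coeff b p q) = M p q := by
  change (∑ p, ∑ q, ((Module.Dual.eval k _ (unitEnd b p q)) ∘ₗ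
    Coend.toDual.toLinearMap).smulRight (M p q) : Coend k V →ₗ[k] H) _ = _
  simp [toDual_coeff, unitEnd, Matrix.single_apply, ite_and]

theorem coend_linearMap_ext {W : Type*} [AddCommGroup W] [Module k W] {f g : Coend k V →ₗ[k] W}
    (h : ∀ p q, f (coeff b p q) = g (coeff b p q)) : f = g := by
  ext ξ
  rw [eq_sum_coeff b ξ]
  simp [h]

end CoendBasis

section CoendAction

variable {k A : Type u} {V : Type u} {ι : Type} [Field k] [Ring A] [HopfAlgebra k A]
  [AddCommGroup V] [Module k V] [Module A V] [IsScalarTower k A V] [FiniteDimensional k V]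
  [Fintype ι] [DecidableEq ι] (b : Module.Basis ι k V)

theorem op_smul_coeff (a : A) (p q : ι) : op a • coeff b p q =
    ∑ i ∈ (ℛ k a).index, ∑ l, ∑ m, (matrixRep b ((ℛ k a).left i) p l *
      matrixRep b (HopfAlgebra.antipode k ((ℛ k a).right i)) m q) • coeff b l m := by
  apply (Coend.toDual (k := k) (V := V)).injective
  ext β : 1
  rw [Coend.toDual_op_smul, Coend.adj_apply (ℛ k a), toDual_coeff]
  simp only [map_sum, map_smul, LinearMap.sum_apply, LinearMap.smul_apply, toDual_coeff,
    Matrix.sum_apply]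
  refine Finset.sum_congr rfl fun i _ => ?_
  rw [Module.End.mul_eq_comp, Module.End.mul_eq_comp, LinearMap.toMatrix_comp b b b,
    LinearMap.toMatrix_comp b b b, Matrix.mul_apply]
  simp only [Matrix.mul_apply, Finset.sum_mul]
  rw [Finset.sum_comm]
  refine Finset.sum_congr rfl fun l _ => Finset.sum_congr rfl fun m _ => ?_
  change matrixRep b _ p l * _ * matrixRep b _ m q = _
  rw [smul_eq_mul]
  ring

/-- Compatible triples correspond to comatrices satisfying the relation `Fwd`. -/
theorem isCompatible_iff {H : Type u} [Ring H] [HopfAlgebra k H] (f : Coend k V →ₗc[k] H)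
    (φ : A →ₐc[k] H) : IsCompatible f φ ↔
      Fwd (matrixRep b).toLinearMap (φ : A →ₐ[k] H).toLinearMap
        (Matrix.of fun p q => f (coeff b p q)) := by
  rw [fwd_iff_adj]
  refine forall_congr' fun a => ?_
  have h1 (p q : ι) : (∑ i ∈ (ℛ k a).index, constMat k H ι (matrixRep b ((ℛ k a).left i)) *
      (Matrix.of fun p q => f (coeff b p q)) * constMat k H ι (matrixRep b
        (HopfAlgebra.antipode k ((ℛ k a).right i)))) p q = f (op a • coeff b p q) := by
    rw [op_smul_coeff, map_sum, Matrix.sum_apply]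
    refine Finset.sum_congr rfl fun i _ => ?_
    rw [mul_constMat_apply]
    simp only [constMat_mul_apply, Finset.smul_sum, map_sum, map_smul, Matrix.of_apply, smul_smul]
    rw [Finset.sum_comm]
    simp only [mul_comm]
  have h2 (p q : ι) : ((Matrix.of fun p q => f (coeff b p q)) *
      scalarMat k H ι ((φ : A →ₐ[k] H).toLinearMap a)) p q = f (coeff b p q) * φ a := by
    simp [scalarMat]
  constructor
  · intro h
    ext p q
    rw [h1, h2, h]
  · intro h c
    have h3 : (f : Coend k V →ₗ[k] H) ∘ₗ
        ((Algebra.lsmul k k (Coend k V) : Aᵐᵒᵖ →ₐ[k] _) (op a)) =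
        LinearMap.mulRight k (φ a) ∘ₗ (f : Coend k V →ₗ[k] H) := by
      refine coend_linearMap_ext b fun p q => ?_
      have := congrFun (congrFun h p) q
      rw [h1, h2] at this
      exact this.symm
    exact congrArg (fun g => g c) h3

/-- The Hopf algebra on a chain indexed by the natural numbers is free on `Coend V`. -/
theorem isFreeHopfAlgebra_chainHopf :
    IsFreeHopfAlgebra (coendHom b _ (isComatrix_mat Nat.succ 0 (matrixRep b) 0))
      (ChainHopf.ofHopf Nat.succ 0 (matrixRep (k := k) (A := A) b)) where
  compatible := by
    rw [isCompatible_iff b]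
    have := (ChainHopf.isChain Nat.succ 0 (matrixRep (k := k) (A := A) b)).fwd
    simp only [coendHom_coeff]
    exact this
  existsUnique_lift H' _ _ f' φ' h := by
    rw [isCompatible_iff b] at h
    have hM := isComatrix_of_coalgHom b f'
    have hch := hM.isMatrixChain h
    let t₀ := ChainHopf.lift hch
    have hA (a) : t₀ (ChainHopf.ofAlg _ _ _ a) = φ' a := ChainHopf.lift_ofAlg hch a
    have hZ (j p q) : t₀ (ChainHopf.mat _ _ _ j p q) = antipodeChain k _ j p q :=
      ChainHopf.lift_mat hch j p q
    let t₁ : ChainHopf Nat.succ 0 (matrixRep (k := k) (A := A) b) →ₐc[k] H' :=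
      BialgHom.ofAlgHom t₀
        (by
          refine ChainHopf.algHom_ext (fun a => ?_) (fun j p q => ?_)
          · simp [hA, ChainHopf.counit_ofAlg]
          · simp [hZ, ChainHopf.counit_mat, (hM.antipodeChain j).counit])
        (by
          refine ChainHopf.algHom_ext (fun a => ?_) (fun j p q => ?_)
          · have := CoalgHomClass.map_comp_comul_apply φ' a
            simp only [AlgHom.comp_apply, Bialgebra.comulAlgHom_apply, hA, ChainHopf.comul_ofAlg]
            rw [← this, ← (ℛ k a).eq]
            simp [hA]
          · simp [hZ, ChainHopf.comul_mat, (hM.antipodeChain j).comul])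
    refine ⟨t₁, ⟨fun c => ?_, hA⟩, ?_⟩
    · have h3 : (t₁ : _ →ₗ[k] H') ∘ₗ (coendHom b _ (isComatrix_mat Nat.succ 0
          (matrixRep (k := k) (A := A) b) 0) : Coend k V →ₗ[k]
            ChainHopf Nat.succ 0 (matrixRep (k := k) (A := A) b)) = (f' : Coend k V →ₗ[k] H') := by
        refine coend_linearMap_ext b fun p q => ?_
        exact (congrArg t₀ (coendHom_coeff b _ (isComatrix_mat Nat.succ 0 _ 0) p q)).trans
          (hZ 0 p q)
      exact congrArg (fun g => g c) h3
    · rintro g ⟨hg, hg'⟩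
      have hgZ (j p q) : g (ChainHopf.mat _ _ _ j p q) = antipodeChain k
          (Matrix.of fun p q => f' (coeff b p q)) j p q := by
        induction j generalizing p q with
        | zero =>
          have := hg (coeff b p q)
          rwa [coendHom_coeff] at this
        | succ j ih =>
          have h4 := BialgHom.map_antipode g (ChainHopf.mat Nat.succ 0 (matrixRep b) j q p)
          rw [ih, ChainHopf.antipode_mat] at h4
          exact h4
      have h5 : (g : _ →ₐ[k] H') = t₀ := ChainHopf.algHom_ext (fun a => (hg' a).trans (hA a).symm)
        fun j p q => (hgZ j p q).trans (hZ j p q).symm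
      ext x
      exact congrArg (fun g => g x) h5

end CoendAction


/-! ### Generic inverses in algebras with a locally finite ideal -/

section GenericInverse

open Polynomial

variable {K E : Type*} [Field K] [Ring E] [Algebra K E]

/-- A two-sided ideal `I`, not containing `1`, of an algebra such that finitely many elements of
`K + I` always lie in a finite-dimensional subalgebra contained in `K + I`. -/
structure IsLocallyFiniteIdeal (I : Submodule K E) : Prop where
  mul_mem_left (x : E) {y : E} (hy : y ∈ I) : x * y ∈ I
  mul_mem_right (x : E) {y : E} (hy : y ∈ I) : y * x ∈ I
  one_notMem : (1 : E) ∉ I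
  exists_subalgebra (s : Finset E) (hs : ∀ x ∈ s, x ∈ K ∙ (1 : E) ⊔ I) :
    ∃ B : Subalgebra K E, FiniteDimensional K B ∧ (∀ x ∈ s, x ∈ B) ∧ ∀ x ∈ B, x ∈ K ∙ (1 : E) ⊔ I

/-- A polynomial family of elements of `K C + I`, for some `C`. -/
def IsPolyFamily (I : Submodule K E) (Z : K → E) : Prop :=
  ∃ (C : E) (n : ℕ) (p : Fin n → K[X]) (F : Fin n → E), (∀ i, F i ∈ K ∙ C ⊔ I) ∧
    ∀ c, Z c = ∑ i, (p i).eval c • F i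

theorem IsPolyFamily.comp {I : Submodule K E} {Z : K → E} (h : IsPolyFamily I Z) (g : E →ₗ[K] E)
    (hg : ∀ x ∈ I, g x ∈ I) : IsPolyFamily I (fun c => g (Z c)) := by
  obtain ⟨C, n, p, F, hF, hZ⟩ := h
  refine ⟨g C, n, p, fun i => g (F i), fun i => ?_, fun c => by simp [hZ]⟩
  obtain ⟨y, hy, z, hz, e⟩ := Submodule.mem_sup.1 (hF i)
  obtain ⟨a, rfl⟩ := Submodule.mem_span_singleton.1 hy
  change g (F i) ∈ _
  rw [← e, map_add, map_smul]
  exact Submodule.add_mem_sup (Submodule.smul_mem _ _ (Submodule.mem_span_singleton_self _))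
    (hg z hz)

theorem isPolyFamily_line {I : Submodule K E} (x y : E) (h : y ∈ I) :
    IsPolyFamily I (fun c : K => x + c • y) := by
  refine ⟨x, 2, ![1, X], ![x, y], fun i => ?_, fun c => by simp⟩
  fin_cases i
  · exact Submodule.mem_sup_left (Submodule.mem_span_singleton_self _)
  · exact Submodule.mem_sup_right h

/-- In a finite-dimensional algebra the inverse of a polynomial family is, up to a scalar
polynomial, again a polynomial family: by Cramer's rule for left multiplications. -/
theorem exists_adjugate_family (B : Type*) [Ring B] [Algebra K B] [FiniteDimensional K B] {n : ℕ}
    (p : Fin n → K[X]) (F : Fin n → B) (c₀ : K) (h₀ : ∑ i, (p i).eval c₀ • F i = 1) :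
    ∃ (D : K[X]) (m : ℕ) (q : Fin m → K[X]) (e : Fin m → B), D.eval c₀ ≠ 0 ∧
      ∀ c, (∑ i, (p i).eval c • F i) * (∑ j, (q j).eval c • e j) = D.eval c • 1 := by
  let b := Module.finBasis K B
  let P : Matrix _ _ K[X] := ∑ i, p i • (Algebra.leftMulMatrix b (F i)).map Polynomial.C
  have hP (c : K) : (Polynomial.evalRingHom c).mapMatrix P =
      Algebra.leftMulMatrix b (∑ i, (p i).eval c • F i) := by
    ext x y
    simp [P, Matrix.sum_apply]
  refine ⟨P.det, _, fun j => (P.adjugate.mulVec fun l => Polynomial.C (b.repr 1 l)) j, b, ?_,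
    fun c => ?_⟩
  · rw [← Polynomial.coe_evalRingHom, RingHom.map_det, hP, h₀, map_one, Matrix.det_one]
    exact one_ne_zero
  · apply b.equivFun.injective
    set G := ∑ i, (p i).eval c • F i
    have h1 (z : B) : b.equivFun (G * z) = (Algebra.leftMulMatrix b G).mulVec (b.equivFun z) := by
      have := Algebra.leftMulMatrix_mulVec_repr b G z
      exact this.symm
    have h2 : b.equivFun (∑ j, ((P.adjugate.mulVec fun l => Polynomial.C (b.repr 1 l)) j).eval c •
        b j) = (Algebra.leftMulMatrix b G).adjugate.mulVec (b.equivFun 1) := by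
      rw [← hP c, ← RingHom.map_adjugate]
      ext x
      simp [Matrix.mulVec, dotProduct, eval_finsetSum, Finsupp.single_apply]
    rw [h1, h2, Matrix.mulVec_mulVec, Matrix.mul_adjugate, Matrix.smul_mulVec, Matrix.one_mulVec,
      map_smul, ← hP c, ← RingHom.map_det, Polynomial.coe_evalRingHom]

/-- If a polynomial family has an invertible member, then its generic member is invertible, and the
inverse is, up to a scalar polynomial, again a polynomial family. -/
theorem IsPolyFamily.exists_inverse {I : Submodule K E} (hI : IsLocallyFiniteIdeal I) {Z : K → E}
    (hZ : IsPolyFamily I Z) {c₀ : K} (h₀ : IsUnit (Z c₀)) :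
    ∃ (D : K[X]) (W : K → E), D.eval c₀ ≠ 0 ∧ IsPolyFamily I W ∧
      ∀ c, D.eval c ≠ 0 → IsUnit (Z c) ∧ W c = D.eval c • Ring.inverse (Z c) := by
  obtain ⟨C, n, p, F, hF, hZ⟩ := hZ
  obtain ⟨z, hz⟩ := h₀
  -- as `Z c₀` is invertible, it does not belong to `I`, and hence `C` belongs to `K (Z c₀) + I`
  have hC : C ∈ K ∙ (z : E) ⊔ I := by
    have : (z : E) ∈ K ∙ C ⊔ I := by
      rw [hz, hZ]
      exact Submodule.sum_mem _ fun i _ => Submodule.smul_mem _ _ (hF i)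
    obtain ⟨y, hy, f, hf, e⟩ := Submodule.mem_sup.1 this
    obtain ⟨a, rfl⟩ := Submodule.mem_span_singleton.1 hy
    have ha : a ≠ 0 := by
      rintro rfl
      rw [zero_smul, zero_add] at e
      apply hI.one_notMem
      rw [← z.inv_mul, ← e]
      exact hI.mul_mem_left _ hf
    have : C = a⁻¹ • (z : E) + -(a⁻¹ • f) := by
      rw [← e, smul_add, smul_smul, inv_mul_cancel₀ ha, one_smul, add_neg_cancel_right]
    rw [this]
    exact Submodule.add_mem_sup (Submodule.smul_mem _ _ (Submodule.mem_span_singleton_self _))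
      (neg_mem (Submodule.smul_mem _ _ hf))
  have hF' (i) : F i ∈ K ∙ (z : E) ⊔ I := by
    refine (sup_le ?_ le_sup_right : K ∙ C ⊔ I ≤ K ∙ (z : E) ⊔ I) (hF i)
    rwa [Submodule.span_singleton_le_iff_mem]
  have hG (i) : (z⁻¹ : Eˣ) * F i ∈ K ∙ (1 : E) ⊔ I := by
    obtain ⟨y, hy, f, hf, e⟩ := Submodule.mem_sup.1 (hF' i)
    obtain ⟨a, rfl⟩ := Submodule.mem_span_singleton.1 hy
    rw [← e, mul_add, mul_smul_comm, z.inv_mul]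
    exact Submodule.add_mem_sup (Submodule.smul_mem _ _ (Submodule.mem_span_singleton_self _))
      (hI.mul_mem_left _ hf)
  classical
  obtain ⟨B, hB, hGB, hBI⟩ := hI.exists_subalgebra
    (Finset.univ.image fun i => (z⁻¹ : Eˣ) * F i) (by simpa using hG)
  replace hGB (i) : (z⁻¹ : Eˣ) * F i ∈ B := hGB _ (by simp)
  let G (i : Fin n) : B := ⟨_, hGB i⟩
  have hsum (c : K) : ((∑ i, (p i).eval c • G i : B) : E) = (z⁻¹ : Eˣ) * Z c := by
    rw [hZ, Finset.mul_sum]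
    simp [G]
  obtain ⟨D, m, q, e, hD, hq⟩ := exists_adjugate_family B p G c₀ (by
    apply Subtype.ext
    rw [hsum, ← hz]
    simp)
  refine ⟨D, fun c => ∑ j, (q j).eval c • ((e j : E) * (z⁻¹ : Eˣ)), hD,
    ⟨(z⁻¹ : Eˣ), m, q, _, fun j => ?_, fun c => rfl⟩, fun c hc => ?_⟩
  · obtain ⟨y, hy, f, hf, e'⟩ := Submodule.mem_sup.1 (hBI _ (e j).2)
    obtain ⟨a, rfl⟩ := Submodule.mem_span_singleton.1 hy
    rw [← e', add_mul, smul_mul_assoc, one_mul]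
    exact Submodule.add_mem_sup (Submodule.smul_mem _ _ (Submodule.mem_span_singleton_self _))
      (hI.mul_mem_right _ hf)
  · set g : B := ∑ i, (p i).eval c • G i
    set y : B := ∑ j, (q j).eval c • e j
    have h1 : g * ((D.eval c)⁻¹ • y) = 1 := by
      rw [mul_smul_comm, hq, smul_smul, inv_mul_cancel₀ hc, one_smul]
    have : IsNoetherianRing B := isNoetherian_of_tower K inferInstance
    -- a one-sided inverse in a finite-dimensional algebra is two-sided
    have h2 : ((D.eval c)⁻¹ • y) * g = 1 := mul_eq_one_symm h1
    have h3 : (g : E) = (z⁻¹ : Eˣ) * Z c := hsum c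
    have h1' := congrArg (Subtype.val) h1
    have h2' := congrArg (Subtype.val) h2
    simp only [MulMemClass.coe_mul, h3, OneMemClass.coe_one] at h1' h2'
    let w : Eˣ := ⟨Z c, (((D.eval c)⁻¹ • y : B) : E) * (z⁻¹ : Eˣ), by
      have := congrArg (fun x => (z : E) * x * (z⁻¹ : Eˣ)) h1'
      simpa [mul_assoc] using this, by rw [mul_assoc, h2']⟩
    refine ⟨w.isUnit, ?_⟩
    have h4 : Ring.inverse (Z c) = (((D.eval c)⁻¹ • y : B) : E) * (z⁻¹ : Eˣ) :=
      Ring.inverse_unit w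
    rw [h4, SetLike.val_smul, smul_mul_assoc, smul_smul, mul_inv_cancel₀ hc, one_smul]
    simp [y, Finset.sum_mul]

end GenericInverse

/-! ### Chains of transposed inverses -/

section TransposeChain

open Polynomial

variable {K E : Type*} [Field K] [Ring E] [Algebra K E] (tr : E →ₗ[K] E)

/-- The element `Z` can be inverted and transposed `n` times in succession. -/
def ChainInvertible : ℕ → E → Prop
  | 0, _ => True
  | n + 1, Z => IsUnit Z ∧ ChainInvertible n (tr (Ring.inverse Z))

variable {tr}

theorem ChainInvertible.smul {n : ℕ} {Z : E} (h : ChainInvertible tr n Z) {c : K} (hc : c ≠ 0) :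
    ChainInvertible tr n (c • Z) := by
  induction n generalizing Z c with
  | zero => trivial
  | succ n ih =>
    obtain ⟨⟨z, rfl⟩, h⟩ := h
    have e : ((Units.mk0 c hc • z : Eˣ) : E) = c • (z : E) := rfl
    refine ⟨⟨Units.mk0 c hc • z, e⟩, ?_⟩
    rw [← e, Ring.inverse_unit]
    rw [Ring.inverse_unit] at h
    have := ih h (inv_ne_zero hc)
    rw [← map_smul] at this
    have e' : (((Units.mk0 c hc • z)⁻¹ : Eˣ) : E) = c⁻¹ • ((z⁻¹ : Eˣ) : E) := by
      apply Units.inv_eq_of_mul_eq_one_right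
      rw [e, smul_mul_smul_comm, mul_inv_cancel₀ hc, Units.mul_inv, one_smul]
    rwa [e']

theorem IsPolyFamily.chainInvertible {I : Submodule K E} (hI : IsLocallyFiniteIdeal I)
    (htr : ∀ x ∈ I, tr x ∈ I) (n : ℕ) {Z : K → E} (hZ : IsPolyFamily I Z) {c₀ : K}
    (h₀ : ChainInvertible tr n (Z c₀)) :
    ∃ D : K[X], D.eval c₀ ≠ 0 ∧ ∀ c, D.eval c ≠ 0 → ChainInvertible tr n (Z c) := by
  induction n generalizing Z with
  | zero => exact ⟨1, by simp, fun _ _ => trivial⟩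
  | succ n ih =>
    obtain ⟨D, W, hD, hW, h⟩ := hZ.exists_inverse hI h₀.1
    have hW₀ : ChainInvertible tr n (tr (W c₀)) := by
      rw [(h c₀ hD).2, map_smul]
      exact h₀.2.smul hD
    obtain ⟨D', hD', h'⟩ := ih (hW.comp tr htr) hW₀
    refine ⟨D * D', by simp [hD, hD'], fun c hc => ?_⟩
    rw [eval_mul] at hc
    have hc₁ := left_ne_zero_of_mul hc
    refine ⟨(h c hc₁).1, ?_⟩
    have := (h' c (right_ne_zero_of_mul hc)).smul (inv_ne_zero hc₁)
    rwa [(h c hc₁).2, map_smul, smul_smul, inv_mul_cancel₀ hc₁, one_smul] at this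

/-- Let `T i` be invertible elements of subspaces `L i` such that `tr (T i)⁻¹` and `T (s i)` agree
modulo a locally finite ideal, and such that `Q⁻¹ ∈ L i` if and only if `tr Q ∈ L (s i)`. Then
each `L i` contains elements which can be inverted and transposed as often as one wishes: they are
inverses of generic members of pencils spanned by `(T i)⁻¹` and a transpose of such an element
of `L (s i)`. -/
theorem exists_chainInvertible [Infinite K] {I : Submodule K E} (hI : IsLocallyFiniteIdeal I)
    (htr : ∀ x ∈ I, tr x ∈ I) (htr₂ : ∀ x, tr (tr x) = x) {J : Type*} (s : J → J)
    (L : J → Submodule K E) (T : J → Eˣ) (hT : ∀ i, (T i : E) ∈ L i)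
    (hTs : ∀ i, tr ((T i)⁻¹ : Eˣ) - T (s i) ∈ I)
    (hL : ∀ i (Q : Eˣ), ((Q⁻¹ : Eˣ) : E) ∈ L i ↔ tr Q ∈ L (s i)) (n : ℕ) (i : J) :
    ∃ Z ∈ L i, Z - T i ∈ I ∧ ChainInvertible tr n Z := by
  induction n generalizing i with
  | zero => exact ⟨T i, hT i, by simp, trivial⟩
  | succ n ih =>
    obtain ⟨Z', hZ', hZT, hn⟩ := ih (s i)
    have hmem : ((T i)⁻¹ : Eˣ) - tr Z' ∈ I := by
      have h1 := htr _ (add_mem (hTs i) (neg_mem hZT))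
      have h2 : tr (tr ((T i)⁻¹ : Eˣ) - T (s i) + -(Z' - T (s i))) =
          ((T i)⁻¹ : Eˣ) - tr Z' := by
        simp [htr₂]
      rwa [h2] at h1
    set Y : E := ((T i)⁻¹ : Eˣ) - tr Z' with hY
    have hfam := isPolyFamily_line (K := K) (tr Z') Y hmem
    obtain ⟨D₁, _, hD₁, _, h₁⟩ := hfam.exists_inverse hI (c₀ := 1)
      (by rw [hY, one_smul, add_sub_cancel]; exact Units.isUnit _)
    obtain ⟨D₂, hD₂, h₂⟩ := (hfam.comp tr htr).chainInvertible hI htr n (c₀ := 0)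
      (by simpa [htr₂] using hn)
    obtain ⟨c, hc⟩ : ∃ c, (D₁ * D₂).eval c ≠ 0 := by
      by_contra! h
      have := Polynomial.funext (p := D₁ * D₂) (q := 0) (by simpa using h)
      rcases mul_eq_zero.1 this with h | h
      · simp [h] at hD₁
      · simp [h] at hD₂
    rw [eval_mul] at hc
    obtain ⟨Q, hQ⟩ := (h₁ c (left_ne_zero_of_mul hc)).1
    have hQn := h₂ c (right_ne_zero_of_mul hc)
    rw [← hQ] at hQn
    refine ⟨(Q⁻¹ : Eˣ), ?_, ?_, Units.isUnit _, ?_⟩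
    · rw [hL, hQ, map_add, map_smul, htr₂, hY, map_sub, htr₂]
      refine add_mem hZ' (Submodule.smul_mem _ _ (sub_mem ?_ hZ'))
      rw [← hL, inv_inv]
      exact hT i
    · have h3 : ((Q⁻¹ : Eˣ) : E) - T i = (Q⁻¹ : Eˣ) * (((T i)⁻¹ : Eˣ) - Q) * T i := by
        rw [mul_sub, sub_mul, mul_assoc, Units.inv_mul, Units.inv_mul, mul_one, one_mul]
      have h4 : (((T i)⁻¹ : Eˣ) : E) - Q = (1 - c) • Y := by
        rw [hQ, sub_smul, one_smul, hY]
        abel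
      rw [h3, h4]
      exact hI.mul_mem_right _ (hI.mul_mem_left _ (Submodule.smul_mem _ _ hmem))
    · rw [Ring.inverse_unit, inv_inv]
      exact hQn

theorem ChainInvertible.isUnit_iterate {n : ℕ} {Z : E} (h : ChainInvertible tr n Z) {j : ℕ}
    (hj : j < n) : IsUnit ((fun Z => tr (Ring.inverse Z))^[j] Z) := by
  induction j generalizing n Z with
  | zero =>
    obtain ⟨n, rfl⟩ := Nat.exists_eq_succ_of_ne_zero hj.ne'
    exact h.1
  | succ j ih =>
    obtain ⟨n, rfl⟩ := Nat.exists_eq_succ_of_ne_zero (Nat.ne_zero_of_lt hj)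
    exact ih h.2 (by omega)

end TransposeChain


/-! ### Intertwining operators on infinite-dimensional spaces -/

section Intertwiner

variable {k A X Y V : Type*} [Field k] [AddCommGroup A] [Module k A] [Coalgebra k A]
  [AddCommGroup X] [Module k X] [AddCommGroup Y] [Module k Y] [AddCommGroup V] [Module k V]

/-- The operator `a ⊗ v ↦ ∑ a₍₁₎ ⊗ f(a₍₂₎) v`. -/
def coact (f : A →ₗ[k] Module.End k V) : A ⊗[k] V →ₗ[k] A ⊗[k] V :=
  (TensorProduct.lift f).lTensor A ∘ₗ (TensorProduct.assoc k A A V).toLinearMap ∘ₗ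
    (comul (R := k) (A := A)).rTensor V

theorem coact_tmul (f : A →ₗ[k] Module.End k V) {κ : Type*} {a : A} (r : Coalgebra.Repr k a κ)
    (v : V) : coact f (a ⊗ₜ v) = ∑ i ∈ r.index, r.left i ⊗ₜ f (r.right i) v := by
  simp [coact, ← r.eq, TensorProduct.sum_tmul]

theorem coact_coact {f g : A →ₗ[k] Module.End k V} (h : toConv f * toConv g = 1)
    (z : A ⊗[k] V) : coact f (coact g z) = z := by
  suffices coact f ∘ₗ coact g = LinearMap.id from congrArg (fun q => q z) this
  refine TensorProduct.ext' fun a v => ?_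
  set r := ℛ k a
  rw [LinearMap.comp_apply, coact_tmul g r, map_sum]
  simp only [coact_tmul f (ℛ k _)]
  have h1 := congrArg ((TensorProduct.lift (LinearMap.mk₂ k (fun x y => f x (g y v))
    (by simp) (by simp) (by simp) (by simp))).lTensor A)
    (Coalgebra.sum_tmul_tmul_eq r (fun i => ℛ k (r.left i)) (fun i => ℛ k (r.right i)))
  simp only [map_sum, LinearMap.lTensor_tmul, TensorProduct.lift.tmul, LinearMap.mk₂_apply] at h1
  rw [h1]
  have h2 (x : A) : ∑ j ∈ (ℛ k x).index, f ((ℛ k x).left j) (g ((ℛ k x).right j) v) =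
      counit (R := k) x • v := by
    have h3 := ((ℛ k x).convMul_apply (toConv f) (toConv g)).symm
    rw [h] at h3
    have h4 := congrArg (fun q => q v) h3
    simpa using h4
  have h5 := congrArg (TensorProduct.rid k A) (Coalgebra.sum_tmul_counit_eq r)
  simp only [map_sum, TensorProduct.rid_tmul, one_smul] at h5
  simp only [← TensorProduct.tmul_sum, h2, TensorProduct.tmul_smul, TensorProduct.smul_tmul']
  rw [← TensorProduct.sum_tmul, h5]
  rfl

theorem coact_mul {m : A →ₗ[k] A →ₗ[k] A} (hm : ∀ a b, comul (R := k) (m a b) =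
      ∑ i ∈ (ℛ k a).index, ∑ j ∈ (ℛ k b).index, m ((ℛ k a).left i) ((ℛ k b).left j) ⊗ₜ[k]
        m ((ℛ k a).right i) ((ℛ k b).right j))
    {t : A →ₗ[k] Module.End k V} (ht : ∀ a b, t (m a b) = t a * t b) (a : A) (z : A ⊗[k] V) :
    coact t ((m a).rTensor V z) = ∑ i ∈ (ℛ k a).index,
      TensorProduct.map (m ((ℛ k a).left i)) (t ((ℛ k a).right i)) (coact t z) := by
  induction z with
  | zero => simp
  | add x y hx hy => simp only [map_add, hx, hy, Finset.sum_add_distrib]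
  | tmul b v =>
    rw [coact_tmul t (ℛ k b)]
    simp [coact, hm, TensorProduct.sum_tmul, ht]

/-- With `X ≅ Y × A ≅ Y × V ≅ Y` and a retraction `β` of `u : A → V`, this is the operator
`X ⊗ V ≅ X ⊗ A ⊕ X ⊗ W ≅ (Y ⊗ A ⊕ V ⊗ A) ⊕ Y ⊗ W ≅ Y ⊗ V ⊕ A ⊗ V ≅ X ⊗ V`, where
`V = u(A) ⊕ W`, and `V ⊗ A` is mapped to `A ⊗ V` by `v ⊗ a ↦ ∑ a₍₁₎ ⊗ t(a₍₂₎) v`. -/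
def seedBwd (t : A →ₗ[k] Module.End k V) (u : A →ₗ[k] V) (β : V →ₗ[k] A) (e₀ : (Y × A) ≃ₗ[k] X)
    (eA : (Y × V) ≃ₗ[k] X) (eW : Y ≃ₗ[k] X) : Module.End k (X ⊗[k] V) :=
  TensorProduct.map (e₀.toLinearMap ∘ₗ .inl k Y A ∘ₗ .fst k Y V ∘ₗ eA.symm.toLinearMap) (u ∘ₗ β) +
  TensorProduct.map (e₀.toLinearMap ∘ₗ .inl k Y A ∘ₗ eW.symm.toLinearMap) (1 - u ∘ₗ β) +
  (e₀.toLinearMap ∘ₗ .inr k Y A).rTensor V ∘ₗ coact t ∘ₗ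
    TensorProduct.map β (.snd k Y V ∘ₗ eA.symm.toLinearMap) ∘ₗ
      (TensorProduct.comm k X V).toLinearMap

/-- The inverse of `seedBwd`, where `t'` is the convolution inverse of `t`. -/
def seedFwd (t' : A →ₗ[k] Module.End k V) (u : A →ₗ[k] V) (β : V →ₗ[k] A) (e₀ : (Y × A) ≃ₗ[k] X)
    (eA : (Y × V) ≃ₗ[k] X) (eW : Y ≃ₗ[k] X) : Module.End k (X ⊗[k] V) :=
  TensorProduct.map (eA.toLinearMap ∘ₗ .inl k Y V ∘ₗ .fst k Y A ∘ₗ e₀.symm.toLinearMap) (u ∘ₗ β) +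
  TensorProduct.map (eW.toLinearMap ∘ₗ .fst k Y A ∘ₗ e₀.symm.toLinearMap) (1 - u ∘ₗ β) +
  (TensorProduct.comm k V X).toLinearMap ∘ₗ TensorProduct.map u (eA.toLinearMap ∘ₗ .inr k Y V) ∘ₗ
    coact t' ∘ₗ (.snd k Y A ∘ₗ e₀.symm.toLinearMap).rTensor V

variable {t t' : A →ₗ[k] Module.End k V} {u : A →ₗ[k] V} {β : V →ₗ[k] A}
  (e₀ : (Y × A) ≃ₗ[k] X) (eA : (Y × V) ≃ₗ[k] X) (eW : Y ≃ₗ[k] X)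

theorem seedBwd_tmul (x : X) (v : V) : seedBwd t u β e₀ eA eW (x ⊗ₜ v) =
    e₀ ((eA.symm x).1, 0) ⊗ₜ u (β v) + e₀ (eW.symm x, 0) ⊗ₜ (v - u (β v)) +
      (e₀.toLinearMap ∘ₗ .inr k Y A).rTensor V (coact t (β v ⊗ₜ (eA.symm x).2)) := rfl

theorem seedFwd_tmul (x : X) (v : V) : seedFwd t' u β e₀ eA eW (x ⊗ₜ v) =
    eA ((e₀.symm x).1, 0) ⊗ₜ u (β v) + eW (e₀.symm x).1 ⊗ₜ (v - u (β v)) +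
      TensorProduct.comm k V X (TensorProduct.map u (eA.toLinearMap ∘ₗ .inr k Y V)
        (coact t' ((e₀.symm x).2 ⊗ₜ v))) := rfl

theorem seedFwd_mul_seedBwd (hu : ∀ a, β (u a) = a) (h : toConv t' * toConv t = 1) :
    seedFwd t' u β e₀ eA eW * seedBwd t u β e₀ eA eW = 1 := by
  have h1 (z : A ⊗[k] V) : seedFwd t' u β e₀ eA eW ((e₀.toLinearMap ∘ₗ .inr k Y A).rTensor V z) =
      TensorProduct.comm k V X (TensorProduct.map u (eA.toLinearMap ∘ₗ .inr k Y V)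
        (coact t' z)) := by
    induction z with
    | zero => simp
    | add x y hx hy => simp only [map_add, hx, hy]
    | tmul b v => simp [seedFwd_tmul, ← Prod.zero_eq_mk]
  refine TensorProduct.ext' fun x v => ?_
  rw [Module.End.mul_apply, seedBwd_tmul, map_add, map_add, h1, coact_coact h, seedFwd_tmul,
    seedFwd_tmul]
  simp only [LinearEquiv.symm_apply_apply, hu, sub_self, TensorProduct.tmul_zero, add_zero,
    map_sub, TensorProduct.zero_tmul, map_zero, sub_zero, zero_add, LinearEquiv.apply_symm_apply,
    TensorProduct.map_tmul, TensorProduct.comm_tmul, Module.End.one_apply, LinearMap.comp_apply,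
    LinearEquiv.coe_coe, LinearMap.inr_apply]
  rw [add_right_comm, ← TensorProduct.add_tmul, ← map_add, Prod.mk_add_mk, add_zero, zero_add,
    Prod.mk.eta, LinearEquiv.apply_symm_apply, ← TensorProduct.tmul_add, add_sub_cancel]

theorem seedBwd_mul_seedFwd (hu : ∀ a, β (u a) = a) (h : toConv t * toConv t' = 1) :
    seedBwd t u β e₀ eA eW * seedFwd t' u β e₀ eA eW = 1 := by
  have h1 (z : A ⊗[k] V) : seedBwd t u β e₀ eA eW
      (TensorProduct.comm k V X (TensorProduct.map u (eA.toLinearMap ∘ₗ .inr k Y V) z)) =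
      (e₀.toLinearMap ∘ₗ .inr k Y A).rTensor V (coact t z) := by
    induction z with
    | zero => simp
    | add x y hx hy => simp only [map_add, hx, hy]
    | tmul b v => simp [seedBwd_tmul, ← Prod.zero_eq_mk, hu]
  refine TensorProduct.ext' fun x v => ?_
  rw [Module.End.mul_apply, seedFwd_tmul, map_add, map_add, h1, coact_coact h, seedBwd_tmul,
    seedBwd_tmul]
  simp only [LinearEquiv.symm_apply_apply, hu, sub_self, TensorProduct.tmul_zero, add_zero,
    map_sub, TensorProduct.zero_tmul, map_zero, sub_zero, zero_add,
    LinearMap.rTensor_tmul, Module.End.one_apply, LinearMap.comp_apply,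
    LinearEquiv.coe_coe, LinearMap.inr_apply]
  rw [← TensorProduct.tmul_add, add_sub_cancel, ← TensorProduct.add_tmul, ← map_add,
    Prod.mk_add_mk, add_zero, zero_add, Prod.mk.eta, LinearEquiv.apply_symm_apply]

/-- `seedBwd` intertwines the action of `A` on the second factor of `X ⊗ V` with the diagonal
action, for `A` acting trivially on `Y ⊆ X` and by multiplication on `A ⊆ X`. -/
theorem seedBwd_intertwines {m : A →ₗ[k] A →ₗ[k] A} (hm : ∀ a b, comul (R := k) (m a b) =
      ∑ i ∈ (ℛ k a).index, ∑ j ∈ (ℛ k b).index, m ((ℛ k a).left i) ((ℛ k b).left j) ⊗ₜ[k]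
        m ((ℛ k a).right i) ((ℛ k b).right j))
    (ht : ∀ a b, t (m a b) = t a * t b) (hβ : ∀ a v, β (t a v) = m a (β v))
    (hu : ∀ a b, u (m a b) = t a (u b)) {ρ : A →ₗ[k] Module.End k X}
    (hρ₁ : ∀ a y, ρ a (e₀ (y, 0)) = counit (R := k) a • e₀ (y, 0))
    (hρ₂ : ∀ a b, ρ a (e₀ (0, b)) = e₀ (0, m a b)) (a : A) :
    seedBwd t u β e₀ eA eW * (t a).lTensor X = (∑ i ∈ (ℛ k a).index,
      TensorProduct.map (ρ ((ℛ k a).left i)) (t ((ℛ k a).right i))) * seedBwd t u β e₀ eA eW := by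
  have h1 (y : Y) (v : V) : (∑ i ∈ (ℛ k a).index, TensorProduct.map (ρ ((ℛ k a).left i))
      (t ((ℛ k a).right i))) (e₀ (y, 0) ⊗ₜ v) = e₀ (y, 0) ⊗ₜ t a v := by
    simp only [LinearMap.sum_apply, TensorProduct.map_tmul, hρ₁, TensorProduct.smul_tmul,
      ← TensorProduct.tmul_sum]
    congr 1
    have h := congrArg (TensorProduct.lid k A) (Coalgebra.sum_counit_tmul_eq (ℛ k a))
    simp only [map_sum, TensorProduct.lid_tmul, one_smul] at h
    conv_rhs => rw [← h]
    simp
  have h2 (z : A ⊗[k] V) : (∑ i ∈ (ℛ k a).index, TensorProduct.map (ρ ((ℛ k a).left i))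
      (t ((ℛ k a).right i))) ((e₀.toLinearMap ∘ₗ .inr k Y A).rTensor V z) =
      (e₀.toLinearMap ∘ₗ .inr k Y A).rTensor V (∑ i ∈ (ℛ k a).index,
        TensorProduct.map (m ((ℛ k a).left i)) (t ((ℛ k a).right i)) z) := by
    induction z with
    | zero => simp
    | add x y hx hy => simp only [map_add, hx, hy, Finset.sum_add_distrib]
    | tmul b v => simp [hρ₂]
  refine TensorProduct.ext' fun x v => ?_
  rw [Module.End.mul_apply, Module.End.mul_apply, LinearMap.lTensor_tmul, seedBwd_tmul,
    seedBwd_tmul, map_add, map_add, h1, h1, h2, ← coact_mul hm ht, LinearMap.rTensor_tmul, hβ, hu,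
    map_sub]

end Intertwiner

/-! ### Operators on tensor products as matrices of operators -/

section TensorMatrix

variable {k X ι : Type*} [Field k] [AddCommGroup X] [Module k X] [Fintype ι] [DecidableEq ι]

/-- The coordinates of an element of `X ⊗ k^ι`. -/
def tensorCoord (i : ι) : X ⊗[k] (ι → k) →ₗ[k] X :=
  (TensorProduct.rid k X).toLinearMap ∘ₗ (LinearMap.proj i : (ι → k) →ₗ[k] k).lTensor X

@[simp] theorem tensorCoord_tmul (i : ι) (x : X) (v : ι → k) :
    tensorCoord i (x ⊗ₜ[k] v) = v i • x := by
  simp [tensorCoord]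

theorem sum_tensorCoord (z : X ⊗[k] (ι → k)) :
    ∑ i, tensorCoord i z ⊗ₜ[k] (Pi.single i 1 : ι → k) = z := by
  induction z with
  | zero => simp
  | add x y hx hy =>
    simp only [map_add, TensorProduct.add_tmul, Finset.sum_add_distrib, hx, hy]
  | tmul x v =>
    simp only [tensorCoord_tmul, TensorProduct.smul_tmul, ← TensorProduct.tmul_sum]
    congr 1
    ext j
    simp [Finset.sum_apply, Pi.single_apply]

/-- The matrix of operators on `X` describing an operator on `X ⊗ k^ι`. -/
def tensorMat : Module.End k (X ⊗[k] (ι → k)) →ₐ[k] Matrix ι ι (Module.End k X) :=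
  AlgHom.ofLinearMap
    { toFun f := Matrix.of fun i j =>
        tensorCoord i ∘ₗ f ∘ₗ (TensorProduct.mk k X (ι → k)).flip (Pi.single j 1)
      map_add' f g := by ext; simp
      map_smul' c f := by ext; simp }
    (by
      ext i j x
      by_cases h : i = j <;> simp [h, Matrix.one_apply])
    (fun f g => by
      ext i j x
      simp only [LinearMap.coe_mk, AddHom.coe_mk, Matrix.of_apply, LinearMap.comp_apply,
        Matrix.mul_apply, LinearMap.sum_apply, Module.End.mul_apply, LinearMap.flip_apply,
        TensorProduct.mk_apply]
      conv_lhs => rw [← sum_tensorCoord (g _)]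
      simp only [map_sum])

theorem tensorMat_apply (f : Module.End k (X ⊗[k] (ι → k))) (i j : ι) (x : X) :
    tensorMat f i j x = tensorCoord i (f (x ⊗ₜ Pi.single j 1)) := rfl

theorem tensorMat_map (f : Module.End k X) (g : Module.End k (ι → k)) :
    tensorMat (TensorProduct.map f g) =
      scalarMat k _ ι f * constMat k _ ι (LinearMap.toMatrix' g) := by
  ext i j x
  simp [tensorMat_apply, scalarMat_mul_apply, LinearMap.toMatrix'_apply,
    Module.algebraMap_end_apply]

theorem tensorMat_lTensor (g : Module.End k (ι → k)) :
    tensorMat (g.lTensor X) = constMat k _ ι (LinearMap.toMatrix' g) := by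
  rw [LinearMap.lTensor, tensorMat_map]
  change scalarMat k _ ι 1 * _ = _
  rw [map_one, one_mul]

end TensorMatrix


/-! ### Operators of finite rank -/

section FiniteRank

variable {K X ι : Type*} [Field K] [AddCommGroup X] [Module K X] [Fintype ι] [DecidableEq ι]

/-- An operator which factors through a finite-dimensional space has finite rank. -/
theorem finiteDimensional_range_comp {W X' : Type*} [AddCommGroup W] [Module K W]
    [FiniteDimensional K W] [AddCommGroup X'] [Module K X'] (f : W →ₗ[K] X') (g : X →ₗ[K] W) :
    FiniteDimensional K (LinearMap.range (f ∘ₗ g)) :=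
  Submodule.finiteDimensional_of_le (LinearMap.range_comp_le_range g f)

variable (K X ι) in
/-- Matrices of operators of finite rank. -/
def finiteRankMat : Submodule K (Matrix ι ι (Module.End K X)) where
  carrier := {M | ∀ i j, FiniteDimensional K (LinearMap.range (M i j))}
  add_mem' {M N} hM hN i j := by
    have := hM i j
    have := hN i j
    exact Submodule.finiteDimensional_of_le (LinearMap.range_add_le (M i j) (N i j))
  zero_mem' i j := by
    change FiniteDimensional K (LinearMap.range (0 : X →ₗ[K] X))
    rw [LinearMap.range_zero]
    infer_instance
  smul_mem' c M hM i j := by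
    have := hM i j
    have h : LinearMap.range ((c • M) i j) ≤ LinearMap.range (M i j) := by
      rintro _ ⟨x, rfl⟩
      exact ⟨c • x, by simp⟩
    exact Submodule.finiteDimensional_of_le h

theorem finiteRank_comp_left (f : Module.End K X) {g : Module.End K X}
    (hg : FiniteDimensional K (LinearMap.range g)) :
    FiniteDimensional K (LinearMap.range (f * g)) :=
  finiteDimensional_range_comp (f ∘ₗ (LinearMap.range g).subtype) g.rangeRestrict

theorem finiteRank_comp_right (f : Module.End K X) {g : Module.End K X}
    (hg : FiniteDimensional K (LinearMap.range g)) :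
    FiniteDimensional K (LinearMap.range (g * f)) :=
  Submodule.finiteDimensional_of_le (LinearMap.range_comp_le_range f g)

theorem finiteRank_sum {κ : Type*} (s : Finset κ) (f : κ → Module.End K X)
    (hf : ∀ i ∈ s, FiniteDimensional K (LinearMap.range (f i))) :
    FiniteDimensional K (LinearMap.range (∑ i ∈ s, f i)) := by
  classical
  induction s using Finset.induction_on with
  | empty =>
    rw [Finset.sum_empty, LinearMap.range_zero]
    infer_instance
  | insert a s ha ih =>
    rw [Finset.sum_insert ha]
    have := hf a (Finset.mem_insert_self _ _)
    have := ih fun i hi => hf i (Finset.mem_insert_of_mem hi)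
    exact Submodule.finiteDimensional_of_le (LinearMap.range_add_le _ _)

theorem exists_subalgebra_eq_span_one_sup {E : Type*} [Ring E] [Algebra K E] (F : Submodule K E)
    [FiniteDimensional K F] (hF : ∀ x ∈ F, ∀ y ∈ F, x * y ∈ F) :
    ∃ B : Subalgebra K E, FiniteDimensional K B ∧ ∀ x, x ∈ B ↔ x ∈ K ∙ (1 : E) ⊔ F := by
  have h1 : (1 : E) ∈ K ∙ (1 : E) ⊔ F :=
    Submodule.mem_sup_left (Submodule.mem_span_singleton_self _)
  have h2 (x y : E) (hx : x ∈ K ∙ (1 : E) ⊔ F) (hy : y ∈ K ∙ (1 : E) ⊔ F) :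
      x * y ∈ K ∙ (1 : E) ⊔ F := by
    obtain ⟨x', hx', f, hf, rfl⟩ := Submodule.mem_sup.1 hx
    obtain ⟨a, rfl⟩ := Submodule.mem_span_singleton.1 hx'
    obtain ⟨y', hy', g, hg, rfl⟩ := Submodule.mem_sup.1 hy
    obtain ⟨b, rfl⟩ := Submodule.mem_span_singleton.1 hy'
    have e : (a • (1 : E) + f) * (b • (1 : E) + g) =
        (a * b) • (1 : E) + (a • g + b • f + f * g) := by
      simp only [add_mul, mul_add, smul_mul_assoc, mul_smul_comm, one_mul, mul_one, smul_add,
        mul_smul, smul_comm b a]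
      abel
    rw [e]
    exact Submodule.add_mem_sup (Submodule.smul_mem _ _ (Submodule.mem_span_singleton_self _))
      (add_mem (add_mem (Submodule.smul_mem _ _ hg) (Submodule.smul_mem _ _ hf)) (hF f hf g hg))
  have h3 : FiniteDimensional K ↥(K ∙ (1 : E) ⊔ F) := inferInstance
  exact ⟨(K ∙ (1 : E) ⊔ F).toSubalgebra h1 h2, h3, fun x => Iff.rfl⟩

theorem isLocallyFiniteIdeal_finiteRankMat [Nonempty ι] (hX : ¬ FiniteDimensional K X) :
    IsLocallyFiniteIdeal (finiteRankMat K X ι) where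
  mul_mem_left x y hy i j := by
    rw [Matrix.mul_apply]
    exact finiteRank_sum _ _ fun l _ => finiteRank_comp_left _ (hy l j)
  mul_mem_right x y hy i j := by
    rw [Matrix.mul_apply]
    exact finiteRank_sum _ _ fun l _ => finiteRank_comp_right _ (hy i l)
  one_notMem h := by
    obtain ⟨i⟩ := ‹Nonempty ι›
    have h1 := h i i
    rw [Matrix.one_apply_eq, Module.End.one_eq_id, LinearMap.range_id] at h1
    exact hX ((Submodule.topEquiv (R := K) (M := X)).finiteDimensional)
  exists_subalgebra s hs := by
    classical
    have hs' (x : s) : ∃ f ∈ finiteRankMat K X ι,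
        x.1 - f ∈ K ∙ (1 : Matrix ι ι (Module.End K X)) := by
      obtain ⟨y, hy, f, hf, e⟩ := Submodule.mem_sup.1 (hs x x.2)
      exact ⟨f, hf, by rwa [← e, add_sub_cancel_right]⟩
    choose f hf hfs using hs'
    -- the algebra consists of the operators that factor through `Q` and whose range lies in `X₀`
    let g (p : s × ι × ι) : Module.End K X := f p.1 p.2.1 p.2.2
    have hg (p) : FiniteDimensional K (LinearMap.range (g p)) := hf _ _ _
    let X₀ : Submodule K X := ⨆ p, LinearMap.range (g p)
    let W := (p : s × ι × ι) → LinearMap.range (g p)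
    let Q : X →ₗ[K] W := LinearMap.pi fun p => (g p).rangeRestrict
    let Φ : Matrix ι ι (W →ₗ[K] X₀) →ₗ[K] Matrix ι ι (Module.End K X) :=
      (LinearMap.lcomp K X Q ∘ₗ (LinearMap.llcomp K W X₀ X X₀.subtype)).mapMatrix
    have hΦ (M) (i j) : Φ M i j = X₀.subtype ∘ₗ M i j ∘ₗ Q := rfl
    have hmul (M N) : ∃ P, Φ M * Φ N = Φ P := by
      refine ⟨Matrix.of fun i j => ∑ l, M i l ∘ₗ Q ∘ₗ X₀.subtype ∘ₗ N l j, ?_⟩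
      ext i j x
      simp [Matrix.mul_apply, hΦ]
    have hmem (x : s) : f x ∈ LinearMap.range Φ := by
      refine ⟨Matrix.of fun i j => Submodule.inclusion (le_iSup (fun p => LinearMap.range (g p))
        (x, i, j)) ∘ₗ LinearMap.proj (x, i, j), ?_⟩
      ext i j y
      rfl
    have hI : LinearMap.range Φ ≤ finiteRankMat K X ι := by
      rintro _ ⟨M, rfl⟩ i j
      rw [hΦ]
      exact finiteDimensional_range_comp (X₀.subtype ∘ₗ M i j) Q
    obtain ⟨B, hB, hB'⟩ := exists_subalgebra_eq_span_one_sup (LinearMap.range Φ) (by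
      rintro _ ⟨M, rfl⟩ _ ⟨N, rfl⟩
      obtain ⟨P, hP⟩ := hmul M N
      exact ⟨P, hP.symm⟩)
    refine ⟨B, hB, fun x hx => (hB' x).2 ?_, fun x hx => sup_le_sup_left hI _ ((hB' x).1 hx)⟩
    have := Submodule.add_mem_sup (hfs ⟨x, hx⟩) (hmem ⟨x, hx⟩)
    rwa [sub_add_cancel] at this

theorem transpose_mem_finiteRankMat {M : Matrix ι ι (Module.End K X)}
    (hM : M ∈ finiteRankMat K X ι) : M.transpose ∈ finiteRankMat K X ι :=
  fun i j => hM j i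

theorem map_baseChange_mem_finiteRankMat (L : Type*) [Field L] [Algebra K L]
    {M : Matrix ι ι (Module.End K X)} (hM : M ∈ finiteRankMat K X ι) :
    M.map (Module.End.baseChangeHom K L X) ∈ finiteRankMat L (L ⊗[K] X) ι := fun i j => by
  have := hM i j
  have h : Module.End.baseChangeHom K L X (M i j) =
      (LinearMap.range (M i j)).subtype.baseChange L ∘ₗ (M i j).rangeRestrict.baseChange L := by
    rw [← LinearMap.baseChange_comp]
    rfl
  rw [Matrix.map_apply, h]
  exact finiteDimensional_range_comp _ _

end FiniteRank

/-! ### Chains in germs of sequences -/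

section Germs

open Filter

variable {k A R ι : Type*} [Field k] [Ring A] [HopfAlgebra k A] [Ring R] [Algebra k R]
  [Fintype ι] [DecidableEq ι]

/-- Germs at infinity of sequences in an algebra form an algebra. -/
instance germAlgebra : Algebra k (Germ (atTop : Filter ℕ) R) :=
  Algebra.ofModule
    (fun r x y => Germ.inductionOn₂ x y fun f g => congrArg Germ.ofFun (smul_mul_assoc r f g))
    (fun r x y => Germ.inductionOn₂ x y fun f g => congrArg Germ.ofFun (mul_smul_comm r f g))

variable (k R) in
/-- The germ of a sequence. -/
def germHom : (ℕ → R) →ₐ[k] Germ (atTop : Filter ℕ) R :=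
  AlgHom.ofLinearMap
    { toFun f := (f : Germ (atTop : Filter ℕ) R)
      map_add' _ _ := rfl
      map_smul' _ _ := rfl } rfl (fun _ _ => rfl)

theorem germHom_eq_iff {f g : ℕ → R} :
    germHom k R f = germHom k R g ↔ ∀ᶠ n in atTop, f n = g n :=
  Germ.coe_eq

theorem fwd_pi {t : A →ₗ[k] Matrix ι ι k} {ρ : A →ₗ[k] (ℕ → R)} {M : Matrix ι ι (ℕ → R)}
    (h : ∀ n, Fwd t ((Pi.evalAlgHom k (fun _ : ℕ => R) n).toLinearMap ∘ₗ ρ)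
      (M.map (Pi.evalAlgHom k (fun _ : ℕ => R) n))) : Fwd t ρ M := fun a => by
  ext p q n
  have h1 := congrFun (congrFun (h n a) p) q
  rw [← map_twist, ← map_constMat _ (Pi.evalAlgHom k (fun _ : ℕ => R) n)] at h1
  have h2 (P Q : Matrix ι ι (ℕ → R)) : (P * Q) p q n = (P.map (Pi.evalAlgHom k (fun _ : ℕ => R) n) *
      Q.map (Pi.evalAlgHom k (fun _ : ℕ => R) n)) p q := by
    simp [Matrix.mul_apply]
  rw [h2, h2]
  exact h1

theorem fwd_even_of_chain {t : A →ₗ[k] Matrix ι ι k} {φ : A →ₐ[k] R} {Z : ℕ → Matrix ι ι R}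
    {n : ℕ} (h₁ : ∀ j < n, Z j * (Z (j + 1)).transpose = 1)
    (h₂ : ∀ j < n, (Z (j + 1)).transpose * Z j = 1) (h₀ : Fwd t φ.toLinearMap (Z 0)) {m : ℕ}
    (hm : 2 * m ≤ n) : Fwd t (φ.comp (antipodeSq k A ^ m)).toLinearMap (Z (2 * m)) := by
  induction m with
  | zero => exact h₀
  | succ m ih =>
    have := (fwd_chain (φ.comp (antipodeSq k A ^ m)) (h₁ (2 * m) (by omega)) (h₂ (2 * m) (by omega))
      (h₁ (2 * m + 1) (by omega)) (h₂ (2 * m + 1) (by omega))).1 (ih (by omega))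
    rw [pow_succ]
    exact this

/-- If over some algebra there are arbitrarily long chains, then the algebra `A` embeds into the
Hopf algebra on a chain indexed by the integers: shifted chains give rise to a chain indexed by
the integers in the algebra of germs of sequences. -/
theorem ofAlg_injective_of_chains {k A R : Type u} {ι : Type} [Field k] [Ring A] [HopfAlgebra k A]
    [Ring R] [Algebra k R] [Fintype ι] [DecidableEq ι] {t : A →ₐ[k] Matrix ι ι k} {φ : A →ₐ[k] R}
    (hφ : Function.Injective φ)
    (hS : Function.Injective (HopfAlgebra.antipode k (A := A)))
    (h : ∀ n : ℕ, ∃ Z : ℕ → Matrix ι ι R, (∀ j < n, Z j * (Z (j + 1)).transpose = 1) ∧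
      (∀ j < n, (Z (j + 1)).transpose * Z j = 1) ∧ Fwd t.toLinearMap φ.toLinearMap (Z 0)) :
    Function.Injective (ChainHopf.ofAlg (fun i : ℤ => i + 1) 0 t) := by
  choose Z h₁ h₂ h₀ using fun n : ℕ => h (4 * n)
  let φ' : A →ₐ[k] (ℕ → R) := AlgHom.pi fun n => φ.comp (antipodeSq k A ^ n)
  let Z' (i : ℤ) : Matrix ι ι (ℕ → R) := Matrix.of fun p q n => Z n (i + 2 * n).toNat p q
  have hev (i : ℤ) : ∀ᶠ n : ℕ in atTop, (i + 2 * n).toNat < 4 * n ∧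
      (i + 1 + 2 * n).toNat = (i + 2 * n).toNat + 1 := by
    filter_upwards [eventually_gt_atTop i.natAbs] with n hn
    omega
  have hone (p q : ι) : (1 : Matrix ι ι (Germ (atTop : Filter ℕ) R)) p q =
      germHom k R fun _ => (1 : Matrix ι ι R) p q := by
    rw [Matrix.one_apply, Matrix.one_apply]
    split_ifs
    · exact (map_one _).symm
    · exact (map_zero _).symm
  have hmul (P Q : Matrix ι ι (ℕ → R)) (p q : ι) :
      (P.map (germHom k R) * Q.map (germHom k R)) p q =
      germHom k R fun n => ∑ l, P p l n * Q l q n := by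
    rw [Matrix.mul_apply]
    simp only [Matrix.map_apply, ← map_mul, ← map_sum]
    congr 1
    ext n
    simp
  have hF : Fwd t.toLinearMap φ'.toLinearMap (Z' 0) := by
    refine fwd_pi fun n => ?_
    have h3 := fwd_even_of_chain (h₁ n) (h₂ n) (h₀ n) (m := n) (by omega)
    have e : (Z' 0).map (Pi.evalAlgHom k (fun _ : ℕ => R) n) = Z n (2 * n) := by
      ext p q
      have h4 : ((0 : ℤ) + 2 * n).toNat = 2 * n := by omega
      exact congrArg (fun j => Z n j p q) h4
    rw [e]
    exact h3
  have hZ : IsMatrixChain (fun i : ℤ => i + 1) 0 t ((germHom k R).comp φ')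
      (fun i => (Z' i).map (germHom k R)) := by
    refine ⟨fun i => ?_, fun i => ?_, hF.map (germHom k R)⟩
    · ext p q
      rw [← Matrix.transpose_map, hmul, hone, germHom_eq_iff]
      filter_upwards [hev i] with n hn
      have := congrFun (congrFun (h₁ n _ hn.1) p) q
      rw [← hn.2, Matrix.mul_apply] at this
      exact this
    · ext p q
      rw [← Matrix.transpose_map, hmul, hone, germHom_eq_iff]
      filter_upwards [hev i] with n hn
      have := congrFun (congrFun (h₂ n _ hn.1) p) q
      rw [← hn.2, Matrix.mul_apply] at this
      exact this
  intro a b hab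
  have h1 : germHom k R (φ' a) = germHom k R (φ' b) := by
    have := congrArg (ChainHopf.lift hZ) hab
    rwa [ChainHopf.lift_ofAlg, ChainHopf.lift_ofAlg] at this
  obtain ⟨n, hn⟩ := (germHom_eq_iff.1 h1).exists
  have h2 : Function.Injective (antipodeSq k A ^ n) := by
    rw [AlgHom.coe_pow]
    exact (hS.comp hS).iterate n
  exact h2 (hφ hn)

end Germs


/-! ### The seeds of the chains -/

section Seeds

variable {k A : Type*} {ι : Type} [Field k] [Ring A] [HopfAlgebra k A] [FiniteDimensional k A]
  [Fintype ι] [DecidableEq ι]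

theorem nonempty_finsupp_prod_equiv (k B : Type*) [Field k] [AddCommGroup B] [Module k B]
    [FiniteDimensional k B] : Nonempty (((ℕ →₀ k) × B) ≃ₗ[k] (ℕ →₀ k)) := by
  obtain ⟨e⟩ := nonempty_equiv_of_countable (α := ℕ ⊕ Fin (Module.finrank k B)) (β := ℕ)
  exact ⟨((LinearEquiv.refl k (ℕ →₀ k)).prodCongr (Module.finBasis k B).repr).trans
    ((Finsupp.sumFinsuppLEquivProdFinsupp k).symm.trans (Finsupp.domLCongr e))⟩

variable (k A) in
/-- The representation of `A` on the sum of a trivial representation of countable dimension and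
the regular representation. -/
def bigRep : A →ₐ[k] Module.End k ((ℕ →₀ k) × A) :=
  AlgHom.ofLinearMap
    { toFun a := (counit (R := k) a • LinearMap.id).prodMap (LinearMap.mulLeft k a)
      map_add' a b := by ext <;> simp [add_smul, add_mul]
      map_smul' c a := by ext <;> simp [mul_smul] }
    (by ext <;> simp)
    (fun a b => by ext <;> simp [mul_smul])

@[simp] theorem bigRep_apply (a : A) (x : (ℕ →₀ k) × A) :
    bigRep k A a x = (counit (R := k) a • x.1, a * x.2) := rfl

/-- The matrix of operators `f π + g (1 - π)`. -/
def mixMat {X : Type*} [AddCommGroup X] [Module k X] (f g : Module.End k X) (π : Matrix ι ι k) :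
    Matrix ι ι (Module.End k X) :=
  scalarMat k _ ι f * constMat k _ ι π + scalarMat k _ ι g * constMat k _ ι (1 - π)

theorem mixMat_transpose {X : Type*} [AddCommGroup X] [Module k X] (f g : Module.End k X)
    (π : Matrix ι ι k) : (mixMat f g π).transpose = mixMat f g π.transpose := by
  have h (m : Matrix ι ι k) : (constMat k (Module.End k X) ι m).transpose =
      constMat k _ ι m.transpose := rfl
  simp [mixMat, transpose_scalarMat_mul, h]

theorem tensorMat_comp_mem_finiteRankMat {X W : Type*} [AddCommGroup X] [Module k X]
    [AddCommGroup W] [Module k W] [FiniteDimensional k W] (f : W →ₗ[k] X ⊗[k] (ι → k))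
    (g : X ⊗[k] (ι → k) →ₗ[k] W) : tensorMat (f ∘ₗ g) ∈ finiteRankMat k X ι := fun i j =>
  finiteDimensional_range_comp (tensorCoord i ∘ₗ f)
    (g ∘ₗ (TensorProduct.mk k X (ι → k)).flip (Pi.single j 1))

theorem tensorMat_sub_mixMat {X : Type*} [AddCommGroup X] [Module k X] (f g : Module.End k X)
    (π : Module.End k (ι → k)) (F : Module.End k (X ⊗[k] (ι → k))) :
    tensorMat (TensorProduct.map f π + TensorProduct.map g (1 - π) + F) -
      mixMat f g (LinearMap.toMatrix' π) = tensorMat F := by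
  rw [map_add, map_add, tensorMat_map, tensorMat_map, map_sub, LinearMap.toMatrix'_one, mixMat,
    add_sub_cancel_left]

/-- Seeds exist for the (anti)multiplicative maps `α`, `t`: mutually inverse matrices of operators,
one of which is subject to the relation `Bwd`, which up to finite rank depend only on the idempotent
matrix of `u β`. -/
theorem exists_seed : ∃ rA rW sA sW : Module.End k ((ℕ →₀ k) × A),
    ∀ (m : A →ₗ[k] A →ₗ[k] A), (∀ a b, comul (R := k) (m a b) =
      ∑ i ∈ (ℛ k a).index, ∑ j ∈ (ℛ k b).index, m ((ℛ k a).left i) ((ℛ k b).left j) ⊗ₜ[k]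
        m ((ℛ k a).right i) ((ℛ k b).right j)) →
    ∀ (α : A ≃ₗ[k] A), (∀ a, counit (R := k) (α a) = counit (R := k) a) →
      (∀ a b, α (m a b) = α a * α b) →
    ∀ (t t' : A →ₗ[k] Matrix ι ι k), toConv t * toConv t' = 1 → toConv t' * toConv t = 1 →
      (∀ a b, t (m a b) = t a * t b) →
    ∀ (u : A →ₗ[k] (ι → k)) (β : (ι → k) →ₗ[k] A), (∀ a, β (u a) = a) →
      (∀ a v, β ((t a).mulVec v) = m a (β v)) → (∀ a b, u (m a b) = (t a).mulVec (u b)) →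
    ∃ N M : Matrix ι ι (Module.End k ((ℕ →₀ k) × A)), M * N = 1 ∧ N * M = 1 ∧
      Bwd t ((bigRep k A).toLinearMap ∘ₗ α.toLinearMap) N ∧
      N - mixMat rA rW (LinearMap.toMatrix' (u ∘ₗ β)) ∈ finiteRankMat k _ ι ∧
      M - mixMat sA sW (LinearMap.toMatrix' (u ∘ₗ β)) ∈ finiteRankMat k _ ι := by
  obtain ⟨e₁⟩ := nonempty_finsupp_prod_equiv k A
  obtain ⟨e₂⟩ := nonempty_finsupp_prod_equiv k (ι → k)
  let eW : (ℕ →₀ k) ≃ₗ[k] (ℕ →₀ k) × A := e₁.symm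
  let eA : ((ℕ →₀ k) × (ι → k)) ≃ₗ[k] (ℕ →₀ k) × A := e₂.trans eW
  refine ⟨.inl k _ A ∘ₗ .fst k _ (ι → k) ∘ₗ eA.symm.toLinearMap, .inl k _ A ∘ₗ eW.symm.toLinearMap,
    eA.toLinearMap ∘ₗ .inl k _ (ι → k) ∘ₗ .fst k _ A, eW.toLinearMap ∘ₗ .fst k _ A,
    fun m hm α hα hαm t t' htt' ht't ht u β hu hβ hum => ?_⟩
  let g : Matrix ι ι k →ₐ[k] Module.End k (ι → k) :=
    (Matrix.toLinAlgEquiv' (R := k) (n := ι)).toAlgHom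
  have hone : g.toLinearMap ∘ₗ (1 : WithConv (A →ₗ[k] Matrix ι ι k)).ofConv =
      (1 : WithConv (A →ₗ[k] Module.End k (ι → k))).ofConv := by ext1 a; simp
  have h₁ : toConv (g.toLinearMap ∘ₗ t) * toConv (g.toLinearMap ∘ₗ t') = 1 := by
    have := LinearMap.algHom_comp_convMul_distrib g (toConv t) (toConv t')
    rw [htt', hone] at this
    exact WithConv.ext this.symm
  have h₂ : toConv (g.toLinearMap ∘ₗ t') * toConv (g.toLinearMap ∘ₗ t) = 1 := by
    have := LinearMap.algHom_comp_convMul_distrib g (toConv t') (toConv t)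
    rw [ht't, hone] at this
    exact WithConv.ext this.symm
  let e₀ : ((ℕ →₀ k) × A) ≃ₗ[k] (ℕ →₀ k) × A := (LinearEquiv.refl k _).prodCongr α
  have hg (x : Matrix ι ι k) : LinearMap.toMatrix' (g x) = x := LinearMap.toMatrix'_toLin' x
  refine ⟨tensorMat (seedBwd (g.toLinearMap ∘ₗ t) u β e₀ eA eW),
    tensorMat (seedFwd (g.toLinearMap ∘ₗ t') u β e₀ eA eW), ?_, ?_, fun a => ?_, ?_, ?_⟩
  · rw [← map_mul, seedFwd_mul_seedBwd e₀ eA eW hu h₂, map_one]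
  · rw [← map_mul, seedBwd_mul_seedFwd e₀ eA eW hu h₁, map_one]
  · have h := seedBwd_intertwines (t := g.toLinearMap ∘ₗ t) e₀ eA eW hm (fun a b => by simp [ht])
      hβ hum (ρ := (bigRep k A).toLinearMap ∘ₗ α.toLinearMap) (fun a y => by simp [e₀, hα])
      (fun a b => by simp [e₀, hαm]) a
    have hc (b : A) : LinearMap.toMatrix' ((g.toLinearMap ∘ₗ t) b) = t b := hg _
    have htm (f : Module.End k ((ℕ →₀ k) × A)) (b : A) :
        tensorMat (TensorProduct.map f ((g.toLinearMap ∘ₗ t) b)) =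
          scalarMat k _ ι f * constMat k _ ι (t b) := by rw [tensorMat_map, hc]
    have h' := congrArg tensorMat h
    rw [map_mul, map_mul, tensorMat_lTensor, map_sum, hc] at h'
    simp only [htm] at h'
    rw [twist_repr _ _ (ℛ k a), h']
  · have h := tensorMat_comp_mem_finiteRankMat ((e₀.toLinearMap ∘ₗ
      LinearMap.inr k (ℕ →₀ k) A).rTensor (ι → k) ∘ₗ coact (g.toLinearMap ∘ₗ t))
      (TensorProduct.map β (LinearMap.snd k (ℕ →₀ k) (ι → k) ∘ₗ eA.symm.toLinearMap) ∘ₗ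
      (TensorProduct.comm k ((ℕ →₀ k) × A) (ι → k)).toLinearMap)
    rw [← tensorMat_sub_mixMat (LinearMap.inl k (ℕ →₀ k) A ∘ₗ LinearMap.fst k _ (ι → k) ∘ₗ
      eA.symm.toLinearMap) (LinearMap.inl k (ℕ →₀ k) A ∘ₗ eW.symm.toLinearMap) (u ∘ₗ β)] at h
    have hf : e₀.toLinearMap ∘ₗ LinearMap.inl k (ℕ →₀ k) A = LinearMap.inl k (ℕ →₀ k) A := by
      ext <;> simp [e₀]
    rw [← hf] at h ⊢
    exact h
  · have h := tensorMat_comp_mem_finiteRankMat ((TensorProduct.comm k (ι → k)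
      ((ℕ →₀ k) × A)).toLinearMap ∘ₗ TensorProduct.map u (eA.toLinearMap ∘ₗ
      LinearMap.inr k (ℕ →₀ k) (ι → k)) ∘ₗ coact (g.toLinearMap ∘ₗ t'))
      ((LinearMap.snd k (ℕ →₀ k) A ∘ₗ e₀.symm.toLinearMap).rTensor (ι → k))
    rw [← tensorMat_sub_mixMat (eA.toLinearMap ∘ₗ LinearMap.inl k (ℕ →₀ k) (ι → k) ∘ₗ
      LinearMap.fst k (ℕ →₀ k) A) (eW.toLinearMap ∘ₗ LinearMap.fst k (ℕ →₀ k) A) (u ∘ₗ β)] at h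
    exact h

end Seeds


/-! ### Seeds for a representation and its transpose -/

section Relations

variable {k A K R ι : Type*} [Field k] [AddCommGroup A] [Module k A] [Coalgebra k A] [Field K]
  [Ring R] [Algebra k R] [Algebra K R] [Fintype ι] [DecidableEq ι]

variable (K) in
/-- The space of solutions of the relation `Fwd`. -/
def fwdSubmodule (t : A →ₗ[k] Matrix ι ι k) (ρ : A →ₗ[k] R) : Submodule K (Matrix ι ι R) where
  carrier := {M | Fwd t ρ M}
  add_mem' h h' a := by rw [mul_add, add_mul, h a, h' a]
  zero_mem' a := by rw [mul_zero, zero_mul]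
  smul_mem' c M h a := by rw [mul_smul_comm, smul_mul_assoc, h a]

variable (K) in
/-- The space of solutions of the relation `Bwd`. -/
def bwdSubmodule (t : A →ₗ[k] Matrix ι ι k) (ρ : A →ₗ[k] R) : Submodule K (Matrix ι ι R) where
  carrier := {N | Bwd t ρ N}
  add_mem' h h' a := by rw [mul_add, add_mul, h a, h' a]
  zero_mem' a := by rw [mul_zero, zero_mul]
  smul_mem' c M h a := by rw [mul_smul_comm, smul_mul_assoc, h a]

end Relations

section Embedding

variable {k A : Type u} {ι : Type} [Field k] [Ring A] [HopfAlgebra k A] [FiniteDimensional k A]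
  [Fintype ι] [DecidableEq ι]

/-- If `ρ` is an algebra homomorphism then the inverses of the solutions of each of the relations
occurring in a chain are the transposes of the solutions of the next one. -/
theorem inv_mem_bwdSubmodule_iff {K R : Type*} [Field K] [Ring R] [Algebra k R] [Algebra K R]
    (t : A →ₗ[k] Matrix ι ι k) (ρ : A →ₐ[k] R) (Q : (Matrix ι ι R)ˣ) :
    ((Q⁻¹ : (Matrix ι ι R)ˣ) : Matrix ι ι R) ∈ bwdSubmodule K (trLin t)
        (ρ.toLinearMap ∘ₗ HopfAlgebra.antipode k) ↔
      (Q : Matrix ι ι R).transpose ∈ fwdSubmodule K t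
        (ρ.toLinearMap ∘ₗ HopfAlgebra.antipode k ∘ₗ HopfAlgebra.antipode k) := by
  refine Iff.trans ?_ (fwd_transpose_antipode (t := t) ρ (Q : Matrix ι ι R).transpose)
  rw [Matrix.transpose_transpose]
  exact ⟨fun h => Bwd.fwd h Q.mul_inv Q.inv_mul, fun h => Fwd.bwd h Q.mul_inv Q.inv_mul⟩

theorem inv_mem_fwdSubmodule_iff {K R : Type*} [Field K] [Ring R] [Algebra k R] [Algebra K R]
    (t : A →ₗ[k] Matrix ι ι k) (ρ : A →ₐ[k] R) (Q : (Matrix ι ι R)ˣ) :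
    ((Q⁻¹ : (Matrix ι ι R)ˣ) : Matrix ι ι R) ∈ fwdSubmodule K t ρ.toLinearMap ↔
      (Q : Matrix ι ι R).transpose ∈ bwdSubmodule K (trLin t)
        (ρ.toLinearMap ∘ₗ HopfAlgebra.antipode k) := by
  refine Iff.trans ?_ (bwd_transpose_antipode (t := t) ρ (Q : Matrix ι ι R))
  exact ⟨fun h => Fwd.bwd h Q.inv_mul Q.mul_inv, fun h => Bwd.fwd h Q.inv_mul Q.mul_inv⟩

theorem toConv_mul_eq_one {E : Type*} [Ring E] [Algebra k E] {f g : A →ₗ[k] E}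
    (h : ∀ a, ∑ i ∈ (ℛ k a).index, f ((ℛ k a).left i) * g ((ℛ k a).right i) =
      algebraMap k E (counit a)) : toConv f * toConv g = 1 := by
  refine WithConv.ext (LinearMap.ext fun a => ?_)
  exact ((ℛ k a).convMul_apply _ _).trans (h a)

theorem transpose_sub_mem_finiteRankMat {K Y : Type*} [Field K] [AddCommGroup Y] [Module K Y]
    {M N P Q : Matrix ι ι (Module.End K Y)} (hM : M - P ∈ finiteRankMat K Y ι)
    (hN : N - Q ∈ finiteRankMat K Y ι) (hPQ : P.transpose = Q) :
    M.transpose - N ∈ finiteRankMat K Y ι := by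
  have := sub_mem (transpose_mem_finiteRankMat hM) hN
  rwa [Matrix.transpose_sub, hPQ, sub_sub_sub_cancel_right] at this

/-- The seeds for a representation with matrix `t` on the coordinate space that has `A` as a direct
summand, embedded by `s` with retraction `p`. For the representation by transposed
matrices, the corresponding embedding is constructed from a Frobenius form of `A`. -/
theorem exists_seeds (t : A →ₐ[k] Matrix ι ι k) (s : A →ₗ[k] (ι → k)) (p : (ι → k) →ₗ[k] A)
    (hps : ∀ a, p (s a) = a) (hs : ∀ a b, s (a * b) = (t a).mulVec (s b))
    (hp : ∀ a v, p ((t a).mulVec v) = a * p v) :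
    ∃ T : ℕ × Bool → (Matrix ι ι (Module.End k ((ℕ →₀ k) × A)))ˣ,
      (∀ n, Fwd t.toLinearMap ((bigRep k A).comp (antipodeSq k A ^ n)).toLinearMap
        (T (n, false)).val) ∧
      (∀ n, Bwd (trLin t.toLinearMap) (((bigRep k A).comp (antipodeSq k A ^ n)).toLinearMap ∘ₗ
        HopfAlgebra.antipode k) (T (n, true)).val) ∧
      (∀ n, (T (n, false)).inv.transpose - (T (n, true)).val ∈ finiteRankMat k _ ι) ∧
      (∀ n, (T (n, true)).inv.transpose - (T (n + 1, false)).val ∈ finiteRankMat k _ ι) := by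
  obtain ⟨l, hS, hl⟩ := exists_frobenius k A
  obtain ⟨rA, rW, sA, sW, hseed⟩ := exists_seed (k := k) (A := A) (ι := ι)
  let σ : A ≃ₗ[k] A := LinearEquiv.ofBijective (HopfAlgebra.antipode k) hS
  have hσ (a : A) : HopfAlgebra.antipode k (σ.symm a) = a := σ.apply_symm_apply a
  have hpow (n : ℕ) : Function.Bijective (antipodeSq k A ^ n) := by
    rw [AlgHom.coe_pow]
    exact (hS.comp hS).iterate n
  let σn (n : ℕ) : A ≃ₗ[k] A := LinearEquiv.ofBijective (antipodeSq k A ^ n).toLinearMap (hpow n)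
  have hσn (n : ℕ) (a : A) : σn n a = (antipodeSq k A ^ n) a := rfl
  have hε (n : ℕ) (a : A) : counit (R := k) (σn n a) = counit (R := k) a := by
    rw [hσn, AlgHom.coe_pow]
    induction n with
    | zero => rfl
    | succ n ih => rw [Function.iterate_succ_apply', antipodeSq_apply, HopfAlgebra.counit_antipode,
        HopfAlgebra.counit_antipode, ih]
  set π := LinearMap.toMatrix' (s ∘ₗ p)
  -- the solutions for the representation `t` itself
  have heven (n : ℕ) := hseed (LinearMap.mul k A) (fun a b => by
      conv_lhs => rw [LinearMap.mul_apply', Bialgebra.comul_mul, ← (ℛ k a).eq, ← (ℛ k b).eq]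
      simp [Finset.sum_mul_sum]) (σn n) (hε n) (fun a b => by simp [hσn])
    t.toLinearMap (t.toLinearMap ∘ₗ HopfAlgebra.antipode k) t.conv_mul_antipode t.conv_antipode_mul
    (fun a b => by simp) s p hps hp hs
  -- the Frobenius form `l` identifies `A` with its dual, and thus the transposes of `p` and `s`
  -- become an embedding of the opposite algebra of `A` and its retraction
  let Λ : A ≃ₗ[k] (A →ₗ[k] k) := LinearEquiv.ofBijective ((LinearMap.mul k A).compr₂ l) hl
  have hΛ (a b : A) : Λ a b = l (a * b) := rfl
  let u : A →ₗ[k] (ι → k) := LinearMap.pi fun j =>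
    l ∘ₗ (LinearMap.mul k A).flip (p (Pi.single j 1))
  have hu (b : A) (v : ι → k) : u b ⬝ᵥ v = l (b * p v) := by
    have : dotProductBilin k k (u b) = l ∘ₗ LinearMap.mulLeft k b ∘ₗ p := by
      ext j
      simp [u]
    exact congrArg (fun f => f v) this
  let β : (ι → k) →ₗ[k] A := Λ.symm.toLinearMap ∘ₗ (LinearMap.lcomp k k s ∘ₗ dotProductBilin k k)
  have hβ (v : ι → k) (c : A) : l (β v * c) = v ⬝ᵥ s c := by
    rw [← hΛ]
    exact congrArg (fun f => f c) (Λ.apply_symm_apply _)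
  have hinj {x y : A} (h : ∀ c, l (x * c) = l (y * c)) : x = y := Λ.injective (LinearMap.ext h)
  have hβu (a : A) : β (u a) = a := hinj fun c => by rw [hβ, hu, hps]
  have hβt (a : A) (v : ι → k) : β ((t a).transpose.mulVec v) = β v * a := hinj fun c => by
    rw [hβ, mul_assoc, hβ, hs, Matrix.mulVec_transpose, Matrix.dotProduct_mulVec]
  have hut (a b : A) : u (b * a) = (t a).transpose.mulVec (u b) := dotProduct_eq _ _ fun v => by
    rw [hu, mul_assoc, ← hp, ← hu, Matrix.mulVec_transpose, Matrix.dotProduct_mulVec]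
  have hπ : LinearMap.toMatrix' (u ∘ₗ β) = π.transpose := by
    ext i j
    change LinearMap.toMatrix' (u ∘ₗ β) i j = LinearMap.toMatrix' (s ∘ₗ p) j i
    rw [LinearMap.toMatrix'_apply, LinearMap.toMatrix'_apply]
    change u (β (Pi.single j 1)) i = s (p (Pi.single i 1)) j
    rw [← dotProduct_single_one (u _) i, hu, hβ, single_one_dotProduct]
  have hconv₁ : toConv (trLin t.toLinearMap) * toConv (trLin t.toLinearMap ∘ₗ σ.symm.toLinearMap) =
      1 := toConv_mul_eq_one fun a => by
    have h : ∑ i ∈ (ℛ k a).index, σ.symm ((ℛ k a).right i) * (ℛ k a).left i =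
        algebraMap k A (counit a) := by
      apply hS.1
      simp only [map_sum, HopfAlgebra.antipode_mul_antidistrib, hσ,
        HopfAlgebra.sum_antipode_mul_eq_algebraMap_counit]
      rw [Algebra.algebraMap_eq_smul_one, map_smul, HopfAlgebra.antipode_one]
    have h' := congrArg (fun x => (t x).transpose) h
    simp only [map_sum, map_mul, Matrix.transpose_sum, Matrix.transpose_mul,
      AlgHom.commutes] at h'
    rw [Matrix.algebraMap_eq_diagonal, Matrix.diagonal_transpose] at h'
    exact h'
  have hconv₂ : toConv (trLin t.toLinearMap ∘ₗ σ.symm.toLinearMap) * toConv (trLin t.toLinearMap) =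
      1 := toConv_mul_eq_one fun a => by
    have h : ∑ i ∈ (ℛ k a).index, (ℛ k a).right i * σ.symm ((ℛ k a).left i) =
        algebraMap k A (counit a) := by
      apply hS.1
      simp only [map_sum, HopfAlgebra.antipode_mul_antidistrib, hσ,
        HopfAlgebra.sum_mul_antipode_eq_algebraMap_counit]
      rw [Algebra.algebraMap_eq_smul_one, map_smul, HopfAlgebra.antipode_one]
    have h' := congrArg (fun x => (t x).transpose) h
    simp only [map_sum, map_mul, Matrix.transpose_sum, Matrix.transpose_mul,
      AlgHom.commutes] at h'
    rw [Matrix.algebraMap_eq_diagonal, Matrix.diagonal_transpose] at h'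
    exact h'
  have hodd (n : ℕ) := hseed (LinearMap.mul k A).flip (fun a b => by
      conv_lhs => rw [LinearMap.flip_apply, LinearMap.mul_apply', Bialgebra.comul_mul,
        ← (ℛ k a).eq, ← (ℛ k b).eq]
      rw [Finset.sum_mul_sum, Finset.sum_comm]
      simp) (σ.trans (σn n))
    (fun a => by rw [LinearEquiv.trans_apply, hε]; exact HopfAlgebra.counit_antipode a)
    (fun a b => by
      change (antipodeSq k A ^ n) (HopfAlgebra.antipode k (b * a)) =
        (antipodeSq k A ^ n) (HopfAlgebra.antipode k a) *
          (antipodeSq k A ^ n) (HopfAlgebra.antipode k b)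
      rw [HopfAlgebra.antipode_mul_antidistrib, map_mul])
    (trLin t.toLinearMap) (trLin t.toLinearMap ∘ₗ σ.symm.toLinearMap) hconv₁ hconv₂
    (fun a b => by simp) u β hβu hβt hut
  choose Ne Me hMNe hNMe hBe hNe hMe using heven
  choose No Mo hMNo hNMo hBo hNo hMo using hodd
  refine ⟨fun i => bif i.2 then ⟨No i.1, Mo i.1, hNMo i.1, hMNo i.1⟩ else
    ⟨Me i.1, Ne i.1, hMNe i.1, hNMe i.1⟩, fun n => (hBe n).fwd (hMNe n) (hNMe n), fun n => hBo n,
    fun n => transpose_sub_mem_finiteRankMat (hNe n) (hNo n) ?_,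
    fun n => transpose_sub_mem_finiteRankMat (hMo n) (hMe (n + 1)) ?_⟩
  · rw [mixMat_transpose, hπ]
  · rw [mixMat_transpose, hπ, Matrix.transpose_transpose]

end Embedding


/-! ### Embedding into the Hopf algebra of a chain -/

section ChainExistence

variable {k A : Type u} {ι : Type} [Field k] [Ring A] [HopfAlgebra k A] [FiniteDimensional k A]
  [Fintype ι] [DecidableEq ι]

/-- An element that can be inverted and transposed `n` times yields a chain of length `n`. -/
theorem exists_chain_of_chainInvertible {K R : Type*} [Field K] [Ring R] [Algebra K R] {n : ℕ}
    {Z : Matrix ι ι R} (h : ChainInvertible (Matrix.transposeLinearEquiv ι ι K R).toLinearMap n Z) :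
    ∃ Z' : ℕ → Matrix ι ι R, Z' 0 = Z ∧ (∀ j < n, Z' j * (Z' (j + 1)).transpose = 1) ∧
      ∀ j < n, (Z' (j + 1)).transpose * Z' j = 1 := by
  refine ⟨fun j => (fun Z => (Matrix.transposeLinearEquiv ι ι K R).toLinearMap
    (Ring.inverse Z))^[j] Z, rfl, fun j hj => ?_, fun j hj => ?_⟩
  · simp only [Function.iterate_succ_apply']
    exact Ring.mul_inverse_cancel _ (h.isUnit_iterate hj)
  · simp only [Function.iterate_succ_apply']
    exact Ring.inverse_mul_cancel _ (h.isUnit_iterate hj)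

/-- Seeds whose transposed inverses agree with their successors modulo a locally finite ideal
give rise to chains of arbitrary length. -/
theorem exists_chain_of_seeds {K R : Type*} [Field K] [Infinite K] [Ring R] [Algebra K R]
    [Algebra k R] (t : A →ₐ[k] Matrix ι ι k) (φ : A →ₐ[k] R) {I : Submodule K (Matrix ι ι R)}
    (hI : IsLocallyFiniteIdeal I) (htr : ∀ M ∈ I, M.transpose ∈ I)
    (T : ℕ × Bool → (Matrix ι ι R)ˣ)
    (hT₁ : ∀ n, Fwd t.toLinearMap (φ.comp (antipodeSq k A ^ n)).toLinearMap (T (n, false)).val)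
    (hT₂ : ∀ n, Bwd (trLin t.toLinearMap) ((φ.comp (antipodeSq k A ^ n)).toLinearMap ∘ₗ
      HopfAlgebra.antipode k) (T (n, true)).val)
    (hT₃ : ∀ n, (T (n, false)).inv.transpose - (T (n, true)).val ∈ I)
    (hT₄ : ∀ n, (T (n, true)).inv.transpose - (T (n + 1, false)).val ∈ I) (n : ℕ) :
    ∃ Z : ℕ → Matrix ι ι R, (∀ j < n, Z j * (Z (j + 1)).transpose = 1) ∧
      (∀ j < n, (Z (j + 1)).transpose * Z j = 1) ∧ Fwd t.toLinearMap φ.toLinearMap (Z 0) := by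
  let φn (n : ℕ) := φ.comp (antipodeSq k A ^ n)
  let s : ℕ × Bool → ℕ × Bool := fun i => bif i.2 then (i.1 + 1, false) else (i.1, true)
  let L : ℕ × Bool → Submodule K (Matrix ι ι R) := fun i =>
    bif i.2 then bwdSubmodule K (trLin t.toLinearMap)
      ((φn i.1).toLinearMap ∘ₗ HopfAlgebra.antipode k)
    else fwdSubmodule K t.toLinearMap (φn i.1).toLinearMap
  have hT (i : ℕ × Bool) : (T i).val ∈ L i := by
    obtain ⟨n, _ | _⟩ := i
    · exact hT₁ n
    · exact hT₂ n
  have hTs (i : ℕ × Bool) : (Matrix.transposeLinearEquiv ι ι K R).toLinearMap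
      ((T i)⁻¹).val - (T (s i)).val ∈ I := by
    obtain ⟨n, _ | _⟩ := i
    · exact hT₃ n
    · exact hT₄ n
  have hL (i : ℕ × Bool) (Q : (Matrix ι ι R)ˣ) :
      (Q⁻¹).val ∈ L i ↔ (Matrix.transposeLinearEquiv ι ι K R).toLinearMap Q.val ∈ L (s i) := by
    obtain ⟨n, _ | _⟩ := i
    · exact inv_mem_fwdSubmodule_iff t.toLinearMap (φn n) Q
    · refine (inv_mem_bwdSubmodule_iff t.toLinearMap (φn n) Q).trans ?_
      have : (φn (n + 1)).toLinearMap =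
          (φn n).toLinearMap ∘ₗ HopfAlgebra.antipode k ∘ₗ HopfAlgebra.antipode k := by
        simp only [φn, pow_succ]
        rfl
      rw [← this]
      rfl
  obtain ⟨Z, hZ, _, hn⟩ := exists_chainInvertible hI htr (fun x => Matrix.transpose_transpose x)
    s L T hT hTs hL n (0, false)
  obtain ⟨Z', hZ', h₁, h₂⟩ := exists_chain_of_chainInvertible hn
  refine ⟨Z', h₁, h₂, ?_⟩
  rw [hZ']
  exact hZ

/-- The seeds may be given over another algebra `R₀`, if the congruences hold over `R`. -/
theorem exists_chain_of_seeds_map {K R₀ R : Type*} [Field K] [Infinite K] [Ring R₀] [Algebra k R₀]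
    [Ring R] [Algebra K R] [Algebra k R] (g : R₀ →ₐ[k] R) (t : A →ₐ[k] Matrix ι ι k)
    (φ : A →ₐ[k] R₀) {I : Submodule K (Matrix ι ι R)}
    (hI : IsLocallyFiniteIdeal I) (htr : ∀ M ∈ I, M.transpose ∈ I)
    (T : ℕ × Bool → (Matrix ι ι R₀)ˣ)
    (hT₁ : ∀ n, Fwd t.toLinearMap (φ.comp (antipodeSq k A ^ n)).toLinearMap (T (n, false)).val)
    (hT₂ : ∀ n, Bwd (trLin t.toLinearMap) ((φ.comp (antipodeSq k A ^ n)).toLinearMap ∘ₗ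
      HopfAlgebra.antipode k) (T (n, true)).val)
    (hT₃ : ∀ n, ((T (n, false)).inv.map g).transpose - (T (n, true)).val.map g ∈ I)
    (hT₄ : ∀ n, ((T (n, true)).inv.map g).transpose - (T (n + 1, false)).val.map g ∈ I) (n : ℕ) :
    ∃ Z : ℕ → Matrix ι ι R, (∀ j < n, Z j * (Z (j + 1)).transpose = 1) ∧
      (∀ j < n, (Z (j + 1)).transpose * Z j = 1) ∧
      Fwd t.toLinearMap (g.comp φ).toLinearMap (Z 0) :=
  exists_chain_of_seeds t (g.comp φ) hI htr
    (fun i => ⟨(T i).val.map g, (T i).inv.map g, by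
      have := congrArg g.mapMatrix (T i).val_inv
      rwa [map_mul, map_one] at this, by
      have := congrArg g.mapMatrix (T i).inv_val
      rwa [map_mul, map_one] at this⟩)
    (fun n => (hT₁ n).map g) (fun n => (hT₂ n).map g) hT₃ hT₄ n

theorem not_finiteDimensional_baseChange (k K Y : Type u) [Field k] [Field K] [Algebra k K]
    [AddCommGroup Y] [Module k Y] : ¬ FiniteDimensional K (K ⊗[k] ((ℕ →₀ k) × Y)) := by
  intro h
  have h1 : Module.Finite k ((ℕ →₀ k) × Y) := by
    have h := Module.rank_lt_aleph0_iff.2 h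
    rw [Module.rank_baseChange, Cardinal.lift_id] at h
    exact Module.rank_lt_aleph0_iff.1 h
  have h2 : Module.Finite k (ℕ →₀ k) :=
    Module.Finite.of_surjective (LinearMap.fst k (ℕ →₀ k) Y) LinearMap.fst_surjective
  have h3 := Module.rank_lt_aleph0_iff.2 h2
  rw [rank_finsupp_self] at h3
  simp at h3

theorem map_transpose_sub_mem_finiteRankMat {X : Type*} [AddCommGroup X] [Module k X]
    (K : Type*) [Field K] [Algebra k K] {M N : Matrix ι ι (Module.End k X)}
    (h : M.transpose - N ∈ finiteRankMat k X ι) :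
    (M.map (Module.End.baseChangeHom k K X)).transpose - N.map (Module.End.baseChangeHom k K X) ∈
      finiteRankMat K (K ⊗[k] X) ι := by
  have := map_baseChange_mem_finiteRankMat K h
  rwa [Matrix.map_sub _ (map_sub _)] at this

theorem bigRep_baseChange_injective (K : Type*) [Field K] [Algebra k K] : Function.Injective
    ((Module.End.baseChangeHom k K ((ℕ →₀ k) × A)).comp (bigRep k A)) := by
  intro a b h
  have h1 := congrArg (fun f => f (1 ⊗ₜ[k] (0, 1))) h
  have h2 : (1 : K) ⊗ₜ[k] (bigRep k A a (0, 1)) = 1 ⊗ₜ[k] (bigRep k A b (0, 1)) := h1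
  have h3 := Module.FaithfullyFlat.tensorProduct_mk_injective (A := k) (B := K)
    ((ℕ →₀ k) × A) h2
  simpa using congrArg Prod.snd h3

theorem exists_chain_baseChange {X : Type*} [AddCommGroup X] [Module k X] (K : Type*) [Field K]
    [Algebra k K] [Infinite K] [Nonempty ι] (hX : ¬ FiniteDimensional K (K ⊗[k] X))
    (t : A →ₐ[k] Matrix ι ι k) (φ : A →ₐ[k] Module.End k X)
    (T : ℕ × Bool → (Matrix ι ι (Module.End k X))ˣ)
    (hT₁ : ∀ n, Fwd t.toLinearMap (φ.comp (antipodeSq k A ^ n)).toLinearMap (T (n, false)).val)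
    (hT₂ : ∀ n, Bwd (trLin t.toLinearMap) ((φ.comp (antipodeSq k A ^ n)).toLinearMap ∘ₗ
      HopfAlgebra.antipode k) (T (n, true)).val)
    (hT₃ : ∀ n, (T (n, false)).inv.transpose - (T (n, true)).val ∈ finiteRankMat k X ι)
    (hT₄ : ∀ n, (T (n, true)).inv.transpose - (T (n + 1, false)).val ∈ finiteRankMat k X ι)
    (n : ℕ) :
    ∃ Z : ℕ → Matrix ι ι (Module.End K (K ⊗[k] X)),
      (∀ j < n, Z j * (Z (j + 1)).transpose = 1) ∧ (∀ j < n, (Z (j + 1)).transpose * Z j = 1) ∧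
      Fwd t.toLinearMap ((Module.End.baseChangeHom k K X).comp φ).toLinearMap (Z 0) := by
  have hI := isLocallyFiniteIdeal_finiteRankMat (ι := ι) hX
  have htr (M : Matrix ι ι (Module.End K (K ⊗[k] X))) (hM : M ∈ finiteRankMat K (K ⊗[k] X) ι) :=
    transpose_mem_finiteRankMat hM
  have h₃ (n : ℕ) := map_transpose_sub_mem_finiteRankMat K (hT₃ n)
  have h₄ (n : ℕ) := map_transpose_sub_mem_finiteRankMat K (hT₄ n)
  have h := exists_chain_of_seeds_map (R₀ := Module.End k X) (R := Module.End K (K ⊗[k] X))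
    (Module.End.baseChangeHom k K X) t φ hI htr
  exact h T hT₁ hT₂ h₃ h₄ n

theorem exists_chain_bigRep (K : Type u) [Field K] [Algebra k K] [Infinite K] [Nonempty ι]
    (t : A →ₐ[k] Matrix ι ι k) (s : A →ₗ[k] (ι → k)) (p : (ι → k) →ₗ[k] A)
    (hps : ∀ a, p (s a) = a) (hs : ∀ a b, s (a * b) = (t a).mulVec (s b))
    (hp : ∀ a v, p ((t a).mulVec v) = a * p v) (n : ℕ) :
    ∃ Z : ℕ → Matrix ι ι (Module.End K (K ⊗[k] ((ℕ →₀ k) × A))),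
      (∀ j < n, Z j * (Z (j + 1)).transpose = 1) ∧ (∀ j < n, (Z (j + 1)).transpose * Z j = 1) ∧
      Fwd t.toLinearMap ((Module.End.baseChangeHom k K ((ℕ →₀ k) × A)).comp
        (bigRep k A)).toLinearMap (Z 0) := by
  obtain ⟨T, hT₁, hT₂, hT₃, hT₄⟩ := exists_seeds t s p hps hs hp
  exact exists_chain_baseChange K (not_finiteDimensional_baseChange k K A) t (bigRep k A) T hT₁ hT₂
    hT₃ hT₄ n

/-- If the representation `t` has the regular representation as a direct summand, then `A` embeds
into the Hopf algebra on a chain indexed by the integers. -/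
theorem ofAlg_injective (t : A →ₐ[k] Matrix ι ι k) (s : A →ₗ[k] (ι → k)) (p : (ι → k) →ₗ[k] A)
    (hps : ∀ a, p (s a) = a) (hs : ∀ a b, s (a * b) = (t a).mulVec (s b))
    (hp : ∀ a v, p ((t a).mulVec v) = a * p v)
    (hS : Function.Injective (HopfAlgebra.antipode k (A := A))) [Nonempty ι] :
    Function.Injective (ChainHopf.ofAlg (fun i : ℤ => i + 1) 0 t) :=
  -- the generic choices made for the chains require an infinite field
  ofAlg_injective_of_chains
    (R := Module.End (AlgebraicClosure k) (AlgebraicClosure k ⊗[k] ((ℕ →₀ k) × A)))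
    (bigRep_baseChange_injective (AlgebraicClosure k)) hS
    (exists_chain_bigRep (AlgebraicClosure k) t s p hps hs hp)

end ChainExistence


/-! ### Sweedler's Hopf algebra -/

section Sweedler

/-- Sweedler's four-dimensional algebra, generated by `g` and `x` subject to the relations
`g² = 1`, `x² = 0`, `x g = - g x`. -/
abbrev Sweedler (k : Type*) [Field k] : Type _ := QuaternionAlgebra k 1 0 0

namespace Sweedler

variable {k : Type*} [Field k]

/-- The grouplike generator. -/
def g : Sweedler k := ⟨0, 1, 0, 0⟩

/-- The skew-primitive generator. -/
def x : Sweedler k := ⟨0, 0, 1, 0⟩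

theorem g_mul_g : (g * g : Sweedler k) = 1 := by ext <;> simp [g]

theorem x_mul_x : (x * x : Sweedler k) = 0 := by ext <;> simp [x]

theorem x_mul_g : (x * g : Sweedler k) = -(g * x) := by ext <;> simp [g, x]

theorem eq_sum (q : Sweedler k) :
    q = q.re • (1 : Sweedler k) + q.imI • g + q.imJ • x + q.imK • (g * x) := by
  ext <;> simp [g, x]

theorem linearMap_ext {W : Type*} [AddCommGroup W] [Module k W] {f h : Sweedler k →ₗ[k] W}
    (h1 : f 1 = h 1) (hg : f g = h g) (hx : f x = h x) (hgx : f (g * x) = h (g * x)) : f = h := by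
  ext q
  rw [eq_sum q]
  simp only [map_add, map_smul, h1, hg, hx, hgx]

variable {E : Type*} [Ring E] [Algebra k E]

theorem algHom_ext {f h : Sweedler k →ₐ[k] E} (hg : f g = h g) (hx : f x = h x) : f = h :=
  QuaternionAlgebra.hom_ext hg hx

/-- The homomorphism determined by the images of the generators. -/
def lift (a b : E) (ha : a * a = 1) (hb : b * b = 0) (hba : b * a = -(a * b)) :
    Sweedler k →ₐ[k] E :=
  QuaternionAlgebra.lift
    { i := a
      j := b
      k := a * b
      i_mul_i := by simp [ha]
      j_mul_j := by simp [hb]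
      i_mul_j := rfl
      j_mul_i := by simp [hba] }

variable {a b : E} (ha : a * a = 1) (hb : b * b = 0) (hba : b * a = -(a * b))

@[simp] theorem lift_g : lift (k := k) a b ha hb hba g = a := by
  change QuaternionAlgebra.Basis.lift _ _ = _
  simp [QuaternionAlgebra.Basis.lift, g]

@[simp] theorem lift_x : lift (k := k) a b ha hb hba x = b := by
  change QuaternionAlgebra.Basis.lift _ _ = _
  simp [QuaternionAlgebra.Basis.lift, x]

/-- The comultiplication, `Δ g = g ⊗ g` and `Δ x = x ⊗ 1 + g ⊗ x`. -/
def comulHom : Sweedler k →ₐ[k] Sweedler k ⊗[k] Sweedler k :=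
  lift (g ⊗ₜ g) (x ⊗ₜ 1 + g ⊗ₜ x)
    (by simp [g_mul_g, Algebra.TensorProduct.one_def])
    (by simp [add_mul, mul_add, g_mul_g, x_mul_x, x_mul_g, TensorProduct.neg_tmul])
    (by simp [add_mul, mul_add, g_mul_g, x_mul_g, TensorProduct.neg_tmul, TensorProduct.tmul_neg,
      add_comm])

/-- The counit, `ε g = 1` and `ε x = 0`. -/
def counitHom : Sweedler k →ₐ[k] k := lift 1 0 (by simp) (by simp) (by simp)

@[simp] theorem comulHom_g : comulHom (k := k) g = g ⊗ₜ g := lift_g _ _ _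

@[simp] theorem comulHom_x : comulHom (k := k) x = x ⊗ₜ 1 + g ⊗ₜ x := lift_x _ _ _

@[simp] theorem counitHom_g : counitHom (k := k) g = 1 := lift_g _ _ _

@[simp] theorem counitHom_x : counitHom (k := k) x = 0 := lift_x _ _ _

instance : Bialgebra k (Sweedler k) :=
  Bialgebra.ofAlgHom comulHom counitHom
    (algHom_ext (by simp) (by
      simp [TensorProduct.add_tmul, TensorProduct.tmul_add, Algebra.TensorProduct.one_def,
        add_assoc]))
    (algHom_ext (by simp) (by simp))
    (algHom_ext (by simp) (by simp))

theorem comul_g : comul (R := k) (g : Sweedler k) = g ⊗ₜ g := comulHom_g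

theorem comul_x : comul (R := k) (x : Sweedler k) = x ⊗ₜ 1 + g ⊗ₜ x := comulHom_x

theorem counit_g : counit (R := k) (g : Sweedler k) = 1 := counitHom_g

theorem counit_x : counit (R := k) (x : Sweedler k) = 0 := counitHom_x

/-- The antipode, `S g = g`, `S x = - g x`, `S (g x) = x`. -/
def antipodeLin : Sweedler k →ₗ[k] Sweedler k where
  toFun q := ⟨q.re, q.imI, q.imK, -q.imJ⟩
  map_add' p q := by ext <;> simp [add_comm]
  map_smul' c q := by ext <;> simp

theorem antipodeLin_one : antipodeLin (1 : Sweedler k) = 1 := by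
  ext <;> simp [antipodeLin]

theorem antipodeLin_g : antipodeLin (g : Sweedler k) = g := by
  ext <;> simp [antipodeLin, g]

theorem antipodeLin_x : antipodeLin (x : Sweedler k) = -(g * x) := by
  ext <;> simp [antipodeLin, g, x]

theorem antipodeLin_g_mul_x : antipodeLin (g * x : Sweedler k) = x := by
  ext <;> simp [antipodeLin, g, x]

instance : HopfAlgebra k (Sweedler k) where
  antipode := antipodeLin
  mul_antipode_rTensor_comul := by
    apply linearMap_ext <;> simp [comul_g, comul_x, counit_g, counit_x, antipodeLin_one,
      antipodeLin_g, antipodeLin_x, antipodeLin_g_mul_x, g_mul_g, Algebra.TensorProduct.one_def,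
      mul_add, x_mul_g]
  mul_antipode_lTensor_comul := by
    apply linearMap_ext <;> simp [comul_g, comul_x, counit_g, counit_x, antipodeLin_one,
      antipodeLin_g, antipodeLin_x, antipodeLin_g_mul_x, g_mul_g, Algebra.TensorProduct.one_def,
      mul_add, ← mul_assoc]
    rw [mul_assoc, x_mul_g, mul_neg, ← mul_assoc, g_mul_g, one_mul, neg_add_cancel]

instance : FiniteDimensional k (Sweedler k) :=
  Module.Finite.of_basis (QuaternionAlgebra.basisOneIJK (R := k) 1 0 0)

/-- Sweedler's algebra is not semisimple, as its left ideal generated by `x` is annihilated by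
`x` and hence not a direct summand. -/
theorem not_isSemisimpleRing : ¬ IsSemisimpleRing (Sweedler k) := by
  intro h
  obtain ⟨J, hJ⟩ := exists_isCompl (Submodule.span (Sweedler k) {(x : Sweedler k)})
  have h1 : (1 : Sweedler k) ∈ Submodule.span (Sweedler k) {(x : Sweedler k)} ⊔ J := by
    rw [hJ.sup_eq_top]
    trivial
  obtain ⟨e, he, f, hf, hef⟩ := Submodule.mem_sup.1 h1
  obtain ⟨q, rfl⟩ := Submodule.mem_span_singleton.1 he
  have h2 : (x : Sweedler k) * (q • x) = 0 := by
    ext <;> simp [x]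
  have h3 : x ∈ J := by
    have h4 := J.smul_mem x hf
    rw [eq_sub_of_add_eq' hef, smul_sub, smul_eq_mul, smul_eq_mul, h2, mul_one, sub_zero] at h4
    exact h4
  have h5 := Submodule.disjoint_def.1 hJ.disjoint x (Submodule.mem_span_singleton_self x) h3
  have h6 := congrArg (fun q : Sweedler k => q.imJ) h5
  simp [x] at h6

end Sweedler

end Sweedler


/-! ### Nonflat Hopf algebras containing a given Hopf algebra -/

section Conclusion

variable {k A : Type u} [Field k] [Ring A] [HopfAlgebra k A]

theorem nontrivial_of_bialgebra (k A : Type*) [Field k] [Ring A] [Bialgebra k A] :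
    Nontrivial A := by
  refine ⟨0, 1, fun h => ?_⟩
  have := congrArg (counit (R := k)) h
  simp at this

section Representation

variable {V : Type u} {ι : Type} [AddCommGroup V] [Module k V] [Module A V] [IsScalarTower k A V]
  [Fintype ι] [DecidableEq ι] (b : Module.Basis ι k V)

/-- A nonprojective module gives rise to nonflat Hopf algebras: over a flat one, the matrix
relations could be solved over `A` itself, which would split `A ⊗ V → V`. -/
theorem not_flat_of_isComatrix [FiniteDimensional k A] {H : Type u} [Ring H]
    [HopfAlgebra k H] (φ : A →ₐc[k] H) {M : Matrix ι ι H} (hM : IsComatrix k M)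
    (h : Fwd (matrixRep b).toLinearMap (φ : A →ₐ[k] H).toLinearMap M)
    (hV : ¬ Module.Projective A V) :
    ¬ LeftFlatOver (φ : A →+* H) ∧ ¬ RightFlatOver (φ : A →+* H) := by
  rw [← not_or]
  exact fun hf => hV (projective_of_flat b φ M _ h hM.mul_antipode hM.antipode_mul hM.counit hf)

/-- `A` embeds into the Hopf algebra on a chain indexed by the integers. -/
theorem ofAlg_injective_of_summand [FiniteDimensional k A] (hV : HasCyclicFreeSummand A V) :
    Function.Injective (ChainHopf.ofAlg (fun i : ℤ => i + 1) 0 (matrixRep (A := A) b)) := by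
  obtain ⟨V₀, V₁, hc, ⟨e⟩⟩ := hV
  let s : A →ₗ[A] V := V₀.subtype ∘ₗ e.symm.toLinearMap
  let p : V →ₗ[A] A := e.toLinearMap ∘ₗ V₀.projectionOnto V₁ hc
  have hps (a : A) : p (s a) = a := by
    simp [p, s]
  have hrep (a : A) (v : V) : b.equivFun (a • v) = (matrixRep b a).mulVec (b.equivFun v) := by
    ext i
    exact repr_smul b a v i
  have hrep' (a : A) (v : ι → k) :
      b.equivFun.symm ((matrixRep b a).mulVec v) = a • b.equivFun.symm v := by
    rw [LinearEquiv.symm_apply_eq, hrep, LinearEquiv.apply_symm_apply]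
  have : Nonempty ι := by
    by_contra hι
    rw [not_nonempty_iff] at hι
    have := nontrivial_of_bialgebra k A
    have h0 : s 1 = 0 := b.equivFun.injective (Subsingleton.elim _ _)
    have h1 := hps 1
    rw [h0, map_zero] at h1
    exact zero_ne_one h1
  obtain ⟨_, hS, _⟩ := exists_frobenius k A
  refine ofAlg_injective (matrixRep b) (b.equivFun.toLinearMap ∘ₗ s.restrictScalars k)
    (p.restrictScalars k ∘ₗ b.equivFun.symm.toLinearMap) (fun a => ?_) (fun a c => ?_)
    (fun a v => ?_) hS.1
  · simp [hps]
  · simp only [LinearMap.comp_apply, LinearMap.restrictScalars_apply, LinearEquiv.coe_coe]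
    rw [← hrep, ← map_smul, smul_eq_mul]
  · simp only [LinearMap.comp_apply, LinearMap.restrictScalars_apply, LinearEquiv.coe_coe]
    rw [hrep', map_smul, smul_eq_mul]

/-- The canonical map from `A` to the free Hopf algebra on `Coend V` is injective, because it can be
composed with a map to the Hopf algebra on a chain indexed by the integers. -/
theorem IsFreeHopfAlgebra.injective [FiniteDimensional k A] [FiniteDimensional k V]
    (hV : HasCyclicFreeSummand A V) {H : Type u} [Ring H] [HopfAlgebra k H]
    {f : Coend k V →ₗc[k] H} {φ : A →ₐc[k] H} (h : IsFreeHopfAlgebra f φ) :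
    Function.Injective φ := by
  let b := Module.finBasis k V
  have hcomp : IsCompatible
      (coendHom b _ (isComatrix_mat (fun i : ℤ => i + 1) 0 (matrixRep (A := A) b) 0))
      (ChainHopf.ofHopf (fun i : ℤ => i + 1) 0 (matrixRep (A := A) b)) := by
    rw [isCompatible_iff b]
    simp only [coendHom_coeff]
    exact (ChainHopf.isChain (fun i : ℤ => i + 1) 0 (matrixRep (A := A) b)).fwd
  obtain ⟨g, ⟨_, hg⟩, _⟩ := h.existsUnique_lift _ _ _ hcomp
  intro x y hxy
  apply ofAlg_injective_of_summand b hV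
  have hx := hg x
  have hy := hg y
  rw [ChainHopf.ofHopf_apply] at hx hy
  rw [← hx, ← hy, hxy]

theorem IsFreeHopfAlgebra.not_flat [FiniteDimensional k A] [FiniteDimensional k V]
    (hV : ¬ Module.Projective A V)
    {H : Type u} [Ring H] [HopfAlgebra k H] {f : Coend k V →ₗc[k] H} {φ : A →ₐc[k] H}
    (h : IsFreeHopfAlgebra f φ) :
    ¬ LeftFlatOver (φ : A →+* H) ∧ ¬ RightFlatOver (φ : A →+* H) :=
  let b := Module.finBasis k V
  not_flat_of_isComatrix b φ (isComatrix_of_coalgHom b f) ((isCompatible_iff b f φ).1 h.compatible)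
    hV

end Representation

/-- The direct sum of the regular representation and the quotient of `A` by a left ideal without
a complement is not projective. -/
theorem exists_not_projective_hasCyclicFreeSummand [FiniteDimensional k A]
    (hA : ¬ IsSemisimpleRing A) :
    ∃ (V : Type u) (_ : AddCommGroup V) (_ : Module k V) (_ : Module A V)
      (_ : IsScalarTower k A V), FiniteDimensional k V ∧ ¬ Module.Projective A V ∧
        HasCyclicFreeSummand A V := by
  obtain ⟨I, hI⟩ : ∃ I : Submodule A A, ¬ ∃ J, IsCompl I J := by
    by_contra! h
    exact hA (@IsSemisimpleModule.mk A _ A _ _ ⟨h⟩)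
  have hfin : FiniteDimensional k (A ⧸ I) :=
    Module.Finite.of_surjective (I.mkQ.restrictScalars k) I.mkQ_surjective
  refine ⟨A × (A ⧸ I), inferInstance, inferInstance, inferInstance, inferInstance, inferInstance,
    fun h => hI ?_, LinearMap.range (LinearMap.inl A A (A ⧸ I)),
    LinearMap.range (LinearMap.inr A A (A ⧸ I)), LinearMap.isCompl_range_inl_inr,
    ⟨(LinearEquiv.ofInjective _ LinearMap.inl_injective).symm⟩⟩
  have hp : Module.Projective A (A ⧸ I) := Module.Projective.of_split
    (LinearMap.inr A A (A ⧸ I)) (LinearMap.snd A A (A ⧸ I)) (LinearMap.snd_comp_inr ..)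
  obtain ⟨s, hs⟩ := Module.projective_lifting_property I.mkQ LinearMap.id I.mkQ_surjective
  have hs' (x : A ⧸ I) : I.mkQ (s x) = x := congrArg (fun f => f x) hs
  let f : A →ₗ[A] I := (LinearMap.id - s ∘ₗ I.mkQ).codRestrict I fun x => by
    rw [← Submodule.Quotient.mk_eq_zero]
    change I.mkQ (x - s (I.mkQ x)) = 0
    rw [map_sub, hs', sub_self]
  refine ⟨LinearMap.ker f, LinearMap.isCompl_of_proj fun x => Subtype.ext ?_⟩
  have hx : I.mkQ x = 0 := (Submodule.Quotient.mk_eq_zero I).2 x.2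
  change (x : A) - s (I.mkQ x) = x
  rw [hx, map_zero, sub_zero]

/-- A finite-dimensional nonsemisimple Hopf algebra embeds into a Hopf algebra with bijective
antipode that is not flat over it. -/
theorem exists_hopfAlgebra_not_flat [FiniteDimensional k A] (hA : ¬ IsSemisimpleRing A) :
    ∃ (H : Type u) (_ : Ring H) (_ : HopfAlgebra k H) (φ : A →ₐc[k] H),
      Function.Injective φ ∧ Function.Bijective (HopfAlgebra.antipode k (A := H)) ∧
      ¬ LeftFlatOver (φ : A →+* H) ∧ ¬ RightFlatOver (φ : A →+* H) := by
  obtain ⟨V, _, _, _, _, _, hV, hV'⟩ := exists_not_projective_hasCyclicFreeSummand (k := k) hA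
  let b := Module.finBasis k V
  obtain ⟨_, hS, _⟩ := exists_frobenius k A
  refine ⟨ChainHopf (fun i : ℤ => i + 1) 0 (matrixRep (A := A) b), inferInstance, inferInstance,
    ChainHopf.ofHopf _ _ _, fun x y hxy => ?_, bijective_antipode_chainHopf _ hS,
    not_flat_of_isComatrix b _ (isComatrix_mat (fun i : ℤ => i + 1) 0 (matrixRep b) 0)
      (ChainHopf.isChain (fun i : ℤ => i + 1) 0 (matrixRep (A := A) b)).fwd hV⟩
  apply ofAlg_injective_of_summand b hV'
  rw [ChainHopf.ofHopf_apply, ChainHopf.ofHopf_apply] at hxy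
  exact hxy

end Conclusion

end

theorem theorem0p1 (k : Type u) [Field k] :
    (∀ (A : Type u) [Ring A] [HopfAlgebra k A] [FiniteDimensional k A], ¬ IsSemisimpleRing A →
      -- a Hopf algebra over its Hopf subalgebra `A`, flat on neither side
      (∃ (H : Type u) (_ : Ring H) (_ : HopfAlgebra k H) (φ : A →ₐc[k] H),
        Function.Injective φ ∧
        Function.Bijective (HopfAlgebra.antipode k (A := H)) ∧
        ¬ LeftFlatOver (φ : A →+* H) ∧ ¬ RightFlatOver (φ : A →+* H)) ∧
      -- modules `V` as required in the construction exist
      (∃ (V : Type u) (_ : AddCommGroup V) (_ : Module k V) (_ : Module A V)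
        (_ : IsScalarTower k A V), FiniteDimensional k V ∧ ¬ Module.Projective A V ∧
          HasCyclicFreeSummand A V) ∧
      -- for every such `V` one may take `H(Coend V, A)`
      (∀ (V : Type u) [AddCommGroup V] [Module k V] [Module A V] [IsScalarTower k A V]
        [FiniteDimensional k V], ¬ Module.Projective A V → HasCyclicFreeSummand A V →
          (∃ (H : Type u) (_ : Ring H) (_ : HopfAlgebra k H)
            (f : Coend k V →ₗc[k] H) (φ : A →ₐc[k] H), IsFreeHopfAlgebra f φ) ∧
          (∀ (H : Type u) [Ring H] [HopfAlgebra k H]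
            (f : Coend k V →ₗc[k] H) (φ : A →ₐc[k] H), IsFreeHopfAlgebra f φ →
              Function.Injective φ ∧
              ¬ LeftFlatOver (φ : A →+* H) ∧ ¬ RightFlatOver (φ : A →+* H)))) ∧
    -- Schauenburg's question has a negative answer
    (∃ (A H : Type u) (_ : Ring A) (_ : HopfAlgebra k A) (_ : Ring H) (_ : HopfAlgebra k H)
      (φ : A →ₐc[k] H), Function.Injective φ ∧
        Function.Bijective (HopfAlgebra.antipode k (A := A)) ∧
        Function.Bijective (HopfAlgebra.antipode k (A := H)) ∧
        ¬ LeftFlatOver (φ : A →+* H) ∧ ¬ RightFlatOver (φ : A →+* H)) := by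
  refine ⟨fun A _ _ _ hA => ⟨exists_hopfAlgebra_not_flat hA,
    exists_not_projective_hasCyclicFreeSummand hA, fun V _ _ _ _ _ hV hV' => ⟨?_, ?_⟩⟩, ?_⟩
  · exact ⟨_, _, _, _, _, isFreeHopfAlgebra_chainHopf (Module.finBasis k V)⟩
  · exact fun H _ _ f φ h => ⟨h.injective hV', h.not_flat hV⟩
  · obtain ⟨H, _, _, φ, hφ, hH, hf⟩ :=
      exists_hopfAlgebra_not_flat (k := k) (Sweedler.not_isSemisimpleRing (k := k))
    obtain ⟨_, hS, _⟩ := exists_frobenius k (Sweedler k)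
    exact ⟨Sweedler k, H, _, _, _, _, φ, hφ, hS, hH, hf⟩
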